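/- Let $n\ge 2$. For a smooth immersion $F:M^n\to\mathbb{R}^{n+1}$ with the induced metric, let $A$ be its second fundamental form. $F$ is \emph{minimal} if its mean curvature vanishes, \emph{flat} if $A\equiv 0$, and, for $\delta\in\mathbb{R}$, \emph{$\delta$-stable} if \[ \delta\int_M |A|^2\varphi^2\le\int_M|\nabla\varphi|^2\qquad\text{for every smooth compactly supported function }\varphi\text{ on }M . \] An \emph{immersed cone} in $\mathbb{R}^{n+1}$ (with vertex at the origin, the vertex being removed) is the immersion $S\times(0,\infty)\to\mathbb{R}^{n+1}$, $(p,r)\mapsto r\,\xi(p)$, where $\xi:S\to\mathbb{S}^n$ is a smooth immersion of a compact $(n-1)$-dimensional manifold $S$ without boundary. (1) If $\delta>\dfrac{(n-2)^2}{4(n-1)}$, then every $\delta$-stable immersed minimal cone in $\mathbb{R}^{n+1}$ is flat. (2) The bound is sharp for $n\ge3$: for all integers $p,q\ge1$ with $p+q=n-1$, the Simons-type cone \[ C_{p,q}=\{(x,y)\in\mathbb{R}^{p+1}\times\mathbb{R}^{q+1}: q|x|^2=p|y|^2\}, \] with its vertex removed, is an embedded minimal cone over the product of spheres $\mathbb{S}^p\big(\sqrt{p/(n-1)}\big)\times\mathbb{S}^q\big(\sqrt{q/(n-1)}\big)$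 which is $\frac{(n-2)^2}{4(n-1)}$-stable and not flat. -/

import Mathlib

open scoped Manifold ContDiff

noncomputable section

namespace DeltaStable

universe uE uH uM uV

section Immersions

/-! Throughout, `M` is a smooth manifold modelled on the finite-dimensional space `E`, `V` is a
Euclidean space (a finite-dimensional real inner product space), and `F : M → V` is a map, in
practice a smooth immersion; `M` carries the metric induced by `F`. -/

variable {E : Type uE} [NormedAddCommGroup E] [NormedSpace ℝ E] [FiniteDimensional ℝ E]
  {H : Type uH} [TopologicalSpace H] (I : ModelWithCorners ℝ E H)
  {M : Type uM} [TopologicalSpace M] [ChartedSpace H M]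
  {V : Type uV} [NormedAddCommGroup V] [InnerProductSpace ℝ V] [FiniteDimensional ℝ V]

/-- `F` is a smooth immersion: it is smooth and its differential is injective at every point. -/
def IsSmoothImmersion (F : M → V) : Prop :=
  ContMDiff I 𝓘(ℝ, V) ∞ F ∧ ∀ x : M, Function.Injective (mfderiv I 𝓘(ℝ, V) F x)

/-- The expression of a vector-valued map `f` in the preferred chart of `M` around `c`. -/
def inChart {W : Type*} (f : M → W) (c : M) : E → W :=
  f ∘ (extChartAt I c).symm

/-- The coordinate basis of the model space with respect to which components are taken. -/
abbrev coordBasis (E : Type uE) [NormedAddCommGroup E] [NormedSpace ℝ E]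
    [FiniteDimensional ℝ E] : Module.Basis (Fin (Module.finrank ℝ E)) ℝ E :=
  Module.finBasis ℝ E

/-- The matrix `(g i j)` of the induced metric, in the chart around `c`, at the coordinate
point `y`: `g i j = ⟪∂ᵢ F, ∂ⱼ F⟫`. -/
def metricMatrix (F : M → V) (c : M) (y : E) :
    Matrix (Fin (Module.finrank ℝ E)) (Fin (Module.finrank ℝ E)) ℝ :=
  Matrix.gram ℝ fun i => fderiv ℝ (inChart I F c) y (coordBasis E i)

/-- The inverse `(gⁱʲ)` of the matrix of the induced metric at the point `x`, in the preferred
chart around `x`. -/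
def inverseMetric (F : M → V) (x : M) :
    Matrix (Fin (Module.finrank ℝ E)) (Fin (Module.finrank ℝ E)) ℝ :=
  (metricMatrix I F x (extChartAt I x x))⁻¹

/-- The second fundamental form of `F` at `x`, applied to coordinate vectors `u`, `v`: the
component of `D²F(u, v)` orthogonal to the tangent space. If `ν` is a unit normal at `x`, this is
`-A(u, v) ν`, where `A(X, Y) = - ⟪D_X Y, ν⟫`. -/
def secondFundamentalForm (F : M → V) (x : M) (u v : E) : V :=
  ((fderiv ℝ (inChart I F x) (extChartAt I x x)).toLinearMap.range)ᗮ.starProjection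
    (fderiv ℝ (fderiv ℝ (inChart I F x)) (extChartAt I x x) u v)

/-- The components `A i j` of the second fundamental form. -/
def secondFundamentalCoeff (F : M → V) (x : M) (i j : Fin (Module.finrank ℝ E)) : V :=
  secondFundamentalForm I F x (coordBasis E i) (coordBasis E j)

/-- The squared norm `|A|² = gⁱᵏ gʲˡ ⟪A i j, A k l⟫` of the second fundamental form. -/
def normSqA (F : M → V) (x : M) : ℝ :=
  ∑ i, ∑ j, ∑ k, ∑ l, inverseMetric I F x i k * inverseMetric I F x j l *
    inner ℝ (secondFundamentalCoeff I F x i j) (secondFundamentalCoeff I F x k l)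

/-- The mean curvature vector `gⁱʲ A i j`. -/
def meanCurvatureVector (F : M → V) (x : M) : V :=
  ∑ i, ∑ j, inverseMetric I F x i j • secondFundamentalCoeff I F x i j

/-- The squared length `|∇φ|² = gⁱʲ ∂ᵢφ ∂ⱼφ` of the gradient of a function `φ` on `M`. -/
def gradNormSq (F : M → V) (φ : M → ℝ) (x : M) : ℝ :=
  ∑ i, ∑ j, inverseMetric I F x i j *
    fderiv ℝ (inChart I φ x) (extChartAt I x x) (coordBasis E i) *
    fderiv ℝ (inChart I φ x) (extChartAt I x x) (coordBasis E j)

/-- `F` is minimal: its mean curvature vanishes identically. -/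
def IsMinimal (F : M → V) : Prop :=
  ∀ x : M, meanCurvatureVector I F x = 0

/-- `F` is flat (totally geodesic): its second fundamental form vanishes identically. -/
def IsFlat (F : M → V) : Prop :=
  ∀ (x : M) (u v : E), secondFundamentalForm I F x u v = 0

variable (M) in
/-- A smooth partition of unity subordinate to the cover of `M` by the domains of its preferred
charts. -/
def chartPartition [SigmaCompactSpace M] [T2Space M] [I.Boundaryless] [IsManifold I ∞ M] :
    SmoothPartitionOfUnity M I M Set.univ :=
  (SmoothPartitionOfUnity.exists_isSubordinate_chartAt_source I M).choose

/-- The integral over `M`, with respect to the volume of the metric induced by `F`, of a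
continuous function `f` with compact support: `∑_c ∫ (ρ_c f) √(det g) dy`, where `(ρ_c)` is a
smooth partition of unity subordinate to the charts, and `dy` is Lebesgue measure in the
coordinates. Only finitely many terms of the sum are nonzero. -/
def integral [SigmaCompactSpace M] [T2Space M] [I.Boundaryless] [IsManifold I ∞ M]
    (F : M → V) (f : M → ℝ) : ℝ :=
  letI : MeasurableSpace E := borel E
  haveI : BorelSpace E := ⟨rfl⟩
  ∑ᶠ c : M, ∫ y in (extChartAt I c).target,
    inChart I (fun x => chartPartition I M c x * f x) c y *
      Real.sqrt (metricMatrix I F c y).det ∂(coordBasis E).addHaar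

/-- `F` is `δ`-stable: `δ ∫ |A|² φ² ≤ ∫ |∇φ|²` for all smooth functions `φ` on `M` with compact
support. -/
def IsDeltaStable [SigmaCompactSpace M] [T2Space M] [I.Boundaryless] [IsManifold I ∞ M]
    (F : M → V) (δ : ℝ) : Prop :=
  ∀ φ : M → ℝ, ContMDiff I 𝓘(ℝ, ℝ) ∞ φ → HasCompactSupport φ →
    δ * integral I F (fun x => normSqA I F x * φ x ^ 2) ≤ integral I F (gradNormSq I F φ)

end Immersions

section Cones

/-- The cone, with vertex at the origin and without its vertex, over a map `ξ : S → V` into the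
unit sphere: its points are `r ξ(p)` with `p ∈ S` and `r > 0`. It is parametrized by `S × ℝ`,
with `r = exp t`. -/
def coneMap {S : Type uM} {V : Type uV} [NormedAddCommGroup V] [InnerProductSpace ℝ V]
    (ξ : S → V) : S × ℝ → V :=
  fun z => Real.exp z.2 • ξ z.1

variable {E : Type uE} [NormedAddCommGroup E] [NormedSpace ℝ E] [FiniteDimensional ℝ E]
  {H : Type uH} [TopologicalSpace H] (I : ModelWithCorners ℝ E H)
  {S : Type uM} [TopologicalSpace S] [ChartedSpace H S]
  {V : Type uV} [NormedAddCommGroup V] [InnerProductSpace ℝ V] [FiniteDimensional ℝ V]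

/-- `ξ` is a smooth immersion into the unit sphere of `V`. -/
def IsSphericalImmersion (ξ : S → V) : Prop :=
  IsSmoothImmersion I ξ ∧ ∀ p : S, ‖ξ p‖ = 1

end Cones

section SimonsCones

/-- The Euclidean space `ℝ^(p+1) × ℝ^(q+1)`, with the Euclidean norm. -/
abbrev ProdSpace (p q : ℕ) : Type :=
  WithLp 2 (EuclideanSpace ℝ (Fin (p + 1)) × EuclideanSpace ℝ (Fin (q + 1)))

/-- The unit sphere of dimension `p`. -/
abbrev UnitSphere (p : ℕ) : Type :=
  Metric.sphere (0 : EuclideanSpace ℝ (Fin (p + 1))) 1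

/-- The Simons-type cone `C_{p,q} = {(x, y) ∈ ℝ^(p+1) × ℝ^(q+1) : q |x|² = p |y|²}`. -/
def simonsCone (p q : ℕ) : Set (ProdSpace p q) :=
  {z | (q : ℝ) * ‖z.fst‖ ^ 2 = (p : ℝ) * ‖z.snd‖ ^ 2}

/-- The link of `C_{p,q}`, a product of round spheres, with its embedding in the unit sphere. -/
def simonsLink (p q : ℕ) : UnitSphere p × UnitSphere q → ProdSpace p q :=
  fun z => WithLp.toLp 2
    (Real.sqrt ((p : ℝ) / (p + q)) • (z.1 : EuclideanSpace ℝ (Fin (p + 1))),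
      Real.sqrt ((q : ℝ) / (p + q)) • (z.2 : EuclideanSpace ℝ (Fin (q + 1))))

end SimonsCones

end DeltaStable

end

/-!
Stable minimal cones are compared with the critical constant `(n - 2)² / (4 (n - 1))` of Hardy's
inequality. Write `m = n - 1`, `r = |x|` and `f = |x|² |A|²`; on a cone, `f` is homogeneous of
degree zero.

Calculus on an immersed hypersurface is done without a connection. For a constant vector `v` of the
ambient space, `tanD I F v u` is the derivative of `u` along the tangential part of `v`. These
operators are derivations, their commutators are given by the shape operator
(`IsUnitNormalOn.tanD_comm_eq`), and on a minimal hypersurface the tangential part of `v` is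
divergence free, so that tangential derivatives of compactly supported functions integrate to zero
(`integral_tanD_eq_zero`). Green's formula, the first variation formula for dilations and Hardy's
inequality on minimal cones (`IsMinimalCone.hardy`) follow.

For the flatness of stable cones, the relations between the tangential derivatives, the unit normal
and the position vector are collected in `MinimalConeAlgebra`, and Simons' identity is an algebraic
consequence of them. Together with the sharp Kato inequality for trace-free symmetric tensors in
dimension `m` (`kato_trace_free`), it yields `simons_kato_cone`:
`Y = Δf / 2 - m |A|² + |x|² |A|⁴` is nonnegative and `(1 + 2 / m) |∇f|² / 4 ≤ f Y`.
Stability is tested with `(f + ε) ^ (δ / 2) r ^ (-(m - 1) / 2) χ(log r)`. The gradient of the first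
factor is absorbed by Simons' inequality because `δ ≥ 1 - 2 / m`, which holds beyond the critical
constant since `(m - 1)² / (4 m) - (1 - 2 / m) = (m - 3)² / (4 m)`. The radial factor costs
`(m - 1)² / 4 < δ m` and a multiple of the integral of `χ' ^ 2`, which is small compared to that of
`χ ^ 2` for a wide cutoff function (`exists_cutoff`). What remains is that the integral of
`f ^ δ r ^ (-n) χ ^ 2` is at most a multiple of `ε ^ δ`
(`IsMinimalCone.integral_scaledNormSqA_rpow_le`), whence `f = 0`.

For the sharpness, a Simons-type cone is the zero set of the quadratic form of a self-adjoint
operator `K` with `K² = c K + 1` and trace `c`. The unit normal of such a cone at `x` is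
`K x / |x|`, and linear algebra shows that the cone is minimal and that `|A|² = m / |x|²`
(`IsQuadraticCone.isMinimal`, `IsQuadraticCone.normSqA_eq`). Its stability inequality for the
critical constant is then Hardy's inequality in dimension `n`.
-/

open scoped Manifold ContDiff

set_option linter.unusedSectionVars false

noncomputable section

namespace DeltaStable

universe uE uH uM uV

/-! ### The left inverse of an injective linear map -/

section LinearAlgebra
variable {E : Type uE} [NormedAddCommGroup E] [NormedSpace ℝ E] [FiniteDimensional ℝ E]
  {V : Type uV} [NormedAddCommGroup V] [InnerProductSpace ℝ V]

/-- The Gram matrix, in the coordinate basis of `E`, of the pullback of the inner product of `V`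
under a linear map `T : E → V`. -/
def gramOf (T : E →L[ℝ] V) :
    Matrix (Fin (Module.finrank ℝ E)) (Fin (Module.finrank ℝ E)) ℝ :=
  Matrix.gram ℝ fun i => T (coordBasis E i)

/-- The left inverse `(T* T)⁻¹ T*` of an injective linear map `T : E → V`, written in the
coordinate basis of `E`; `T ∘ pinv T` is the orthogonal projection onto the range of `T`. -/
def pinv (T : E →L[ℝ] V) : V →L[ℝ] E :=
  ∑ i, ∑ j, (gramOf T)⁻¹ i j •
    (innerSL ℝ (T (coordBasis E i))).smulRight (coordBasis E j)

theorem pinv_apply (T : E →L[ℝ] V) (v : V) :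
    pinv T v = ∑ i, ∑ j, ((gramOf T)⁻¹ i j * inner ℝ (T (coordBasis E i)) v) • coordBasis E j := by
  simp [pinv, smul_smul]

theorem gramOf_isSymm (T : E →L[ℝ] V) (i j) : gramOf T i j = gramOf T j i := by
  simp [gramOf, Matrix.gram_apply, real_inner_comm]

theorem gramOf_transpose (T : E →L[ℝ] V) : (gramOf T).transpose = gramOf T := by
  ext i j; exact gramOf_isSymm T j i

theorem gramOf_inv_isSymm (T : E →L[ℝ] V) (i j) : (gramOf T)⁻¹ i j = (gramOf T)⁻¹ j i := by
  conv_lhs => rw [← gramOf_transpose T, ← Matrix.transpose_nonsing_inv]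
  rfl

theorem gramOf_det_pos {T : E →L[ℝ] V} (hT : Function.Injective T) : 0 < (gramOf T).det := by
  have h : LinearIndependent ℝ fun i => T (coordBasis E i) :=
    (coordBasis E).linearIndependent.map' (T : E →ₗ[ℝ] V) (LinearMap.ker_eq_bot.2 hT)
  exact (Matrix.posDef_gram_of_linearIndependent h).det_pos

theorem gramOf_inv_mul {T : E →L[ℝ] V} (hT : Function.Injective T) :
    (gramOf T)⁻¹ * gramOf T = 1 :=
  Matrix.nonsing_inv_mul _ (isUnit_iff_ne_zero.2 (gramOf_det_pos hT).ne')

theorem pinv_comp_apply {T : E →L[ℝ] V} (hT : Function.Injective T) (e : E) :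
    pinv T (T e) = e := by
  suffices h : ((pinv T).comp T : E →ₗ[ℝ] E) = LinearMap.id from
    congrArg (fun f : E →ₗ[ℝ] E => f e) h
  refine (coordBasis E).ext fun k => ?_
  have : ∀ j, ∑ i, (gramOf T)⁻¹ i j * inner ℝ (T (coordBasis E i)) (T (coordBasis E k)) =
      if j = k then 1 else 0 := by
    intro j
    have h := congrFun (congrFun (gramOf_inv_mul hT) j) k
    rw [Matrix.mul_apply, Matrix.one_apply] at h
    rw [← h]
    refine Finset.sum_congr rfl fun i _ => ?_
    rw [gramOf_inv_isSymm]; rfl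
  simp only [ContinuousLinearMap.coe_coe, LinearMap.id_apply,
    ContinuousLinearMap.comp_apply, pinv_apply]
  rw [Finset.sum_comm]
  simp_rw [← Finset.sum_smul, this]
  simp

theorem inner_apply_pinv {T : E →L[ℝ] V} (hT : Function.Injective T) (v : V) (e : E) :
    inner ℝ (T e) (T (pinv T v)) = inner ℝ (T e) v := by
  suffices h : (innerₗ V).flip (T (pinv T v)) ∘ₗ (T : E →ₗ[ℝ] V) =
      (innerₗ V).flip v ∘ₗ (T : E →ₗ[ℝ] V) from congrArg (fun f : E →ₗ[ℝ] ℝ => f e) h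
  refine (coordBasis E).ext fun k => ?_
  have : ∀ i, ∑ j, (gramOf T)⁻¹ i j * inner ℝ (T (coordBasis E k)) (T (coordBasis E j)) =
      if i = k then 1 else 0 := by
    intro j
    have h := congrFun (congrFun (gramOf_inv_mul hT) j) k
    rw [Matrix.mul_apply, Matrix.one_apply] at h
    rw [← h]
    refine Finset.sum_congr rfl fun i _ => ?_
    rw [gramOf_isSymm]; rfl
  change inner ℝ (T (coordBasis E k)) (T (pinv T v)) = inner ℝ (T (coordBasis E k)) v
  have h2 : ∀ i, ∑ j, (gramOf T)⁻¹ i j * inner ℝ (T (coordBasis E i)) v *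
      inner ℝ (T (coordBasis E k)) (T (coordBasis E j)) =
      inner ℝ (T (coordBasis E i)) v * if i = k then 1 else 0 := by
    intro i
    rw [← this, Finset.mul_sum]
    exact Finset.sum_congr rfl fun j _ => by ring
  simp only [pinv_apply, map_sum, map_smul, inner_sum, inner_smul_right, h2]
  simp

/-- `T (pinv T v)` is the only vector in the range of `T` with the same inner products as `v`
with this range. -/
theorem pinv_eq_of_inner {T : E →L[ℝ] V} (hT : Function.Injective T) {v : V} {e : E}
    (h : ∀ e', inner ℝ (T e') (T e) = inner ℝ (T e') v) : pinv T v = e := by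
  apply hT
  rw [← sub_eq_zero, ← inner_self_eq_zero (𝕜 := ℝ)]
  have h1 : ∀ e', inner ℝ (T e') (T (pinv T v) - T e) = 0 := fun e' => by
    rw [inner_sub_right, inner_apply_pinv hT, h, sub_self]
  rw [inner_sub_left, h1, h1, sub_self]

theorem pinv_eq_zero {T : E →L[ℝ] V} (hT : Function.Injective T) {v : V}
    (h : ∀ e', inner ℝ (T e') v = 0) : pinv T v = 0 :=
  pinv_eq_of_inner hT fun e' => by simp [h]

/-- Under a reparametrization `Λ` of the domain, `pinv` changes contravariantly; hence derivatives
in the direction `pinv T v` do not depend on the coordinates. -/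
theorem pinv_comp_equiv {T T' : E →L[ℝ] V} (hT : Function.Injective T)
    (hT' : Function.Injective T') {Λ : E →L[ℝ] E} (h : T' = T.comp Λ) (hΛ : Function.Surjective Λ)
    (v : V) : Λ (pinv T' v) = pinv T v := by
  symm
  apply pinv_eq_of_inner hT
  intro e
  obtain ⟨e, rfl⟩ := hΛ e
  have := inner_apply_pinv hT' v e
  rw [h] at this
  simpa [h] using this

theorem starProjection_range_orthogonal [FiniteDimensional ℝ V] {T : E →L[ℝ] V}
    (hT : Function.Injective T) (v : V) :
    (T.toLinearMap.range)ᗮ.starProjection v = v - T (pinv T v) := by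
  refine Submodule.eq_starProjection_of_mem_of_inner_eq_zero ?_ fun z hz => ?_
  · rw [Submodule.mem_orthogonal]
    rintro _ ⟨e, rfl⟩
    change inner ℝ (T e) _ = 0
    rw [inner_sub_right, inner_apply_pinv hT, sub_self]
  · rw [sub_sub_cancel]
    exact Submodule.inner_right_of_mem_orthogonal (LinearMap.mem_range_self _ _) hz

/-- A trace with respect to the pulled back metric is a trace in `V`. -/
theorem sum_gramOf_inv_smul {W : Type*} [AddCommGroup W] [Module ℝ W] {ι : Type*} [Fintype ι]
    (e : OrthonormalBasis ι ℝ V) {T : E →L[ℝ] V} (hT : Function.Injective T)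
    (B : E →ₗ[ℝ] E →ₗ[ℝ] W) :
    ∑ i, ∑ j, (gramOf T)⁻¹ i j • B (coordBasis E i) (coordBasis E j) =
      ∑ a, B (pinv T (e a)) (pinv T (e a)) := by
  have h1 : ∀ (x : E), ∑ a, inner ℝ (e a) (T x) • pinv T (e a) = x := by
    intro x
    conv_rhs => rw [← pinv_comp_apply hT x]
    conv_rhs => rw [← e.sum_repr (T x)]
    simp [map_sum, e.repr_apply_apply]
  have h2 : ∀ a, pinv T (e a) = ∑ i, inner ℝ (e a) (T (coordBasis E i)) •
      ∑ j, (gramOf T)⁻¹ i j • coordBasis E j := by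
    intro a
    rw [pinv_apply]
    refine Finset.sum_congr rfl fun i _ => ?_
    rw [Finset.smul_sum]
    refine Finset.sum_congr rfl fun j _ => ?_
    rw [smul_smul, mul_comm, real_inner_comm]
  have h3 : ∀ a, B (pinv T (e a)) (pinv T (e a)) = ∑ i, ∑ j,
      (gramOf T)⁻¹ i j • B (inner ℝ (e a) (T (coordBasis E i)) • pinv T (e a))
        (coordBasis E j) := by
    intro a
    conv_lhs => rw [h2 a, ← h2 a]
    conv_lhs => arg 2; rw [h2 a]
    simp only [map_sum, map_smul, Finset.smul_sum, LinearMap.smul_apply]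
    refine Finset.sum_congr rfl fun i _ => Finset.sum_congr rfl fun j _ => ?_
    rw [smul_comm]
  simp_rw [h3]
  symm
  rw [Finset.sum_comm]
  refine Finset.sum_congr rfl fun i _ => ?_
  rw [Finset.sum_comm]
  refine Finset.sum_congr rfl fun j _ => ?_
  rw [← Finset.smul_sum]
  congr 1
  conv_rhs => rw [← h1 (coordBasis E i)]
  simp only [map_sum, LinearMap.sum_apply]

end LinearAlgebra

/-! ### Derivatives of determinants -/

section Determinants
variable {E : Type uE} [NormedAddCommGroup E] [NormedSpace ℝ E]
  {κ : Type*} [Fintype κ] [DecidableEq κ]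

theorem contDiffOn_matrix_det {A : E → Matrix κ κ ℝ} {U : Set E} {k : ℕ∞ω}
    (hA : ∀ i j, ContDiffOn ℝ k (fun y => A y i j) U) :
    ContDiffOn ℝ k (fun y => (A y).det) U := by
  simp only [Matrix.det_apply']
  exact ContDiffOn.sum fun σ _ => contDiffOn_const.mul (contDiffOn_prod fun i _ => hA _ _)

theorem contDiffOn_matrix_inv {A : E → Matrix κ κ ℝ} {U : Set E} {k : ℕ∞ω}
    (hA : ∀ i j, ContDiffOn ℝ k (fun y => A y i j) U) (h0 : ∀ y ∈ U, (A y).det ≠ 0) (i j : κ) :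
    ContDiffOn ℝ k (fun y => (A y)⁻¹ i j) U := by
  simp only [Matrix.inv_def, Matrix.smul_apply, Ring.inverse_eq_inv', smul_eq_mul,
    Matrix.adjugate_apply]
  refine ((contDiffOn_matrix_det hA).inv h0).mul (contDiffOn_matrix_det fun a b => ?_)
  by_cases h : a = j
  · subst h; simpa using contDiffOn_const
  · simpa [Matrix.updateRow_ne h] using hA a b

/-- Jacobi's formula for the derivative of a determinant. -/
theorem hasFDerivAt_matrix_det {A : E → Matrix κ κ ℝ} {A' : κ → κ → E →L[ℝ] ℝ} {y : E}
    (hA : ∀ i j, HasFDerivAt (fun y => A y i j) (A' i j) y) :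
    HasFDerivAt (fun y => (A y).det) (∑ i, ∑ j, (A y).adjugate j i • A' i j) y := by
  let D : ContinuousMultilinearMap ℝ (fun _ : κ => κ → ℝ) ℝ :=
    ⟨(Matrix.detRowAlternating : (κ → ℝ) [⋀^κ]→ₗ[ℝ] ℝ).toMultilinearMap,
      Continuous.matrix_det continuous_id⟩
  have h1 : HasFDerivAt (fun y i j => A y i j)
      (ContinuousLinearMap.pi fun i => ContinuousLinearMap.pi fun j => A' i j) y :=
    hasFDerivAt_pi.2 fun i => hasFDerivAt_pi.2 fun j => hA i j
  have h2 := (D.hasFDerivAt (fun i j => A y i j)).comp y h1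
  refine h2.congr_fderiv (ContinuousLinearMap.ext fun h => ?_)
  symm
  have h3 : ∀ i, D (Function.update (fun i j => A y i j) i (fun j => A' i j h)) =
      ∑ j, (A y).adjugate j i * A' i j h := by
    intro i
    have h4 : D (Function.update (fun i j => A y i j) i (fun j => A' i j h)) =
        ((A y).updateRow i (fun j => A' i j h)).det := rfl
    rw [h4, ← Matrix.cramer_transpose_apply, Matrix.cramer_eq_adjugate_mulVec,
      ← Matrix.adjugate_transpose]
    rfl
  rw [ContinuousLinearMap.comp_apply, ContinuousMultilinearMap.linearDeriv_apply]
  simp only [sum_apply, smul_apply, smul_eq_mul]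
  exact Finset.sum_congr rfl fun i _ => (h3 i).symm

end Determinants

/-! ### Tangential derivatives in a coordinate domain -/

section LocalCalculus
variable {E : Type uE} [NormedAddCommGroup E] [NormedSpace ℝ E] [FiniteDimensional ℝ E]
  {V : Type uV} [NormedAddCommGroup V] [InnerProductSpace ℝ V]
  {W : Type*} [NormedAddCommGroup W] [NormedSpace ℝ W]

/-- The derivative of `u` in the direction of the tangential part of the constant vector `v`, for
a parametrized immersed submanifold `G` of `V`. -/
def tanDeriv (G : E → V) (v : V) (u : E → W) (y : E) : W :=
  fderiv ℝ u y (pinv (fderiv ℝ G y) v)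

theorem differentiableAt_of_contDiffOn {u : E → W} {O : Set E} (hO : IsOpen O)
    (hu : ContDiffOn ℝ ∞ u O) {y : E} (hy : y ∈ O) : DifferentiableAt ℝ u y :=
  (hu.contDiffAt (hO.mem_nhds hy)).differentiableAt (by simp)

theorem fderiv_fderiv_comm {u : E → W} {O : Set E} (hO : IsOpen O)
    (hu : ContDiffOn ℝ ∞ u O) {y : E} (hy : y ∈ O) (a b : E) :
    fderiv ℝ (fderiv ℝ u) y a b = fderiv ℝ (fderiv ℝ u) y b a :=
  (hu.contDiffAt (hO.mem_nhds hy)).isSymmSndFDerivAt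
    (by simpa using WithTop.coe_le_coe.2 (le_top : (2 : ℕ∞) ≤ ⊤)) a b

/-- `G` is a smooth immersion of the open set `U` of coordinates. -/
structure IsLocalImmersion (G : E → V) (U : Set E) : Prop where
  isOpen : IsOpen U
  contDiffOn : ContDiffOn ℝ ∞ G U
  injective : ∀ y ∈ U, Function.Injective (fderiv ℝ G y)

namespace IsLocalImmersion
variable {G : E → V} {U : Set E} (hG : IsLocalImmersion G U)
include hG

theorem contDiffOn_fderiv : ContDiffOn ℝ ∞ (fderiv ℝ G) U :=
  hG.contDiffOn.fderiv_of_isOpen hG.isOpen (by simp)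

theorem contDiffOn_gramOf (i j) : ContDiffOn ℝ ∞ (fun y => gramOf (fderiv ℝ G y) i j) U :=
  (hG.contDiffOn_fderiv.clm_apply contDiffOn_const).inner ℝ
    (hG.contDiffOn_fderiv.clm_apply contDiffOn_const)

theorem contDiffOn_gramOf_inv (i j) :
    ContDiffOn ℝ ∞ (fun y => (gramOf (fderiv ℝ G y))⁻¹ i j) U :=
  contDiffOn_matrix_inv hG.contDiffOn_gramOf
    (fun y hy => (gramOf_det_pos (hG.injective y hy)).ne') i j

theorem contDiffOn_sqrt_det :
    ContDiffOn ℝ ∞ (fun y => Real.sqrt (gramOf (fderiv ℝ G y)).det) U :=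
  (contDiffOn_matrix_det hG.contDiffOn_gramOf).sqrt
    fun y hy => (gramOf_det_pos (hG.injective y hy)).ne'

theorem contDiffOn_pinv (v : V) : ContDiffOn ℝ ∞ (fun y => pinv (fderiv ℝ G y) v) U := by
  simp only [pinv_apply]
  exact ContDiffOn.sum fun i _ => ContDiffOn.sum fun j _ =>
    ((hG.contDiffOn_gramOf_inv i j).mul
      ((hG.contDiffOn_fderiv.clm_apply contDiffOn_const).inner ℝ contDiffOn_const)).smul
      contDiffOn_const

theorem contDiffOn_tanDeriv (v : V) {u : E → W} {O : Set E} (hO : IsOpen O) (hOU : O ⊆ U)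
    (hu : ContDiffOn ℝ ∞ u O) : ContDiffOn ℝ ∞ (tanDeriv G v u) O :=
  (hu.fderiv_of_isOpen hO (by simp)).clm_apply ((hG.contDiffOn_pinv v).mono hOU)

/-- The second derivatives of `u` cancel in the commutator of two tangential derivatives. -/
theorem tanDeriv_tanDeriv_sub (a b : V) {u : E → W} {O : Set E} (hO : IsOpen O) (hOU : O ⊆ U)
    (hu : ContDiffOn ℝ ∞ u O) {y : E} (hy : y ∈ O) :
    tanDeriv G a (tanDeriv G b u) y - tanDeriv G b (tanDeriv G a u) y =
      fderiv ℝ u y (fderiv ℝ (fun y => pinv (fderiv ℝ G y) b) y (pinv (fderiv ℝ G y) a) -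
        fderiv ℝ (fun y => pinv (fderiv ℝ G y) a) y (pinv (fderiv ℝ G y) b)) := by
  have h1 : ∀ a b, tanDeriv G a (tanDeriv G b u) y =
      fderiv ℝ (fderiv ℝ u) y (pinv (fderiv ℝ G y) a) (pinv (fderiv ℝ G y) b) +
      fderiv ℝ u y (fderiv ℝ (fun y => pinv (fderiv ℝ G y) b) y (pinv (fderiv ℝ G y) a)) := by
    intro a b
    have h2 : tanDeriv G b u = fun y => fderiv ℝ u y (pinv (fderiv ℝ G y) b) := rfl
    have h3 : DifferentiableAt ℝ (fderiv ℝ u) y :=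
      differentiableAt_of_contDiffOn hO (hu.fderiv_of_isOpen hO (by simp)) hy
    have h4 : DifferentiableAt ℝ (fun y => pinv (fderiv ℝ G y) b) y :=
      differentiableAt_of_contDiffOn hO ((hG.contDiffOn_pinv b).mono hOU) hy
    rw [h2]
    simp only [tanDeriv]
    rw [fderiv_clm_apply h3 h4]
    simp [add_comm]
  rw [h1, h1, fderiv_fderiv_comm hO hu hy, map_sub]
  abel

/-- The commutator of two tangential derivatives is the tangential derivative along the
commutator applied to the immersion. -/
theorem tanDeriv_comm (a b : V) {u : E → W} {O : Set E} (hO : IsOpen O) (hOU : O ⊆ U)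
    (hu : ContDiffOn ℝ ∞ u O) {y : E} (hy : y ∈ O) :
    tanDeriv G a (tanDeriv G b u) y - tanDeriv G b (tanDeriv G a u) y =
      tanDeriv G (tanDeriv G a (tanDeriv G b G) y - tanDeriv G b (tanDeriv G a G) y) u y := by
  rw [hG.tanDeriv_tanDeriv_sub a b hO hOU hu hy,
    hG.tanDeriv_tanDeriv_sub a b hO hOU (hG.contDiffOn.mono hOU) hy, tanDeriv,
    pinv_comp_apply (hG.injective y (hOU hy))]

/-- The divergence, with respect to the induced metric, of the tangential part of the constant
vector `v` is the `v`-component of the mean curvature vector. -/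
theorem sum_fderiv_sqrt_det_mul_pinv [FiniteDimensional ℝ V] (v : V) {y : E} (hy : y ∈ U) :
    ∑ j, fderiv ℝ (fun y => Real.sqrt (gramOf (fderiv ℝ G y)).det *
        (coordBasis E).coord j (pinv (fderiv ℝ G y) v)) y (coordBasis E j) =
      Real.sqrt (gramOf (fderiv ℝ G y)).det * inner ℝ (∑ i, ∑ j, (gramOf (fderiv ℝ G y))⁻¹ i j •
        ((fderiv ℝ G y).toLinearMap.range)ᗮ.starProjection
          (fderiv ℝ (fderiv ℝ G) y (coordBasis E i) (coordBasis E j))) v := by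
  set T := fderiv ℝ G with hT
  set H := fderiv ℝ T y with hH
  set s : E → ℝ := fun y => Real.sqrt (gramOf (T y)).det with hs
  set Y : E → E := fun y => pinv (T y) v with hY
  set b := coordBasis E
  have hinj := hG.injective y hy
  have hTd : HasFDerivAt T H y :=
    (differentiableAt_of_contDiffOn hG.isOpen hG.contDiffOn_fderiv hy).hasFDerivAt
  have hYd : DifferentiableAt ℝ Y y :=
    differentiableAt_of_contDiffOn hG.isOpen (hG.contDiffOn_pinv v) hy
  have hsymm : ∀ a c, H a c = H c a := fun a c =>
    fderiv_fderiv_comm hG.isOpen hG.contDiffOn hy a c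
  have hdet := gramOf_det_pos hinj
  have hTa : ∀ e, HasFDerivAt (fun y => T y e) (H.flip e) y := fun e => by
    simpa using hTd.clm_apply (hasFDerivAt_const e y)
  -- the coordinates of `pinv`
  have hcoord : ∀ j w, b.coord j (pinv (T y) w) =
      ∑ i, (gramOf (T y))⁻¹ i j * inner ℝ (T y (b i)) w := by
    intro j w
    rw [pinv_apply, Finset.sum_comm]
    simp [map_sum, b, Finsupp.single_apply]
  -- derivative of the volume density
  have hds : ∀ h, fderiv ℝ s y h = s y * ∑ k, b.coord k (pinv (T y) (H h (b k))) := by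
    intro h
    have h1 : ∀ k l, HasFDerivAt (fun y => gramOf (T y) k l)
        ((innerSL ℝ (T y (b k))).comp (H.flip (b l)) +
          (innerSL ℝ (T y (b l))).comp (H.flip (b k))) y := by
      intro k l
      refine ((hTa (b k)).inner ℝ (hTa (b l))).congr_fderiv (ContinuousLinearMap.ext fun x => ?_)
      simp [fderivInnerCLM_apply, real_inner_comm]
    have h2 := (hasFDerivAt_matrix_det h1).sqrt hdet.ne'
    rw [h2.fderiv]
    have h3 : ∀ i j, (gramOf (T y)).adjugate j i = (gramOf (T y)).det * (gramOf (T y))⁻¹ j i := by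
      intro i j
      rw [Matrix.inv_def, Ring.inverse_eq_inv', Matrix.smul_apply, smul_eq_mul,
        mul_inv_cancel_left₀ hdet.ne']
    have h4 : ∑ i, ∑ j, (gramOf (T y))⁻¹ j i *
        (inner ℝ (T y (b i)) (H h (b j)) + inner ℝ (T y (b j)) (H h (b i))) =
        2 * ∑ k, b.coord k (pinv (T y) (H h (b k))) := by
      simp only [mul_add, Finset.sum_add_distrib, hcoord]
      rw [two_mul]
      congr 1
      rw [Finset.sum_comm]
      refine Finset.sum_congr rfl fun i _ => Finset.sum_congr rfl fun j _ => ?_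
      rw [gramOf_inv_isSymm]
    have h5 : (gramOf (T y)).det = s y * s y := (Real.mul_self_sqrt hdet.le).symm
    have h6 : s y ≠ 0 := (Real.sqrt_pos.2 hdet).ne'
    simp only [smul_apply, sum_apply, add_apply, ContinuousLinearMap.comp_apply,
        innerSL_apply_apply,
      ContinuousLinearMap.flip_apply, smul_eq_mul, h3, mul_assoc, ← Finset.mul_sum, h4]
    change 1 / (2 * s y) * _ = _
    rw [h5]
    field_simp
  -- derivative of the tangential part
  have hdY : ∀ j, b.coord j (fderiv ℝ Y y (b j)) =
      ∑ i, (gramOf (T y))⁻¹ i j * inner ℝ (H (b j) (b i)) (v - T y (Y y)) -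
        b.coord j (pinv (T y) (H (b j) (Y y))) := by
    intro j
    have h1 : ∀ e h, inner ℝ (T y e) (T y (fderiv ℝ Y y h)) =
        inner ℝ (H h e) (v - T y (Y y)) - inner ℝ (T y e) (H h (Y y)) := by
      intro e h
      have h2 : HasFDerivAt (fun y => T y (Y y)) _ y := hTd.clm_apply hYd.hasFDerivAt
      have h3 := (hTa e).inner ℝ h2
      have h4 := (hTa e).inner ℝ (hasFDerivAt_const v y)
      have h5 : (fun y => inner ℝ (T y e) (T y (Y y))) =ᶠ[nhds y] fun y => inner ℝ (T y e) v := by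
        filter_upwards [hG.isOpen.mem_nhds hy] with z hz
        exact inner_apply_pinv (hG.injective z hz) v e
      have h6 := congrArg (fun f : E →L[ℝ] ℝ => f h) (h3.unique (h4.congr_of_eventuallyEq h5))
      simp [fderivInnerCLM_apply, inner_add_right] at h6
      rw [inner_sub_right]
      linarith
    rw [← pinv_comp_apply hinj (fderiv ℝ Y y (b j)), hcoord, hcoord, ← Finset.sum_sub_distrib]
    refine Finset.sum_congr rfl fun i _ => ?_
    rw [h1, mul_sub]
  have hQ : ∀ w, inner ℝ (((T y).toLinearMap.range)ᗮ.starProjection w) v =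
      inner ℝ w (v - T y (Y y)) := by
    intro w
    rw [Submodule.inner_starProjection_left_eq_right,
      starProjection_range_orthogonal hinj]
  have hprod : ∀ j, fderiv ℝ (fun y => s y * b.coord j (Y y)) y (b j) =
      s y * b.coord j (fderiv ℝ Y y (b j)) + b.coord j (Y y) * fderiv ℝ s y (b j) := by
    intro j
    have h1 : HasFDerivAt (fun y => b.coord j (Y y))
        ((LinearMap.toContinuousLinearMap (b.coord j)).comp (fderiv ℝ Y y)) y :=
      (LinearMap.toContinuousLinearMap (b.coord j)).hasFDerivAt.comp y hYd.hasFDerivAt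
    have h2 : DifferentiableAt ℝ s y :=
      differentiableAt_of_contDiffOn hG.isOpen hG.contDiffOn_sqrt_det hy
    rw [(h2.hasFDerivAt.fun_mul h1).fderiv]
    simp
  change ∑ j, fderiv ℝ (fun y => s y * b.coord j (Y y)) y (b j) = s y * _
  simp only [hprod, Finset.sum_add_distrib, ← Finset.mul_sum]
  have h7 : ∑ j, b.coord j (Y y) * fderiv ℝ s y (b j) = fderiv ℝ s y (Y y) := by
    conv_rhs => rw [← b.sum_repr (Y y)]
    simp only [map_sum, map_smul, smul_eq_mul, Module.Basis.coord_apply]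
  rw [h7, hds, ← mul_add]
  congr 1
  simp only [hdY, Finset.sum_sub_distrib, hsymm _ (Y y), sub_add_cancel, sum_inner,
    real_inner_smul_left, hQ]
  rw [Finset.sum_comm]
  refine Finset.sum_congr rfl fun i _ => Finset.sum_congr rfl fun j _ => ?_
  rw [hsymm]

end IsLocalImmersion

end LocalCalculus

/-! ### Changes of charts -/

section Charts

variable {E : Type uE} [NormedAddCommGroup E] [NormedSpace ℝ E] [FiniteDimensional ℝ E]
  {H : Type uH} [TopologicalSpace H] (I : ModelWithCorners ℝ E H) [I.Boundaryless]
  {M : Type uM} [TopologicalSpace M] [ChartedSpace H M] [IsManifold I ∞ M]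
  {V : Type uV} [NormedAddCommGroup V] [InnerProductSpace ℝ V]
  {W : Type*} [NormedAddCommGroup W] [NormedSpace ℝ W]

/-- The change of coordinates from the chart around `c` to the chart around `d`. -/
def transition (c d : M) : E → E := extChartAt I d ∘ (extChartAt I c).symm

/-- The coordinates, in the chart around `c`, of the points of `O` in its domain. -/
def chartDomain (c : M) (O : Set M) : Set E :=
  (extChartAt I c).target ∩ (extChartAt I c).symm ⁻¹' O

variable {I}

theorem isOpen_chartDomain (c : M) {O : Set M} (hO : IsOpen O) : IsOpen (chartDomain I c O) :=
  (continuousOn_extChartAt_symm c).isOpen_inter_preimage (isOpen_extChartAt_target c) hO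

theorem contDiffOn_inChart {f : M → W} {O : Set M} (hf : ContMDiffOn I 𝓘(ℝ, W) ∞ f O) (c : M) :
    ContDiffOn ℝ ∞ (inChart I f c) (chartDomain I c O) := by
  rw [← contMDiffOn_iff_contDiffOn]
  exact hf.comp ((contMDiffOn_extChartAt_symm c).mono Set.inter_subset_left)
    fun y hy => hy.2

theorem contDiffOn_inChart_target {f : M → W} (hf : ContMDiff I 𝓘(ℝ, W) ∞ f) (c : M) :
    ContDiffOn ℝ ∞ (inChart I f c) (extChartAt I c).target :=
  (contDiffOn_inChart (O := Set.univ) hf.contMDiffOn c).mono fun _ hy => ⟨hy, trivial⟩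

theorem contDiffOn_transition (c d : M) :
    ContDiffOn ℝ ∞ (transition I c d) (chartDomain I c (extChartAt I d).source) :=
  contDiffOn_inChart (extChartAt_source (I := I) d ▸ contMDiffOn_extChartAt (n := ∞)) c

theorem mem_chartDomain {c x : M} {O : Set M} (hc : x ∈ (extChartAt I c).source) (hx : x ∈ O) :
    extChartAt I c x ∈ chartDomain I c O :=
  ⟨(extChartAt I c).map_source hc, by rwa [Set.mem_preimage, (extChartAt I c).left_inv hc]⟩

theorem inChart_apply (f : M → W) {c x : M} (hc : x ∈ (extChartAt I c).source) :
    inChart I f c (extChartAt I c x) = f x := by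
  rw [inChart, Function.comp_apply, (extChartAt I c).left_inv hc]

theorem transition_apply (d : M) {c x : M} (hc : x ∈ (extChartAt I c).source) :
    transition I c d (extChartAt I c x) = extChartAt I d x := by
  rw [transition, Function.comp_apply, (extChartAt I c).left_inv hc]

theorem inChart_eq_comp_transition (f : M → W) (c d : M) {y : E}
    (hy : y ∈ chartDomain I c (extChartAt I d).source) :
    inChart I f c y = inChart I f d (transition I c d y) := by
  have h : (extChartAt I c).symm y ∈ (extChartAt I d).source := hy.2
  simp only [inChart, transition, Function.comp_apply, (extChartAt I d).left_inv h]

theorem transition_mem (c d : M) {y : E}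
    (hy : y ∈ chartDomain I c (extChartAt I d).source) :
    transition I c d y ∈ chartDomain I d (extChartAt I c).source := by
  refine ⟨(extChartAt I d).map_source hy.2, ?_⟩
  have h : (extChartAt I c).symm y ∈ (extChartAt I d).source := hy.2
  simp only [transition, Function.comp_apply, Set.mem_preimage, (extChartAt I d).left_inv h]
  exact (extChartAt I c).map_target hy.1

theorem transition_transition (c d : M) {y : E}
    (hy : y ∈ chartDomain I c (extChartAt I d).source) :
    transition I d c (transition I c d y) = y := by
  have h : (extChartAt I c).symm y ∈ (extChartAt I d).source := hy.2
  simp only [transition, Function.comp_apply, (extChartAt I d).left_inv h,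
    (extChartAt I c).right_inv hy.1]

theorem differentiableAt_transition (c d : M) {y : E}
    (hy : y ∈ chartDomain I c (extChartAt I d).source) :
    DifferentiableAt ℝ (transition I c d) y :=
  differentiableAt_of_contDiffOn (isOpen_chartDomain c (isOpen_extChartAt_source d))
    (contDiffOn_transition c d) hy

theorem fderiv_transition_comp (c d : M) {y : E}
    (hy : y ∈ chartDomain I c (extChartAt I d).source) :
    (fderiv ℝ (transition I d c) (transition I c d y)).comp (fderiv ℝ (transition I c d) y) =
      ContinuousLinearMap.id ℝ E := by
  rw [← fderiv_comp _ (differentiableAt_transition d c (transition_mem c d hy))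
    (differentiableAt_transition c d hy), ← fderiv_id]
  refine Filter.EventuallyEq.fderiv_eq ?_
  filter_upwards [(isOpen_chartDomain c (isOpen_extChartAt_source d)).mem_nhds hy] with z hz
  exact transition_transition c d hz

theorem fderiv_transition_surjective (c d : M) {y : E}
    (hy : y ∈ chartDomain I c (extChartAt I d).source) :
    Function.Surjective (fderiv ℝ (transition I c d) y) := by
  have h := fderiv_transition_comp d c (transition_mem c d hy)
  rw [transition_transition c d hy] at h
  exact fun e => ⟨_, congrArg (fun f : E →L[ℝ] E => f e) h⟩

/-- The chain rule for a change of coordinates. -/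
theorem fderiv_inChart_transition {f : M → W} {x c d : M} {O : Set M} (hO : IsOpen O)
    (hf : ContMDiffOn I 𝓘(ℝ, W) ∞ f O) (hx : x ∈ O) (hc : x ∈ (extChartAt I c).source)
    (hd : x ∈ (extChartAt I d).source) :
    fderiv ℝ (inChart I f c) (extChartAt I c x) =
      (fderiv ℝ (inChart I f d) (extChartAt I d x)).comp
        (fderiv ℝ (transition I c d) (extChartAt I c x)) := by
  have hy := mem_chartDomain (I := I) hc hd
  rw [← transition_apply d hc, ← fderiv_comp]
  · refine Filter.EventuallyEq.fderiv_eq ?_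
    filter_upwards [(isOpen_chartDomain c (isOpen_extChartAt_source d)).mem_nhds hy] with z hz
    exact inChart_eq_comp_transition f c d hz
  · rw [transition_apply d hc]
    exact differentiableAt_of_contDiffOn (isOpen_chartDomain d hO) (contDiffOn_inChart hf d)
      (mem_chartDomain hd hx)
  · exact differentiableAt_transition c d hy

theorem fderiv_inChart_injective {F : M → V} (hF : IsSmoothImmersion I F) {c x : M}
    (hc : x ∈ (extChartAt I c).source) :
    Function.Injective (fderiv ℝ (inChart I F c) (extChartAt I c x)) := by
  have hx := mem_extChartAt_source (I := I) x
  rw [fderiv_inChart_transition isOpen_univ hF.1.contMDiffOn trivial hc hx]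
  have h1 : Function.Injective (fderiv ℝ (inChart I F x) (extChartAt I x x)) := by
    have h : Function.Injective (fderivWithin ℝ (writtenInExtChartAt I 𝓘(ℝ, V) x F)
        (Set.range I) (extChartAt I x x)) := by
      have h := hF.2 x
      rwa [(hF.1.mdifferentiableAt (by simp)).mfderiv] at h
    rwa [I.range_eq_univ, fderivWithin_univ] at h
  refine h1.comp fun a b hab => ?_
  have h := fderiv_transition_comp c x (mem_chartDomain (I := I) hc hx)
  have ha := congrArg (fun f : E →L[ℝ] E => f a) h
  have hb := congrArg (fun f : E →L[ℝ] E => f b) h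
  simp only [ContinuousLinearMap.comp_apply] at ha hb
  have hab' : fderiv ℝ (transition I c x) (extChartAt I c x) a =
    fderiv ℝ (transition I c x) (extChartAt I c x) b := hab
  rw [hab', hb] at ha
  exact ha.symm

theorem IsSmoothImmersion.isLocalImmersion {F : M → V} (hF : IsSmoothImmersion I F) (c : M) :
    IsLocalImmersion (inChart I F c) (extChartAt I c).target where
  isOpen := isOpen_extChartAt_target c
  contDiffOn := contDiffOn_inChart_target hF.1 c
  injective y hy := by
    have h := fderiv_inChart_injective hF ((extChartAt I c).map_target hy)
    rwa [(extChartAt I c).right_inv hy] at h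

/-- Smoothness can be checked in the preferred charts. -/
theorem contMDiffOn_of_inChart {f : M → W} {O : Set M} (hO : IsOpen O)
    (h : ∀ c, ContDiffOn ℝ ∞ (inChart I f c) (chartDomain I c O)) :
    ContMDiffOn I 𝓘(ℝ, W) ∞ f O := by
  intro x hx
  have hc := mem_extChartAt_source (I := I) x
  have h1 : ContMDiffAt 𝓘(ℝ, E) 𝓘(ℝ, W) ∞ (inChart I f x) (extChartAt I x x) :=
    ((h x).contDiffAt ((isOpen_chartDomain x hO).mem_nhds (mem_chartDomain hc hx))).contMDiffAt
  refine ((h1.comp x (contMDiffAt_extChartAt (n := ∞))).congr_of_eventuallyEq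
    ?_).contMDiffWithinAt
  filter_upwards [(isOpen_extChartAt_source (I := I) x).mem_nhds hc] with z hz
  exact (inChart_apply f hz).symm

/-! ### Tangential derivatives on a manifold -/

variable (I) in
/-- The derivative of `f : M → W` at `x` in the direction of the tangential part of the constant
vector `v`, where `M` is immersed by `F`. For real-valued `f` and `v` in an orthonormal basis of
`V`, these are the components of the gradient of `f`, regarded as a vector of `V`; this makes it
possible to compute on `M` without a connection. -/
def tanD (F : M → V) (v : V) (f : M → W) (x : M) : W :=
  tanDeriv (inChart I F x) v (inChart I f x) (extChartAt I x x)

/-- Tangential derivatives may be computed in any chart. -/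
theorem tanD_eq_tanDeriv {F : M → V} (hF : IsSmoothImmersion I F) (v : V) {f : M → W} {O : Set M}
    (hO : IsOpen O) (hf : ContMDiffOn I 𝓘(ℝ, W) ∞ f O) {c x : M} (hx : x ∈ O)
    (hc : x ∈ (extChartAt I c).source) :
    tanD I F v f x = tanDeriv (inChart I F c) v (inChart I f c) (extChartAt I c x) := by
  have hx' := mem_extChartAt_source (I := I) x
  rw [tanD, tanDeriv, tanDeriv, fderiv_inChart_transition hO hf hx hc hx',
    ContinuousLinearMap.comp_apply]
  congr 1
  exact (pinv_comp_equiv (fderiv_inChart_injective hF hx') (fderiv_inChart_injective hF hc)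
    (fderiv_inChart_transition isOpen_univ hF.1.contMDiffOn trivial hc hx')
    (fderiv_transition_surjective c x (mem_chartDomain hc hx')) v).symm

theorem inChart_tanD {F : M → V} (hF : IsSmoothImmersion I F) (v : V) {f : M → W} {O : Set M}
    (hO : IsOpen O) (hf : ContMDiffOn I 𝓘(ℝ, W) ∞ f O) (c : M) {y : E}
    (hy : y ∈ chartDomain I c O) :
    inChart I (tanD I F v f) c y = tanDeriv (inChart I F c) v (inChart I f c) y := by
  have h := tanD_eq_tanDeriv hF v hO hf hy.2 ((extChartAt I c).map_target hy.1)
  rwa [(extChartAt I c).right_inv hy.1] at h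

theorem contMDiffOn_tanD {F : M → V} (hF : IsSmoothImmersion I F) (v : V) {f : M → W} {O : Set M}
    (hO : IsOpen O) (hf : ContMDiffOn I 𝓘(ℝ, W) ∞ f O) :
    ContMDiffOn I 𝓘(ℝ, W) ∞ (tanD I F v f) O :=
  contMDiffOn_of_inChart hO fun c =>
    ((hF.isLocalImmersion c).contDiffOn_tanDeriv v (isOpen_chartDomain c hO)
      Set.inter_subset_left (contDiffOn_inChart hf c)).congr fun _ hy =>
          inChart_tanD hF v hO hf c hy

theorem contMDiff_tanD {F : M → V} (hF : IsSmoothImmersion I F) (v : V) {f : M → W}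
    (hf : ContMDiff I 𝓘(ℝ, W) ∞ f) : ContMDiff I 𝓘(ℝ, W) ∞ (tanD I F v f) :=
  contMDiffOn_univ.1 (contMDiffOn_tanD hF v isOpen_univ hf.contMDiffOn)

theorem tanD_tanD {F : M → V} (hF : IsSmoothImmersion I F) (a b : V) {f : M → W} {O : Set M}
    (hO : IsOpen O) (hf : ContMDiffOn I 𝓘(ℝ, W) ∞ f O) {x : M} (hx : x ∈ O) :
    tanD I F a (tanD I F b f) x = tanDeriv (inChart I F x) a
      (tanDeriv (inChart I F x) b (inChart I f x)) (extChartAt I x x) := by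
  have hy := mem_chartDomain (I := I) (mem_extChartAt_source (I := I) x) hx
  rw [tanD, tanDeriv, tanDeriv]
  congr 1
  refine Filter.EventuallyEq.fderiv_eq ?_
  filter_upwards [(isOpen_chartDomain x hO).mem_nhds hy] with z hz
  exact inChart_tanD hF b hO hf x hz

/-- The commutator of two tangential derivatives is the tangential derivative along the
commutator applied to the immersion. -/
theorem tanD_comm {F : M → V} (hF : IsSmoothImmersion I F) (a b : V) {f : M → W} {O : Set M}
    (hO : IsOpen O) (hf : ContMDiffOn I 𝓘(ℝ, W) ∞ f O) {x : M} (hx : x ∈ O) :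
    tanD I F a (tanD I F b f) x - tanD I F b (tanD I F a f) x =
      tanD I F (tanD I F a (tanD I F b F) x - tanD I F b (tanD I F a F) x) f x := by
  have hF' := hF.1.contMDiffOn (s := O)
  rw [tanD_tanD hF a b hO hf hx, tanD_tanD hF b a hO hf hx, tanD_tanD hF a b hO hF' hx,
    tanD_tanD hF b a hO hF' hx]
  exact (hF.isLocalImmersion x).tanDeriv_comm a b (isOpen_chartDomain x hO) Set.inter_subset_left
    (contDiffOn_inChart hf x) (mem_chartDomain (mem_extChartAt_source x) hx)

end Charts

/-! ### Rules for tangential derivatives -/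

section TangentialCalculus

variable {E : Type uE} [NormedAddCommGroup E] [NormedSpace ℝ E] [FiniteDimensional ℝ E]
  {H : Type uH} [TopologicalSpace H] {I : ModelWithCorners ℝ E H} [I.Boundaryless]
  {M : Type uM} [TopologicalSpace M] [ChartedSpace H M] [IsManifold I ∞ M]
  {V : Type uV} [NormedAddCommGroup V] [InnerProductSpace ℝ V]
  {W : Type*} [NormedAddCommGroup W] [NormedSpace ℝ W]
  {W' : Type*} [NormedAddCommGroup W'] [NormedSpace ℝ W']

theorem differentiableAt_inChart {f : M → W} {x : M} (hf : ContMDiffAt I 𝓘(ℝ, W) ∞ f x) :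
    DifferentiableAt ℝ (inChart I f x) (extChartAt I x x) := by
  have h := (hf.mdifferentiableAt (by simp)).differentiableWithinAt_writtenInExtChartAt
  rwa [I.range_eq_univ, differentiableWithinAt_univ] at h

theorem inChart_self (f : M → W) (x : M) : inChart I f x (extChartAt I x x) = f x :=
  inChart_apply f (mem_extChartAt_source x)

theorem eventually_inChart {p : M → Prop} {x : M} (h : ∀ᶠ z in nhds x, p z) :
    ∀ᶠ y in nhds (extChartAt I x x), p ((extChartAt I x).symm y) := by
  have h1 : Filter.Tendsto (extChartAt I x).symm (nhds (extChartAt I x x)) (nhds x) := by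
    have := (continuousAt_extChartAt_symm (I := I) x).tendsto
    rwa [(extChartAt I x).left_inv (mem_extChartAt_source x)] at this
  exact h1 h

theorem tanD_congr (F : M → V) (v : V) {f g : M → W} {x : M} (h : f =ᶠ[nhds x] g) :
    tanD I F v f x = tanD I F v g x := by
  rw [tanD, tanD, tanDeriv, tanDeriv]
  congr 1
  refine Filter.EventuallyEq.fderiv_eq ?_
  exact eventually_inChart h

theorem tanD_const (F : M → V) (v : V) (c : W) (x : M) : tanD I F v (fun _ => c) x = 0 := by
  rw [tanD, tanDeriv]
  have : inChart I (fun _ : M => c) x = fun _ => c := rfl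
  rw [this]; simp

theorem tanD_comp (F : M → V) (v : V) {f : M → W} {g : W → W'} {x : M}
    (hf : ContMDiffAt I 𝓘(ℝ, W) ∞ f x) (hg : DifferentiableAt ℝ g (f x)) :
    tanD I F v (fun z => g (f z)) x = fderiv ℝ g (f x) (tanD I F v f x) := by
  rw [tanD, tanDeriv]
  have : inChart I (fun z => g (f z)) x = g ∘ inChart I f x := rfl
  rw [this, fderiv_comp _ (by rwa [inChart_self]) (differentiableAt_inChart hf), inChart_self]
  rfl

theorem tanD_clm (F : M → V) (v : V) {f : M → W} (L : W →L[ℝ] W') {x : M}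
    (hf : ContMDiffAt I 𝓘(ℝ, W) ∞ f x) :
    tanD I F v (fun z => L (f z)) x = L (tanD I F v f x) := by
  rw [tanD_comp F v hf L.differentiableAt, L.fderiv]

theorem tanD_comp_real (F : M → V) (v : V) {f : M → ℝ} {g : ℝ → ℝ} {x : M} {g' : ℝ}
    (hf : ContMDiffAt I 𝓘(ℝ, ℝ) ∞ f x) (hg : HasDerivAt g g' (f x)) :
    tanD I F v (fun z => g (f z)) x = g' * tanD I F v f x := by
  rw [tanD_comp F v hf hg.differentiableAt, hg.hasFDerivAt.fderiv]
  simp [mul_comm]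

theorem tanD_add (F : M → V) (v : V) {f g : M → W} {x : M}
    (hf : ContMDiffAt I 𝓘(ℝ, W) ∞ f x) (hg : ContMDiffAt I 𝓘(ℝ, W) ∞ g x) :
    tanD I F v (fun z => f z + g z) x = tanD I F v f x + tanD I F v g x := by
  simp only [tanD, tanDeriv]
  have : inChart I (fun z => f z + g z) x = fun y => inChart I f x y + inChart I g x y := rfl
  rw [this, fderiv_fun_add (differentiableAt_inChart hf) (differentiableAt_inChart hg)]
  rfl

theorem tanD_sub (F : M → V) (v : V) {f g : M → W} {x : M}
    (hf : ContMDiffAt I 𝓘(ℝ, W) ∞ f x) (hg : ContMDiffAt I 𝓘(ℝ, W) ∞ g x) :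
    tanD I F v (fun z => f z - g z) x = tanD I F v f x - tanD I F v g x := by
  simp only [tanD, tanDeriv]
  have : inChart I (fun z => f z - g z) x = fun y => inChart I f x y - inChart I g x y := rfl
  rw [this, fderiv_fun_sub (differentiableAt_inChart hf) (differentiableAt_inChart hg)]
  rfl

theorem tanD_smul (F : M → V) (v : V) {f : M → ℝ} {g : M → W} {x : M}
    (hf : ContMDiffAt I 𝓘(ℝ, ℝ) ∞ f x) (hg : ContMDiffAt I 𝓘(ℝ, W) ∞ g x) :
    tanD I F v (fun z => f z • g z) x = f x • tanD I F v g x + tanD I F v f x • g x := by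
  simp only [tanD, tanDeriv]
  have : inChart I (fun z => f z • g z) x = fun y => inChart I f x y • inChart I g x y := rfl
  rw [this, fderiv_fun_smul (differentiableAt_inChart hf) (differentiableAt_inChart hg)]
  simp only [add_apply, smul_apply, ContinuousLinearMap.smulRight_apply, inChart_self]

theorem tanD_mul (F : M → V) (v : V) {f g : M → ℝ} {x : M}
    (hf : ContMDiffAt I 𝓘(ℝ, ℝ) ∞ f x) (hg : ContMDiffAt I 𝓘(ℝ, ℝ) ∞ g x) :
    tanD I F v (fun z => f z * g z) x = f x * tanD I F v g x + g x * tanD I F v f x := by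
  rw [mul_comm (g x)]
  exact tanD_smul F v hf hg

theorem tanD_inner (F : M → V) (v : V) {U : Type*} [NormedAddCommGroup U] [InnerProductSpace ℝ U]
    {f g : M → U} {x : M}
    (hf : ContMDiffAt I 𝓘(ℝ, U) ∞ f x) (hg : ContMDiffAt I 𝓘(ℝ, U) ∞ g x) :
    tanD I F v (fun z => inner ℝ (f z) (g z)) x =
      inner ℝ (f x) (tanD I F v g x) + inner ℝ (tanD I F v f x) (g x) := by
  simp only [tanD, tanDeriv]
  have : inChart I (fun z => inner ℝ (f z) (g z)) x =
      fun y => inner ℝ (inChart I f x y) (inChart I g x y) := rfl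
  rw [this, fderiv_inner_apply ℝ (differentiableAt_inChart hf) (differentiableAt_inChart hg)]
  simp only [inChart_self]

theorem tanD_sum (F : M → V) (v : V) {ι : Type*} (s : Finset ι) {f : ι → M → W} {x : M}
    (hf : ∀ i, ContMDiffAt I 𝓘(ℝ, W) ∞ (f i) x) :
    tanD I F v (fun z => ∑ i ∈ s, f i z) x = ∑ i ∈ s, tanD I F v (f i) x := by
  simp only [tanD, tanDeriv]
  have : inChart I (fun z => ∑ i ∈ s, f i z) x = fun y => ∑ i ∈ s, inChart I (f i) x y := rfl
  rw [this, fderiv_fun_sum fun i _ => differentiableAt_inChart (hf i)]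
  simp

theorem tanD_add_left (F : M → V) (v w : V) (f : M → W) (x : M) :
    tanD I F (v + w) f x = tanD I F v f x + tanD I F w f x := by
  simp [tanD, tanDeriv]

theorem tanD_sub_left (F : M → V) (v w : V) (f : M → W) (x : M) :
    tanD I F (v - w) f x = tanD I F v f x - tanD I F w f x := by
  simp [tanD, tanDeriv]

theorem tanD_smul_left (F : M → V) (c : ℝ) (v : V) (f : M → W) (x : M) :
    tanD I F (c • v) f x = c • tanD I F v f x := by
  simp [tanD, tanDeriv]

theorem tanD_sum_left (F : M → V) {ι : Type*} (s : Finset ι) (c : ι → ℝ) (v : ι → V) (f : M → W)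
    (x : M) : tanD I F (∑ i ∈ s, c i • v i) f x = ∑ i ∈ s, c i • tanD I F (v i) f x := by
  simp [tanD, tanDeriv]

theorem tanD_basis {ι : Type*} [Fintype ι] (e : OrthonormalBasis ι ℝ V) (F : M → V) (v : V)
    (f : M → W) (x : M) : tanD I F v f x = ∑ a, inner ℝ (e a) v • tanD I F (e a) f x := by
  conv_lhs => rw [← e.sum_repr v]
  rw [tanD_sum_left]
  simp [e.repr_apply_apply]

/-- The trace of a bilinear map does not depend on the orthonormal basis. -/
theorem sum_orthonormalBasis_eq {ι ι' : Type*} [Fintype ι] [Fintype ι']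
    (e : OrthonormalBasis ι ℝ V) (e' : OrthonormalBasis ι' ℝ V) (B : V →ₗ[ℝ] V →ₗ[ℝ] W) :
    ∑ a, B (e a) (e a) = ∑ a, B (e' a) (e' a) := by
  have h1 : ∀ a, B (e a) (e a) = ∑ b, inner ℝ (e' b) (e a) • B (e' b) (e a) := by
    intro a
    conv_lhs => arg 1; rw [← e'.sum_repr (e a)]
    simp [map_sum, LinearMap.sum_apply, e'.repr_apply_apply]
  have h2 : ∀ b, B (e' b) (e' b) = ∑ a, inner ℝ (e a) (e' b) • B (e' b) (e a) := by
    intro b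
    conv_lhs => arg 2; rw [← e.sum_repr (e' b)]
    simp [map_sum, e.repr_apply_apply]
  simp_rw [h1, h2]
  rw [Finset.sum_comm]
  simp_rw [real_inner_comm]

theorem gradNormSq_eq_sum {ι : Type*} [Fintype ι] (e : OrthonormalBasis ι ℝ V) {F : M → V}
    [FiniteDimensional ℝ V]
    (hF : IsSmoothImmersion I F) (φ : M → ℝ) (x : M) :
    gradNormSq I F φ x = ∑ a, tanD I F (e a) φ x ^ 2 := by
  have h := sum_gramOf_inv_smul e (fderiv_inChart_injective hF (mem_extChartAt_source x))
    (LinearMap.mk₂ ℝ (fun u v => fderiv ℝ (inChart I φ x) (extChartAt I x x) u *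
      fderiv ℝ (inChart I φ x) (extChartAt I x x) v) (by intros; simp [add_mul])
      (by intros; simp [mul_assoc]) (by intros; simp [mul_add])
      (by intros; simp [mul_left_comm]))
  refine Eq.trans (Finset.sum_congr rfl fun i _ => Finset.sum_congr rfl fun j _ => ?_)
    (h.trans (Finset.sum_congr rfl fun a _ => ?_))
  · exact mul_assoc _ _ _
  · exact (sq _).symm

/-! ### Unit normal fields -/

/-- `ν` is a smooth unit normal field, on the open set `O`, of the hypersurface immersed by `F`:
the tangential part of every vector `v` is `v - ⟪ν, v⟫ ν`. -/
structure IsUnitNormalOn (I : ModelWithCorners ℝ E H) (F ν : M → V) (O : Set M) : Prop where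
  isOpen : IsOpen O
  contMDiffOn : ContMDiffOn I 𝓘(ℝ, V) ∞ ν O
  norm_eq_one : ∀ x ∈ O, ‖ν x‖ = 1
  tanD_self : ∀ x ∈ O, ∀ v, tanD I F v F x = v - inner ℝ (ν x) v • ν x

/-- In codimension one, a unit vector normal to the tangent space determines the tangential
projection. -/
theorem tanD_self_of_normal [FiniteDimensional ℝ V]
    (hdim : Module.finrank ℝ V = Module.finrank ℝ E + 1) {F : M → V}
    (hF : IsSmoothImmersion I F) {x : M} {n : V} (hn : ‖n‖ = 1)
    (hnF : ∀ v, inner ℝ n (tanD I F v F x) = 0) (v : V) :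
    tanD I F v F x = v - inner ℝ n v • n := by
  set T := fderiv ℝ (inChart I F x) (extChartAt I x x)
  have hT : Function.Injective T := fderiv_inChart_injective hF (mem_extChartAt_source x)
  have hpT : ∀ v, tanD I F v F x = T (pinv T v) := fun v => rfl
  have hperp : ∀ v, v - T (pinv T v) ∈ (T.toLinearMap.range)ᗮ := fun v => by
    rw [← starProjection_range_orthogonal hT]
    exact Submodule.starProjection_apply_mem _ _
  have hn1 : n ∈ (T.toLinearMap.range)ᗮ := by
    rw [Submodule.mem_orthogonal']
    rintro _ ⟨e, rfl⟩
    have := hnF (T e)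
    rwa [hpT, pinv_comp_apply hT] at this
  have hfin : Module.finrank ℝ (T.toLinearMap.range)ᗮ = 1 := by
    have h1 := Submodule.finrank_add_finrank_orthogonal T.toLinearMap.range
    rw [LinearMap.finrank_range_of_inj hT] at h1
    omega
  have hn0 : (⟨n, hn1⟩ : (T.toLinearMap.range)ᗮ) ≠ 0 := by
    intro h
    have : n = 0 := congrArg Subtype.val h
    simp [this] at hn
  obtain ⟨c, hc⟩ := (finrank_eq_one_iff_of_nonzero' _ hn0).1 hfin ⟨_, hperp v⟩
  have hc' : c • n = v - T (pinv T v) := congrArg Subtype.val hc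
  have h2 : c = inner ℝ n v := by
    have h3 := congrArg (fun w => inner ℝ n w) hc'
    simp only [inner_smul_right, inner_sub_right, real_inner_self_eq_norm_sq, hn, ← hpT, hnF] at h3
    simpa using h3
  rw [hpT, ← h2, hc']
  abel

/-- Hypersurfaces have local unit normal fields. -/
theorem exists_isUnitNormalOn [FiniteDimensional ℝ V]
    (hdim : Module.finrank ℝ V = Module.finrank ℝ E + 1) {F : M → V}
    (hF : IsSmoothImmersion I F) (x₀ : M) :
    ∃ (ν : M → V) (O : Set M), x₀ ∈ O ∧ IsUnitNormalOn I F ν O := by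
  set T : M → E →L[ℝ] V := fun x => fderiv ℝ (inChart I F x) (extChartAt I x x)
  have hT : ∀ x, Function.Injective (T x) := fun x =>
    fderiv_inChart_injective hF (mem_extChartAt_source x)
  have hpT : ∀ x v, tanD I F v F x = T x (pinv (T x) v) := fun x v => rfl
  obtain ⟨w, hw⟩ : ∃ w : V, w - tanD I F w F x₀ ≠ 0 := by
    by_contra! h
    have h1 : Function.Surjective (T x₀).toLinearMap := fun w =>
      ⟨pinv (T x₀) w, (sub_eq_zero.1 (h w)).symm⟩
    have h2 := LinearMap.finrank_le_finrank_of_injective (f := (T x₀).toLinearMap) (hT x₀)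
    have h3 := LinearMap.finrank_range_of_inj (f := (T x₀).toLinearMap) (hT x₀)
    rw [LinearMap.range_eq_top.2 h1, finrank_top] at h3
    omega
  -- the normal part of a constant vector that is not tangent at `x₀`
  set u : M → V := fun x => w - tanD I F w F x
  have hu : ContMDiff I 𝓘(ℝ, V) ∞ u := contMDiff_const.sub (contMDiff_tanD hF w hF.1)
  have hO : IsOpen {x | u x ≠ 0} := isOpen_ne_fun hu.continuous continuous_const
  have hν : ∀ x, u x ≠ 0 → ‖‖u x‖⁻¹ • u x‖ = 1 := fun x hx => by
    rw [norm_smul, norm_inv, norm_norm, inv_mul_cancel₀ (norm_ne_zero_iff.2 hx)]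
  refine ⟨fun x => ‖u x‖⁻¹ • u x, {x | u x ≠ 0}, hw, hO, fun x hx => ?_, fun x hx => hν x hx,
    fun x hx v => tanD_self_of_normal hdim hF (hν x hx) (fun v => ?_) v⟩
  · have h1 : ContDiffAt ℝ ∞ (fun z : V => ‖z‖⁻¹ • z) (u x) :=
      ((contDiffAt_norm ℝ hx).inv (norm_ne_zero_iff.2 hx)).smul contDiffAt_id
    exact (h1.contMDiffAt.comp x hu.contMDiffAt).contMDiffWithinAt
  · rw [inner_smul_left, real_inner_comm, inner_sub_right, hpT, hpT, inner_apply_pinv (hT x),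
      sub_self, mul_zero]

namespace IsUnitNormalOn
variable {F ν : M → V} {O : Set M} (hν : IsUnitNormalOn I F ν O)
include hν

theorem contMDiffAt {x : M} (hx : x ∈ O) : ContMDiffAt I 𝓘(ℝ, V) ∞ ν x :=
  hν.contMDiffOn.contMDiffAt (hν.isOpen.mem_nhds hx)

theorem inner_self {x : M} (hx : x ∈ O) : inner ℝ (ν x) (ν x) = 1 := by
  rw [real_inner_self_eq_norm_sq, hν.norm_eq_one x hx]; norm_num

theorem inner_tanD_normal {x : M} (hx : x ∈ O) (v : V) : inner ℝ (tanD I F v ν x) (ν x) = 0 := by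
  have h := tanD_inner F v (hν.contMDiffAt hx) (hν.contMDiffAt hx)
  have h1 : (fun z => inner ℝ (ν z) (ν z)) =ᶠ[nhds x] fun _ => (1 : ℝ) := by
    filter_upwards [hν.isOpen.mem_nhds hx] with z hz using hν.inner_self hz
  rw [tanD_congr F v h1, tanD_const, real_inner_comm] at h
  linarith

theorem inner_fderiv (hF : IsSmoothImmersion I F) {c x : M} (hx : x ∈ O)
    (hc : x ∈ (extChartAt I c).source) (e : E) :
    inner ℝ (ν x) (fderiv ℝ (inChart I F c) (extChartAt I c x) e) = 0 := by
  set v := fderiv ℝ (inChart I F c) (extChartAt I c x) e with hv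
  have h := hν.tanD_self x hx v
  rw [tanD_eq_tanDeriv hF v isOpen_univ hF.1.contMDiffOn trivial hc, tanDeriv, hv,
    pinv_comp_apply (fderiv_inChart_injective hF hc), ← hv] at h
  have h1 := congrArg (fun w => inner ℝ (ν x) w) h
  simp only [inner_sub_right, inner_smul_right, hν.inner_self hx] at h1
  linarith

/-- The tangential derivative of a function along the normal vanishes. -/
theorem tanD_normal (hF : IsSmoothImmersion I F) {x : M} (hx : x ∈ O) (f : M → W) :
    tanD I F (ν x) f x = 0 := by
  rw [tanD, tanDeriv, pinv_eq_zero (fderiv_inChart_injective hF (mem_extChartAt_source x)),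
    map_zero]
  intro e
  rw [real_inner_comm]
  exact hν.inner_fderiv hF hx (mem_extChartAt_source x) e

/-- Weingarten's equation. -/
theorem inner_fderiv_fderiv (hF : IsSmoothImmersion I F) {c x : M} (hx : x ∈ O)
    (hc : x ∈ (extChartAt I c).source) (h e : E) :
    inner ℝ (ν x) (fderiv ℝ (fderiv ℝ (inChart I F c)) (extChartAt I c x) h e) =
      - inner ℝ (fderiv ℝ (inChart I ν c) (extChartAt I c x) h)
        (fderiv ℝ (inChart I F c) (extChartAt I c x) e) := by
  have hloc := hF.isLocalImmersion c
  have hy := (extChartAt I c).map_source hc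
  have hyO := mem_chartDomain (I := I) hc hx
  have h0 : DifferentiableAt ℝ (inChart I ν c) (extChartAt I c x) :=
    differentiableAt_of_contDiffOn (isOpen_chartDomain c hν.isOpen)
      (contDiffOn_inChart hν.contMDiffOn c) hyO
  have h1 : DifferentiableAt ℝ (fun y => fderiv ℝ (inChart I F c) y e) (extChartAt I c x) :=
    differentiableAt_of_contDiffOn hloc.isOpen
      (hloc.contDiffOn_fderiv.clm_apply contDiffOn_const) hy
  have h2 := fderiv_inner_apply ℝ h0 h1 h
  have h3 : (fun y => inner ℝ (inChart I ν c y) (fderiv ℝ (inChart I F c) y e))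
      =ᶠ[nhds (extChartAt I c x)] fun _ => (0 : ℝ) := by
    filter_upwards [(isOpen_chartDomain c hν.isOpen).mem_nhds hyO] with y hy
    have := hν.inner_fderiv hF hy.2 ((extChartAt I c).map_target hy.1) e
    rwa [(extChartAt I c).right_inv hy.1] at this
  rw [h3.fderiv_eq, inChart_apply ν hc] at h2
  have h4 : fderiv ℝ (fun y => fderiv ℝ (inChart I F c) y e) (extChartAt I c x) h =
      fderiv ℝ (fderiv ℝ (inChart I F c)) (extChartAt I c x) h e := by
    rw [fderiv_clm_apply (differentiableAt_of_contDiffOn hloc.isOpen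
      hloc.contDiffOn_fderiv hy) (differentiableAt_const _)]
    simp
  rw [h4, fderiv_fun_const] at h2
  simp only [Pi.zero_apply, zero_apply] at h2
  linarith

/-- Weingarten's equation along the tangential parts of two constant vectors: the shape operator is
`v ↦ tanD I F v ν x`, up to the sign. -/
theorem inner_fderiv_fderiv_pinv (hF : IsSmoothImmersion I F) {c x : M} (hx : x ∈ O)
    (hc : x ∈ (extChartAt I c).source) (a b : V) :
    inner ℝ (ν x) (fderiv ℝ (fderiv ℝ (inChart I F c)) (extChartAt I c x)
      (pinv (fderiv ℝ (inChart I F c) (extChartAt I c x)) a)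
      (pinv (fderiv ℝ (inChart I F c) (extChartAt I c x)) b)) = - inner ℝ (tanD I F a ν x) b := by
  rw [hν.inner_fderiv_fderiv hF hx hc]
  have h1 := tanD_eq_tanDeriv hF a hν.isOpen hν.contMDiffOn hx hc
  have h2 := tanD_eq_tanDeriv hF b isOpen_univ hF.1.contMDiffOn trivial hc
  rw [tanDeriv] at h1 h2
  rw [← h1, ← h2, hν.tanD_self x hx, inner_sub_right, inner_smul_right, hν.inner_tanD_normal hx,
    mul_zero, sub_zero]

/-- The shape operator is symmetric. -/
theorem inner_tanD_symm (hF : IsSmoothImmersion I F) {x : M} (hx : x ∈ O) (a b : V) :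
    inner ℝ (tanD I F a ν x) b = inner ℝ (tanD I F b ν x) a := by
  have h1 := hν.inner_fderiv_fderiv_pinv hF hx (mem_extChartAt_source x) a b
  have hloc := hF.isLocalImmersion x
  rw [fderiv_fderiv_comm hloc.isOpen hloc.contDiffOn (mem_extChartAt_target x),
    hν.inner_fderiv_fderiv_pinv hF hx (mem_extChartAt_source x) b a] at h1
  linarith

variable [FiniteDimensional ℝ V]

theorem secondFundamentalForm_eq (hF : IsSmoothImmersion I F) {x : M} (hx : x ∈ O) (h e : E) :
    secondFundamentalForm I F x h e =
      inner ℝ (ν x) (fderiv ℝ (fderiv ℝ (inChart I F x)) (extChartAt I x x) h e) • ν x := by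
  rw [secondFundamentalForm,
    starProjection_range_orthogonal (fderiv_inChart_injective hF (mem_extChartAt_source x))]
  have := hν.tanD_self x hx (fderiv ℝ (fderiv ℝ (inChart I F x)) (extChartAt I x x) h e)
  rw [tanD, tanDeriv] at this
  rw [this, sub_sub_cancel]

theorem secondFundamentalForm_pinv (hF : IsSmoothImmersion I F) {x : M} (hx : x ∈ O) (a b : V) :
    secondFundamentalForm I F x (pinv (fderiv ℝ (inChart I F x) (extChartAt I x x)) a)
      (pinv (fderiv ℝ (inChart I F x) (extChartAt I x x)) b) =
      - inner ℝ (tanD I F a ν x) b • ν x := by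
  rw [hν.secondFundamentalForm_eq hF hx,
    hν.inner_fderiv_fderiv_pinv hF hx (mem_extChartAt_source x), neg_smul]

end IsUnitNormalOn

end TangentialCalculus

/-! ### The second fundamental form in terms of a unit normal -/

section ShapeOperator

variable {E : Type uE} [NormedAddCommGroup E] [NormedSpace ℝ E] [FiniteDimensional ℝ E]
  {H : Type uH} [TopologicalSpace H] {I : ModelWithCorners ℝ E H} [I.Boundaryless]
  {M : Type uM} [TopologicalSpace M] [ChartedSpace H M] [IsManifold I ∞ M]
  {V : Type uV} [NormedAddCommGroup V] [InnerProductSpace ℝ V] [FiniteDimensional ℝ V]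
  {ι : Type*} [Fintype ι]

/-- The second fundamental form as a bilinear map. -/
def secondFundamentalBilin (I : ModelWithCorners ℝ E H) (F : M → V) (x : M) : E →ₗ[ℝ] E →ₗ[ℝ] V :=
  LinearMap.mk₂ ℝ (secondFundamentalForm I F x)
    (by intros; simp only [secondFundamentalForm, map_add, add_apply])
    (by intros; simp only [secondFundamentalForm, map_smul, smul_apply])
    (by intros; simp only [secondFundamentalForm, map_add])
    (by intros; simp only [secondFundamentalForm, map_smul])

theorem secondFundamentalBilin_apply (F : M → V) (x : M) (u v : E) :
    secondFundamentalBilin I F x u v = secondFundamentalForm I F x u v := rfl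

theorem meanCurvatureVector_eq_sum (e : OrthonormalBasis ι ℝ V) {F : M → V}
    (hF : IsSmoothImmersion I F) (x : M) :
    meanCurvatureVector I F x = ∑ a, secondFundamentalForm I F x
      (pinv (fderiv ℝ (inChart I F x) (extChartAt I x x)) (e a))
      (pinv (fderiv ℝ (inChart I F x) (extChartAt I x x)) (e a)) :=
  sum_gramOf_inv_smul e (fderiv_inChart_injective hF (mem_extChartAt_source x))
    (secondFundamentalBilin I F x)

theorem normSqA_eq_sum (e : OrthonormalBasis ι ℝ V) {F : M → V}
    (hF : IsSmoothImmersion I F) (x : M) :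
    normSqA I F x = ∑ a, ∑ b, ‖secondFundamentalForm I F x
      (pinv (fderiv ℝ (inChart I F x) (extChartAt I x x)) (e a))
      (pinv (fderiv ℝ (inChart I F x) (extChartAt I x x)) (e b))‖ ^ 2 := by
  set T := fderiv ℝ (inChart I F x) (extChartAt I x x)
  have hT : Function.Injective T := fderiv_inChart_injective hF (mem_extChartAt_source x)
  let A := secondFundamentalBilin I F x
  -- the metric on the second pair of arguments
  let B : E → E → E →ₗ[ℝ] E →ₗ[ℝ] ℝ := fun u u' =>
    LinearMap.mk₂ ℝ (fun w w' => inner ℝ (A u w) (A u' w'))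
      (by intros; simp [inner_add_left]) (by intros; simp [inner_smul_left])
      (by intros; simp [inner_add_right]) (by intros; simp [inner_smul_right])
  let C : E →ₗ[ℝ] E →ₗ[ℝ] ℝ :=
    LinearMap.mk₂ ℝ (fun u u' => ∑ b, inner ℝ (A u (pinv T (e b))) (A u' (pinv T (e b))))
      (by intros; simp [inner_add_left, Finset.sum_add_distrib])
      (by intros; simp [inner_smul_left, Finset.mul_sum])
      (by intros; simp [inner_add_right, Finset.sum_add_distrib])
      (by intros; simp [inner_smul_right, Finset.mul_sum])
  have h1 := sum_gramOf_inv_smul e hT C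
  have h2 : ∀ u u', C u u' = _ := fun u u' => (sum_gramOf_inv_smul e hT (B u u')).symm
  have h3 : ∀ a, C (pinv T (e a)) (pinv T (e a)) =
      ∑ b, ‖secondFundamentalForm I F x (pinv T (e a)) (pinv T (e b))‖ ^ 2 := fun a =>
    Finset.sum_congr rfl fun b _ => real_inner_self_eq_norm_sq _
  simp_rw [h2] at h1
  have h4 : ∀ a, ∑ i, ∑ j, (gramOf T)⁻¹ i j • B (pinv T (e a)) (pinv T (e a))
      (coordBasis E i) (coordBasis E j) = ∑ b, ‖secondFundamentalForm I F x
        (pinv T (e a)) (pinv T (e b))‖ ^ 2 := fun a => (h2 _ _).symm.trans (h3 a)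
  simp_rw [h4] at h1
  rw [← h1, normSqA]
  refine Finset.sum_congr rfl fun i _ => ?_
  rw [Finset.sum_comm]
  refine Finset.sum_congr rfl fun k _ => ?_
  rw [Finset.smul_sum]
  refine Finset.sum_congr rfl fun j _ => ?_
  rw [Finset.smul_sum]
  refine Finset.sum_congr rfl fun l _ => ?_
  exact mul_assoc _ _ _

variable {F ν : M → V} {O : Set M}

namespace IsUnitNormalOn

theorem meanCurvatureVector_eq (hν : IsUnitNormalOn I F ν O) (hF : IsSmoothImmersion I F)
    (e : OrthonormalBasis ι ℝ V) {x : M} (hx : x ∈ O) :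
    meanCurvatureVector I F x = -(∑ a, inner ℝ (tanD I F (e a) ν x) (e a)) • ν x := by
  rw [meanCurvatureVector_eq_sum e hF]
  simp_rw [hν.secondFundamentalForm_pinv hF hx]
  rw [← Finset.sum_smul, Finset.sum_neg_distrib]

theorem sum_inner_tanD_eq_zero (hν : IsUnitNormalOn I F ν O) (hF : IsSmoothImmersion I F)
    (hmin : IsMinimal I F) (e : OrthonormalBasis ι ℝ V) {x : M} (hx : x ∈ O) :
    ∑ a, inner ℝ (tanD I F (e a) ν x) (e a) = 0 := by
  have h := hmin x
  rw [hν.meanCurvatureVector_eq hF e hx, smul_eq_zero, neg_eq_zero] at h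
  refine h.resolve_right fun h0 => ?_
  have := hν.norm_eq_one x hx
  simp [h0] at this

theorem normSqA_eq (hν : IsUnitNormalOn I F ν O) (hF : IsSmoothImmersion I F)
    (e : OrthonormalBasis ι ℝ V) {x : M} (hx : x ∈ O) :
    normSqA I F x = ∑ a, ∑ b, inner ℝ (tanD I F (e a) ν x) (e b) ^ 2 := by
  rw [normSqA_eq_sum e hF]
  simp_rw [hν.secondFundamentalForm_pinv hF hx, norm_smul, hν.norm_eq_one x hx, mul_one, norm_neg,
    Real.norm_eq_abs, sq_abs]

end IsUnitNormalOn

/-- The definition of `normSqA` uses a chart that varies with the point; a local unit normal field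
expresses it by tangential derivatives, which are smooth. -/
theorem contMDiff_normSqA (hdim : Module.finrank ℝ V = Module.finrank ℝ E + 1)
    (hF : IsSmoothImmersion I F) : ContMDiff I 𝓘(ℝ, ℝ) ∞ (normSqA I F) := by
  intro x
  obtain ⟨ν, O, hx, hν⟩ := exists_isUnitNormalOn hdim hF x
  have hO := hν.isOpen.mem_nhds hx
  have h1 : ContMDiffOn I 𝓘(ℝ, ℝ) ∞ (fun z => ∑ a, ∑ b,
      inner ℝ (tanD I F (stdOrthonormalBasis ℝ V a) ν z) (stdOrthonormalBasis ℝ V b) ^ 2) O := by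
    refine contMDiffOn_finsetSum fun a _ => contMDiffOn_finsetSum fun b _ => ?_
    have h2 := contMDiffOn_tanD hF (stdOrthonormalBasis ℝ V a) hν.isOpen hν.contMDiffOn
    have h3 : ContDiff ℝ ∞ fun v : V => inner ℝ v (stdOrthonormalBasis ℝ V b) ^ 2 :=
      (contDiff_id.inner ℝ contDiff_const).pow 2
    exact h3.contMDiff.comp_contMDiffOn h2
  refine (h1.contMDiffAt hO).congr_of_eventuallyEq ?_
  filter_upwards [hO] with z hz
  exact hν.normSqA_eq hF _ hz

theorem normSqA_nonneg (hF : IsSmoothImmersion I F) (x : M) : 0 ≤ normSqA I F x := by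
  rw [normSqA_eq_sum (stdOrthonormalBasis ℝ V) hF]
  positivity

theorem isFlat_of_normSqA_eq_zero (hF : IsSmoothImmersion I F) (h : ∀ x, normSqA I F x = 0) :
    IsFlat I F := by
  intro x u v
  set T := fderiv ℝ (inChart I F x) (extChartAt I x x)
  have hT : Function.Injective T := fderiv_inChart_injective hF (mem_extChartAt_source x)
  set e := stdOrthonormalBasis ℝ V
  have h0 := h x
  rw [normSqA_eq_sum e hF, Finset.sum_eq_zero_iff_of_nonneg fun _ _ => by positivity] at h0
  have h1 : ∀ a b, secondFundamentalBilin I F x (pinv T (e a)) (pinv T (e b)) = 0 := by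
    intro a b
    have h2 := h0 a (Finset.mem_univ a)
    rw [Finset.sum_eq_zero_iff_of_nonneg fun _ _ => by positivity] at h2
    exact norm_eq_zero.1 (pow_eq_zero_iff two_ne_zero |>.1 (h2 b (Finset.mem_univ b)))
  have h3 : ∀ u, u = ∑ a, inner ℝ (e a) (T u) • pinv T (e a) := by
    intro u
    conv_lhs => rw [← pinv_comp_apply hT u, ← e.sum_repr (T u)]
    simp [map_sum, e.repr_apply_apply]
  rw [← secondFundamentalBilin_apply, h3 u, h3 v]
  simp [map_sum, LinearMap.sum_apply, h1]

theorem normSqA_eq_zero_of_isFlat (hF : IsSmoothImmersion I F) (h : IsFlat I F) (x : M) :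
    normSqA I F x = 0 := by
  rw [normSqA_eq_sum (stdOrthonormalBasis ℝ V) hF]
  simp [h x]

end ShapeOperator

/-! ### The sharp Kato inequality -/

section Kato

/-- The sharp Kato inequality for a totally symmetric trace-free three-tensor `h`, paired with a
diagonal matrix `l`. -/
theorem kato_trace_free {κ : Type*} [Fintype κ] [DecidableEq κ] (l : κ → ℝ) (h : κ → κ → κ → ℝ)
    (h12 : ∀ k i j, h k i j = h i k j) (h23 : ∀ k i j, h k i j = h k j i)
    (htr : ∀ k, ∑ i, h k i i = 0) :
    (1 + 2 / (Fintype.card κ : ℝ)) * ∑ k, (∑ i, l i * h k i i) ^ 2 ≤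
      (∑ i, l i ^ 2) * ∑ k, ∑ i, ∑ j, h k i j ^ 2 := by
  rcases isEmpty_or_nonempty κ with hκ | hκ
  · simp
  have hm : (0 : ℝ) < Fintype.card κ := by exact_mod_cast Fintype.card_pos
  set m : ℝ := (Fintype.card κ : ℝ) with hmdef
  set a := ∑ k, h k k k ^ 2
  set b := ∑ k, ∑ i ∈ Finset.univ.erase k, h k i i ^ 2
  have hab : ∑ k, ∑ i, h k i i ^ 2 = a + b := by
    rw [← Finset.sum_add_distrib]
    exact Finset.sum_congr rfl fun k _ =>
      (Finset.add_sum_erase _ (fun i => h k i i ^ 2) (Finset.mem_univ k)).symm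
  have h1 : ∑ k, (∑ i, l i * h k i i) ^ 2 ≤ (∑ i, l i ^ 2) * (a + b) := by
    rw [← hab, Finset.mul_sum]
    exact Finset.sum_le_sum fun k _ => Finset.sum_mul_sq_le_sq_mul_sq _ _ _
  -- the diagonal entries are controlled by the others because the trace vanishes
  have h2 : a ≤ (m - 1) * b := by
    rw [Finset.mul_sum]
    refine Finset.sum_le_sum fun k _ => ?_
    have h3 : h k k k = -∑ i ∈ Finset.univ.erase k, h k i i := by
      have := Finset.add_sum_erase _ (fun i => h k i i) (Finset.mem_univ k)
      rw [htr] at this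
      linarith
    have h4 : ((Finset.univ.erase k).card : ℝ) = m - 1 := by
      rw [Finset.card_erase_of_mem (Finset.mem_univ k), Nat.cast_sub]
      · simp [hmdef]
      · exact Fintype.card_pos (α := κ)
    rw [h3, neg_sq, ← h4]
    exact sq_sum_le_card_mul_sum_sq
  -- every off-diagonal entry occurs three times
  have h5 : a + 3 * b ≤ ∑ k, ∑ i, ∑ j, h k i j ^ 2 := by
    have h6 : ∀ k i j, ((if i = j then h k i j ^ 2 else 0) +
        (if k = i then if j = k then 0 else h k i j ^ 2 else 0)) +
        (if k = j then if i = k then 0 else h k i j ^ 2 else 0) ≤ h k i j ^ 2 := by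
      intro k i j
      rcases eq_or_ne i j with rfl | hij
      · rcases eq_or_ne k i with rfl | hki
        · simp
        · simp [hki]
      · rcases eq_or_ne k i with rfl | hki
        · simp [hij, hij.symm]
        · rcases eq_or_ne k j with rfl | hkj
          · simp [hij]
          · simpa [hij, hki, hkj] using sq_nonneg (h k i j)
    refine le_trans (le_of_eq ?_) (Finset.sum_le_sum fun k _ => Finset.sum_le_sum fun i _ =>
      Finset.sum_le_sum fun j _ => h6 k i j)
    simp only [Finset.sum_add_distrib]
    have e1 : ∑ k, ∑ i, ∑ j, (if i = j then h k i j ^ 2 else 0) = a + b := by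
      simp [← hab]
    have e0 : ∀ k, ∑ i ∈ Finset.univ.erase k, h k i i ^ 2 =
        ∑ i, if i = k then 0 else h k i i ^ 2 := by
      intro k
      rw [← Finset.add_sum_erase _ (fun i => if i = k then (0 : ℝ) else h k i i ^ 2)
        (Finset.mem_univ k), if_pos rfl, zero_add]
      exact Finset.sum_congr rfl fun i hi => by rw [if_neg (Finset.ne_of_mem_erase hi)]
    have e2 : ∑ k, ∑ i, ∑ j, (if k = i then if j = k then 0 else h k i j ^ 2 else 0) = b := by
      have : ∀ k, ∑ i, ∑ j, (if k = i then if j = k then 0 else h k i j ^ 2 else 0) =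
          ∑ j, if j = k then 0 else h k k j ^ 2 := by
        intro k
        rw [Finset.sum_comm]
        simp
      simp_rw [this, b, e0]
      rw [Finset.sum_comm]
      refine Finset.sum_congr rfl fun k _ => Finset.sum_congr rfl fun i _ => ?_
      rw [h23 i i k, h12 i k i]
      simp only [eq_comm]
    have e3 : ∑ k, ∑ i, ∑ j, (if k = j then if i = k then 0 else h k i j ^ 2 else 0) = b := by
      rw [← e2]
      refine Finset.sum_congr rfl fun k _ => ?_
      rw [Finset.sum_comm]
      refine Finset.sum_congr rfl fun i _ => Finset.sum_congr rfl fun j _ => ?_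
      rw [h23]
    rw [e1, e2, e3]
    ring
  have h7 : (1 + 2 / m) * (a + b) ≤ a + 3 * b := by
    have h8 : a + 3 * b - (1 + 2 / m) * (a + b) = 2 / m * ((m - 1) * b - a) := by
      field_simp
      ring
    have : 0 ≤ 2 / m * ((m - 1) * b - a) := mul_nonneg (by positivity) (by linarith)
    linarith
  have hl : 0 ≤ ∑ i, l i ^ 2 := by positivity
  calc (1 + 2 / m) * ∑ k, (∑ i, l i * h k i i) ^ 2
      ≤ (1 + 2 / m) * ((∑ i, l i ^ 2) * (a + b)) := by gcongr
    _ = (∑ i, l i ^ 2) * ((1 + 2 / m) * (a + b)) := by ring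
    _ ≤ _ := mul_le_mul_of_nonneg_left (h7.trans h5) hl

end Kato

/-! ### Simons' identity on a minimal cone -/

section Simons

/-- The algebra of a minimal hypersurface that is a cone: `R` stands for the smooth functions on an
open part of the cone, `D a` for the tangential derivatives along an orthonormal basis of the
ambient space, `ν a` for the components of the unit normal and `x a` for the coordinates. The matrix
`D a (ν b)` is the shape operator. -/
structure MinimalConeAlgebra {ι R : Type*} [Fintype ι] [DecidableEq ι] [CommRing R] [Algebra ℝ R]
    (D : ι → Derivation ℝ R R) (ν x : ι → R) : Prop where
  unit : ∑ a, ν a * ν a = 1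
  normal : ∀ u, ∑ a, ν a * D a u = 0
  symm : ∀ a b, D a (ν b) = D b (ν a)
  minimal : ∑ a, D a (ν a) = 0
  comm : ∀ a b u, D a (D b u) - D b (D a u) =
    ∑ c, (ν a * D b (ν c) - ν b * D a (ν c)) * D c u
  coord : ∀ a b, D a (x b) = (if a = b then 1 else 0) - ν a * ν b
  cone : ∑ a, x a * ν a = 0

namespace MinimalConeAlgebra

variable {ι R : Type*} [Fintype ι] [DecidableEq ι] [CommRing R] [Algebra ℝ R]
  {D : ι → Derivation ℝ R R} {ν x : ι → R} (h : MinimalConeAlgebra D ν x)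
include h

omit h in
theorem eq_zero_of_add_self {u : R} (hu : u + u = 0) : u = 0 := by
  have : (2 : ℝ) • u = 0 := by rw [two_smul, hu]
  rw [← one_smul ℝ u, show (1 : ℝ) = 2⁻¹ * 2 by norm_num, mul_smul, this, smul_zero]

/-- The normal is in the kernel of the shape operator. -/
theorem sum_shape_mul_normal (a : ι) : ∑ b, D a (ν b) * ν b = 0 := by
  have h1 := congrArg (D a) h.unit
  simp only [map_sum, Derivation.leibniz, smul_eq_mul, Derivation.map_one_eq_zero,
    Finset.sum_add_distrib] at h1
  simp only [mul_comm (ν _)] at h1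
  exact eq_zero_of_add_self h1

theorem sum_normal_mul_shape (a : ι) : ∑ b, ν b * D a (ν b) = 0 := by
  simpa only [mul_comm] using h.sum_shape_mul_normal a

/-- Codazzi's equation. -/
theorem codazzi (a b c : ι) : D c (D a (ν b)) = D a (D c (ν b)) +
    ν c * (∑ d, D a (ν d) * D d (ν b)) - ν a * (∑ d, D c (ν d) * D d (ν b)) := by
  have h1 := h.comm c a (ν b)
  simp only [sub_mul, Finset.sum_sub_distrib, mul_assoc, ← Finset.mul_sum] at h1
  linear_combination h1

theorem sum_deriv_shape_mul_normal (a c : ι) :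
    ∑ b, D c (D a (ν b)) * ν b = -∑ b, D a (ν b) * D b (ν c) := by
  have h1 := congrArg (D c) (h.sum_shape_mul_normal a)
  simp only [map_sum, Derivation.leibniz, smul_eq_mul, map_zero, Finset.sum_add_distrib] at h1
  have h2 : ∑ b, D a (ν b) * D c (ν b) = ∑ b, D a (ν b) * D b (ν c) :=
    Finset.sum_congr rfl fun b _ => by rw [h.symm c b]
  have h3 : ∑ b, ν b * D c (D a (ν b)) = ∑ b, D c (D a (ν b)) * ν b :=
    Finset.sum_congr rfl fun b _ => mul_comm _ _
  rw [h2, h3] at h1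
  linear_combination h1

/-- On a cone, the position vector is in the kernel of the shape operator. -/
theorem sum_shape_mul_coord (a : ι) : ∑ b, D a (ν b) * x b = 0 := by
  have h1 := congrArg (D a) h.cone
  simp only [map_sum, Derivation.leibniz, smul_eq_mul, map_zero, Finset.sum_add_distrib,
    h.coord, mul_sub, mul_ite, mul_one, mul_zero, Finset.sum_sub_distrib,
    Finset.sum_ite_eq, Finset.mem_univ, if_true] at h1
  have h2 : ∑ b, ν b * (ν a * ν b) = ν a := by
    calc ∑ b, ν b * (ν a * ν b) = ν a * ∑ b, ν b * ν b := by
          rw [Finset.mul_sum]; exact Finset.sum_congr rfl fun b _ => by ring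
      _ = ν a := by rw [h.unit, mul_one]
  have h3 : ∑ b, x b * D a (ν b) = ∑ b, D a (ν b) * x b :=
    Finset.sum_congr rfl fun b _ => mul_comm _ _
  rw [h2, h3] at h1
  linear_combination h1

theorem sum_deriv_shape_mul_coord (a c : ι) :
    ∑ b, D c (D a (ν b)) * x b = -D a (ν c) := by
  have h1 := congrArg (D c) (h.sum_shape_mul_coord a)
  simp only [map_sum, Derivation.leibniz, smul_eq_mul, map_zero, Finset.sum_add_distrib,
    h.coord, mul_sub, mul_ite, mul_one, mul_zero, Finset.sum_sub_distrib,
    Finset.sum_ite_eq, Finset.mem_univ, if_true] at h1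
  have h2 : ∑ b, D a (ν b) * (ν c * ν b) = 0 := by
    rw [← mul_zero (ν c), ← h.sum_shape_mul_normal a, Finset.mul_sum]
    exact Finset.sum_congr rfl fun b _ => by ring
  have h3 : ∑ b, x b * D c (D a (ν b)) = ∑ b, D c (D a (ν b)) * x b :=
    Finset.sum_congr rfl fun b _ => mul_comm _ _
  rw [h2, h3] at h1
  linear_combination h1

/-- The shape operator of a cone is homogeneous of degree `-1`. -/
theorem sum_coord_mul_deriv_shape (a b : ι) :
    ∑ c, x c * D c (D a (ν b)) = -D a (ν b) := by
  have h1 : ∀ c, x c * D c (D a (ν b)) = D a (D b (ν c)) * x c +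
      (x c * ν c) * (∑ d, D a (ν d) * D d (ν b)) -
      ν a * (∑ d, (D d (ν c) * x c) * D d (ν b)) := by
    intro c
    rw [h.codazzi, h.symm c b]
    have : ∑ d, (D d (ν c) * x c) * D d (ν b) = x c * ∑ d, D c (ν d) * D d (ν b) := by
      rw [Finset.mul_sum]
      exact Finset.sum_congr rfl fun d _ => by rw [h.symm c d]; ring
    rw [this]
    ring
  simp only [h1, Finset.sum_sub_distrib, Finset.sum_add_distrib, ← Finset.sum_mul, h.cone,
    h.sum_deriv_shape_mul_coord, ← Finset.mul_sum]
  rw [Finset.sum_comm]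
  simp only [← Finset.sum_mul, h.sum_shape_mul_coord]
  rw [h.symm b a]
  simp

/-- The Laplacian of the normal of a minimal hypersurface is `-|A|² ν`. -/
theorem sum_deriv_shape (b : ι) :
    ∑ c, D c (D c (ν b)) = -(ν b * ∑ c, ∑ d, D c (ν d) * D c (ν d)) := by
  have h1 : ∀ c, D c (D c (ν b)) = D b (D c (ν c)) +
      (∑ d, D b (ν d) * (ν c * D d (ν c))) - ν b * (∑ d, D c (ν d) * D c (ν d)) := by
    intro c
    rw [h.symm c b, h.codazzi b c c]
    congr 2
    · rw [Finset.mul_sum]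
      exact Finset.sum_congr rfl fun d _ => by ring
    · exact Finset.sum_congr rfl fun d _ => by rw [h.symm d c]
  simp only [h1, Finset.sum_sub_distrib, Finset.sum_add_distrib, ← map_sum, h.minimal, map_zero,
    ← Finset.mul_sum]
  rw [Finset.sum_comm]
  simp only [← Finset.mul_sum, h.sum_normal_mul_shape]
  simp

/-- Simons' identity, before completing the square. The second derivatives are those of the ambient
components of the shape operator and not covariant derivatives; this is why `2 |A²|²` appears
besides the usual `|A|⁴`. -/
theorem sum_shape_mul_laplacian :
    ∑ a, ∑ b, ∑ c, D a (ν b) * D c (D c (D a (ν b))) =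
      -(∑ a, ∑ b, D a (ν b) * D a (ν b)) ^ 2 -
        2 * ∑ a, ∑ b, (∑ d, D a (ν d) * D d (ν b)) ^ 2 := by
  set A : ι → ι → R := fun a b => D a (ν b) with hA
  set B : ι → ι → R := fun a b => ∑ d, A a d * A d b with hB
  set S : R := ∑ a, ∑ b, A a b * A a b with hS
  have hs : ∀ a b, A a b = A b a := h.symm
  have hBs : ∀ a b, B a b = B b a := fun a b =>
    Finset.sum_congr rfl fun d _ => by rw [hs a d, hs d b, mul_comm]
  have hAν : ∀ a, ∑ b, A a b * ν b = 0 := h.sum_shape_mul_normal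
  have hAν' : ∀ b, ∑ a, A a b * ν a = 0 := fun b => by
    simpa only [hs _ b] using hAν b
  -- expand the second derivative by Codazzi's equation and the commutator formula
  have h1 : ∀ a b c, D c (D c (A a b)) = D a (D c (A c b)) +
      (∑ d, A a d * (ν c * D d (A b c)) - ν a * ∑ d, A c d * D d (A c b)) +
      (ν c * D c (B a b) + B a b * A c c) - (ν a * D c (B c b) + B c b * A c a) := by
    intro a b c
    have e1 : D c (A a b) = D a (A c b) + ν c * B a b - ν a * B c b := h.codazzi a b c
    have e2 := h.comm c a (A c b)
    simp only [sub_mul, Finset.sum_sub_distrib, mul_assoc, ← Finset.mul_sum] at e2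
    have e3 : ∑ d, A a d * (ν c * D d (A b c)) = ν c * ∑ d, D a (ν d) * D d (A c b) := by
      rw [Finset.mul_sum]
      exact Finset.sum_congr rfl fun d _ => by rw [hs b c]; simp only [hA]; ring
    rw [e1, map_sub, map_add, Derivation.leibniz, Derivation.leibniz, e3]
    simp only [smul_eq_mul, hA] at e2 ⊢
    linear_combination e2
  have h2 : ∀ a b, ∑ c, D c (D c (A a b)) = D a (-(ν b * S)) - ∑ d, A a d * B b d -
      ν a * (∑ c, (∑ d, A c d * D d (A c b) + D c (B c b))) - ∑ c, B c b * A c a := by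
    intro a b
    have e1 : ∑ c, D a (D c (A c b)) = D a (-(ν b * S)) := by
      rw [← map_sum]; exact congrArg (D a) (h.sum_deriv_shape b)
    have e2 : ∑ c, ∑ d, A a d * (ν c * D d (A b c)) = -∑ d, A a d * B b d := by
      rw [Finset.sum_comm, ← Finset.sum_neg_distrib]
      refine Finset.sum_congr rfl fun d _ => ?_
      rw [← Finset.mul_sum, ← mul_neg]
      congr 1
      rw [← h.sum_deriv_shape_mul_normal b d]
      exact Finset.sum_congr rfl fun c _ => mul_comm _ _
    have e3 : ∑ c, ν c * D c (B a b) = 0 := h.normal _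
    have e4 : ∑ c, B a b * A c c = 0 := by
      rw [← Finset.mul_sum]; exact (congrArg (B a b * ·) h.minimal).trans (mul_zero _)
    simp only [h1, Finset.sum_sub_distrib, Finset.sum_add_distrib, e1, e2, e3, e4,
      ← Finset.mul_sum]
    ring
  have h3 : ∀ a b, ∑ c, A a b * D c (D c (A a b)) = -(A a b * A a b) * S - A a b * ν b * D a S -
      ∑ d, A b a * A a d * B b d -
      A a b * ν a * (∑ c, (∑ d, A c d * D d (A c b) + D c (B c b))) -
      ∑ c, A c a * A a b * B c b := by
    intro a b
    rw [← Finset.mul_sum, h2, map_neg, Derivation.leibniz]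
    have e1 : ∑ d, A b a * A a d * B b d = A a b * ∑ d, A a d * B b d := by
      rw [Finset.mul_sum]
      exact Finset.sum_congr rfl fun d _ => by rw [hs b a]; ring
    have e2 : ∑ c, A c a * A a b * B c b = A a b * ∑ c, B c b * A c a := by
      rw [Finset.mul_sum]
      exact Finset.sum_congr rfl fun d _ => by ring
    rw [e1, e2]
    simp only [smul_eq_mul, hA]
    ring
  have e1 : ∑ a, ∑ b, -(A a b * A a b) * S = -S ^ 2 := by
    simp only [← Finset.sum_mul, Finset.sum_neg_distrib]
    ring
  have e2 : ∑ a, ∑ b, A a b * ν b * D a S = 0 := by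
    simp only [← Finset.sum_mul, hAν]; simp
  have e3 : ∑ a, ∑ b, ∑ d, A b a * A a d * B b d = ∑ a, ∑ b, B a b ^ 2 := by
    rw [Finset.sum_comm]
    refine Finset.sum_congr rfl fun b _ => ?_
    rw [Finset.sum_comm]
    refine Finset.sum_congr rfl fun d _ => ?_
    rw [← Finset.sum_mul, sq]
  have e4 : ∑ a, ∑ b, A a b * ν a * (∑ c, (∑ d, A c d * D d (A c b) + D c (B c b))) = 0 := by
    rw [Finset.sum_comm]
    simp only [← Finset.sum_mul, hAν']; simp
  have e5 : ∑ a, ∑ b, ∑ c, A c a * A a b * B c b = ∑ a, ∑ b, B a b ^ 2 := by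
    rw [Finset.sum_comm]
    have : ∀ b, ∑ a, ∑ c, A c a * A a b * B c b = ∑ c, B c b ^ 2 := by
      intro b
      rw [Finset.sum_comm]
      refine Finset.sum_congr rfl fun c _ => ?_
      rw [← Finset.sum_mul, sq]
    simp only [this]
    rw [Finset.sum_comm]
  change ∑ a, ∑ b, ∑ c, A a b * D c (D c (A a b)) = -S ^ 2 - 2 * ∑ a, ∑ b, B a b ^ 2
  simp only [h3, Finset.sum_sub_distrib, e1, e2, e3, e4, e5]
  ring

/-- The function `|A|²` on a cone is homogeneous of degree `-2`. -/
theorem sum_coord_mul_deriv_normSq :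
    ∑ c, x c * D c (∑ a, ∑ b, D a (ν b) * D a (ν b)) =
      -2 * ∑ a, ∑ b, D a (ν b) * D a (ν b) := by
  simp only [map_sum, Derivation.leibniz, smul_eq_mul, Finset.mul_sum]
  rw [Finset.sum_comm]
  refine Finset.sum_congr rfl fun a _ => ?_
  rw [Finset.sum_comm]
  refine Finset.sum_congr rfl fun b _ => ?_
  have := h.sum_coord_mul_deriv_shape a b
  calc ∑ c, x c * (D a (ν b) * D c (D a (ν b)) + D a (ν b) * D c (D a (ν b)))
      = 2 * D a (ν b) * ∑ c, x c * D c (D a (ν b)) := by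
        rw [Finset.mul_sum]; exact Finset.sum_congr rfl fun c _ => by ring
    _ = _ := by rw [this]; ring

theorem deriv_sum_coord_sq (a : ι) : D a (∑ b, x b * x b) = 2 * x a := by
  simp only [map_sum, Derivation.leibniz, smul_eq_mul, h.coord, Finset.sum_add_distrib, mul_sub,
    mul_ite, mul_one, mul_zero, Finset.sum_sub_distrib, Finset.sum_ite_eq, Finset.mem_univ,
    if_true]
  have : ∑ b, x b * (ν a * ν b) = 0 := by
    rw [← mul_zero (ν a), ← h.cone, Finset.mul_sum]
    exact Finset.sum_congr rfl fun b _ => by ring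
  rw [this]
  ring

theorem sum_deriv_coord : ∑ a, D a (x a) = (Fintype.card ι : R) - 1 := by
  simp [h.coord, h.unit]

/-- The function `|x|² |A|²` on a cone is homogeneous of degree zero. -/
theorem sum_coord_mul_deriv_scaled :
    ∑ c, x c * D c ((∑ b, x b * x b) * ∑ a, ∑ b, D a (ν b) * D a (ν b)) = 0 := by
  have h1 := h.sum_coord_mul_deriv_normSq
  set S := ∑ a, ∑ b, D a (ν b) * D a (ν b)
  have h2 : ∀ c, x c * D c ((∑ b, x b * x b) * S) =
      (∑ b, x b * x b) * (x c * D c S) + 2 * S * (x c * x c) := by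
    intro c
    rw [Derivation.leibniz, h.deriv_sum_coord_sq]
    simp only [smul_eq_mul]; ring
  simp only [h2, Finset.sum_add_distrib, ← Finset.mul_sum, h1]
  ring

/-- Simons' identity for the function `|x|² |A|²` on a minimal cone. -/
theorem laplacian_scaled :
    ∑ c, D c (D c ((∑ b, x b * x b) * ∑ a, ∑ b, D a (ν b) * D a (ν b))) =
      2 * (((Fintype.card ι : R) - 5) * (∑ a, ∑ b, D a (ν b) * D a (ν b)) +
        (∑ b, x b * x b) * ((∑ c, ∑ a, ∑ b, D c (D a (ν b)) ^ 2) -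
        (∑ a, ∑ b, D a (ν b) * D a (ν b)) ^ 2 -
        2 * ∑ a, ∑ b, (∑ d, D a (ν d) * D d (ν b)) ^ 2)) := by
  have h1 := h.sum_coord_mul_deriv_normSq
  have h0 := h.sum_shape_mul_laplacian
  have h3 : ∑ c, D c (D c (∑ a, ∑ b, D a (ν b) * D a (ν b))) =
      2 * (∑ c, ∑ a, ∑ b, D c (D a (ν b)) ^ 2) +
      2 * ∑ a, ∑ b, ∑ c, D a (ν b) * D c (D c (D a (ν b))) := by
    have e1 : ∑ a, ∑ b, ∑ c, D a (ν b) * D c (D c (D a (ν b))) =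
        ∑ c, ∑ a, ∑ b, D a (ν b) * D c (D c (D a (ν b))) := by
      rw [Finset.sum_comm]
      conv_rhs => rw [Finset.sum_comm]
      rw [Finset.sum_comm]
      exact Finset.sum_congr rfl fun a _ => Finset.sum_comm
    rw [e1]
    simp only [Finset.mul_sum, ← Finset.sum_add_distrib, map_sum, Derivation.leibniz, smul_eq_mul,
      map_add]
    refine Finset.sum_congr rfl fun c _ => Finset.sum_congr rfl fun a _ =>
      Finset.sum_congr rfl fun b _ => by ring
  set S := ∑ a, ∑ b, D a (ν b) * D a (ν b)
  have h2 : ∀ c, D c (D c ((∑ b, x b * x b) * S)) =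
      (∑ b, x b * x b) * D c (D c S) + 4 * (x c * D c S) + 2 * S * D c (x c) := by
    intro c
    have e2 : D c ((∑ b, x b * x b) * S) = (∑ b, x b * x b) * D c S + (2 : ℝ) • (x c * S) := by
      rw [Derivation.leibniz, h.deriv_sum_coord_sq, two_smul]
      simp only [smul_eq_mul]; ring
    rw [e2, map_add, Derivation.leibniz, h.deriv_sum_coord_sq, Derivation.map_smul,
      Derivation.leibniz, two_smul]
    simp only [smul_eq_mul]
    ring
  rw [h0] at h3
  simp only [h2, Finset.sum_add_distrib, ← Finset.mul_sum, h1, h3, h.sum_deriv_coord]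
  ring

end MinimalConeAlgebra

end Simons

/-! ### The Simons–Kato inequality at a point -/

section PointwiseSimons

namespace MinimalConeAlgebra

variable {κ R : Type*} [Fintype κ] [DecidableEq κ] [CommRing R] [Algebra ℝ R]
  {D : κ ⊕ Fin 2 → Derivation ℝ R R} {ν x : κ ⊕ Fin 2 → R}

/-- The Simons inequality with the Kato term, at a point (where the functions take the values
given by `ev`), for an orthonormal basis consisting of principal directions tangent to the link,
the radial direction, and the normal. Here `f = |x|² |A|²`. -/
theorem simons_kato (h : MinimalConeAlgebra D ν x) (ev : R →ₐ[ℝ] ℝ) (l : κ → ℝ) {ρ : ℝ}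
    (hρ : 0 < ρ) (hνl : ∀ i, ev (ν (Sum.inl i)) = 0) (hν0 : ev (ν (Sum.inr 0)) = 0)
    (hν1 : ev (ν (Sum.inr 1)) = 1) (hxl : ∀ i, ev (x (Sum.inl i)) = 0)
    (hx0 : ev (x (Sum.inr 0)) = ρ) (hx1 : ev (x (Sum.inr 1)) = 0)
    (hA : ∀ i j, ev (D (Sum.inl i) (ν (Sum.inl j))) = if i = j then l i else 0)
    {a2 f : R} (ha2 : a2 = ∑ a, ∑ b, D a (ν b) * D a (ν b)) (hf : f = (∑ b, x b * x b) * a2) :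
    0 ≤ ev (∑ c, D c (D c f)) / 2 - Fintype.card κ * ev a2 + ρ ^ 2 * ev a2 ^ 2 ∧
    (1 + 2 / (Fintype.card κ : ℝ)) * ((∑ c, ev (D c f) ^ 2) / 4) ≤
      ev f * (ev (∑ c, D c (D c f)) / 2 - Fintype.card κ * ev a2 + ρ ^ 2 * ev a2 ^ 2) := by
  set A : κ ⊕ Fin 2 → κ ⊕ Fin 2 → ℝ := fun a b => ev (D a (ν b)) with hAdef
  set T : κ ⊕ Fin 2 → κ ⊕ Fin 2 → κ ⊕ Fin 2 → ℝ := fun c a b => ev (D c (D a (ν b))) with hT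
  have hAs : ∀ a b, A a b = A b a := fun a b => congrArg ev (h.symm a b)
  have hTs : ∀ c a b, T c a b = T c b a := fun c a b => by
    simp only [hT, h.symm a b]
  -- the components of the shape operator
  have hA1 : ∀ a, A a (Sum.inr 1) = 0 := fun a => by
    have := congrArg ev (h.sum_shape_mul_normal a)
    simpa [Fintype.sum_sum_type, hνl, hν0, hν1] using this
  have hA0 : ∀ a, A a (Sum.inr 0) = 0 := fun a => by
    have := congrArg ev (h.sum_shape_mul_coord a)
    simpa [Fintype.sum_sum_type, hxl, hx0, hx1, hρ.ne'] using this
  have hAl : ∀ i j, A (Sum.inl i) (Sum.inl j) = if i = j then l i else 0 := hA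
  have hA1' : ∀ a, A (Sum.inr 1) a = 0 := fun a => by rw [hAs, hA1]
  have hA0' : ∀ a, A (Sum.inr 0) a = 0 := fun a => by rw [hAs, hA0]
  -- the components of its derivative
  have hT1 : ∀ i j, T (Sum.inl i) (Sum.inl j) (Sum.inr 1) = if i = j then -l i ^ 2 else 0 := by
    intro i j
    have := congrArg ev (h.sum_deriv_shape_mul_normal (Sum.inl j) (Sum.inl i))
    simp only [map_sum, map_add, map_mul, map_neg, Fintype.sum_sum_type, Fin.sum_univ_two, hνl, hν0,
        hν1]
      at this
    change _ + (_ + T (Sum.inl i) (Sum.inl j) (Sum.inr 1) * 1) =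
      -(∑ d, A (Sum.inl j) (Sum.inl d) * A (Sum.inl d) (Sum.inl i) +
      (A (Sum.inl j) (Sum.inr 0) * A (Sum.inr 0) (Sum.inl i) +
        A (Sum.inl j) (Sum.inr 1) * A (Sum.inr 1) (Sum.inl i))) at this
    simp only [hA0, hA1, hAl, mul_zero, Finset.sum_const_zero, zero_add, mul_one, zero_mul,
      add_zero, mul_ite, ite_mul] at this
    rw [this]
    rcases eq_or_ne i j with rfl | hij
    · simp [sq]
    · simp [hij, hij.symm]
  have hT0 : ∀ i j, T (Sum.inl i) (Sum.inl j) (Sum.inr 0) = if i = j then -l i / ρ else 0 := by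
    intro i j
    have := congrArg ev (h.sum_deriv_shape_mul_coord (Sum.inl j) (Sum.inl i))
    simp only [map_sum, map_add, map_mul, map_neg, Fintype.sum_sum_type, Fin.sum_univ_two, hxl, hx0,
        hx1]
      at this
    change _ + (T (Sum.inl i) (Sum.inl j) (Sum.inr 0) * ρ + _) =
      -A (Sum.inl j) (Sum.inl i) at this
    simp only [hAl, mul_zero, Finset.sum_const_zero, zero_add, add_zero] at this
    have h2 : T (Sum.inl i) (Sum.inl j) (Sum.inr 0) = -(if j = i then l j else 0) / ρ := by
      rw [← this]; field_simp
    rw [h2]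
    split_ifs with h1 h2 h2
    · subst h1; rfl
    · exact absurd h1.symm h2
    · exact absurd h2.symm h1
    · simp
  have hTr : ∀ i j, T (Sum.inr 0) (Sum.inl i) (Sum.inl j) = if i = j then -l i / ρ else 0 := by
    intro i j
    have := congrArg ev (h.sum_coord_mul_deriv_shape (Sum.inl i) (Sum.inl j))
    simp only [map_sum, map_add, map_mul, map_neg, Fintype.sum_sum_type, Fin.sum_univ_two, hxl, hx0,
        hx1]
      at this
    change _ + (ρ * T (Sum.inr 0) (Sum.inl i) (Sum.inl j) + _) =
      -A (Sum.inl i) (Sum.inl j) at this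
    simp only [hAl, zero_mul, Finset.sum_const_zero, zero_add, add_zero] at this
    have h2 : T (Sum.inr 0) (Sum.inl i) (Sum.inl j) = -(if i = j then l i else 0) / ρ := by
      rw [← this]; field_simp
    rw [h2]
    split_ifs <;> simp
  -- the tangential part of the derivative of the shape operator
  set t : κ → κ → κ → ℝ := fun k i j => T (Sum.inl k) (Sum.inl i) (Sum.inl j) with ht
  have ht12 : ∀ k i j, t k i j = t i k j := by
    intro k i j
    have := congrArg ev (h.codazzi (Sum.inl i) (Sum.inl j) (Sum.inl k))
    simp only [map_sub, map_add, map_mul, hνl, zero_mul, add_zero, sub_zero] at this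
    exact this
  have ht23 : ∀ k i j, t k i j = t k j i := fun k i j => hTs _ _ _
  have hTrace : ∀ k, ∑ i, t k i i = 0 := by
    intro k
    have h1 := congrArg (fun u => ev (D (Sum.inl k) u)) h.minimal
    simp only [map_sum, map_add, map_zero, Fintype.sum_sum_type, Fin.sum_univ_two] at h1
    have h2 : T (Sum.inl k) (Sum.inr 1) (Sum.inr 1) = 0 := by
      have := congrArg ev (h.sum_deriv_shape_mul_normal (Sum.inr 1) (Sum.inl k))
      simp only [map_sum, map_add, map_mul, map_neg, Fintype.sum_sum_type, Fin.sum_univ_two, hνl,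
          hν0, hν1]
        at this
      change _ + (_ + T (Sum.inl k) (Sum.inr 1) (Sum.inr 1) * 1) =
        -(∑ d, A (Sum.inr 1) (Sum.inl d) * A (Sum.inl d) (Sum.inl k) +
        (A (Sum.inr 1) (Sum.inr 0) * A (Sum.inr 0) (Sum.inl k) +
          A (Sum.inr 1) (Sum.inr 1) * A (Sum.inr 1) (Sum.inl k))) at this
      simpa [hA1'] using this
    have h3 : T (Sum.inl k) (Sum.inr 0) (Sum.inr 0) = 0 := by
      have := congrArg ev (h.sum_deriv_shape_mul_coord (Sum.inr 0) (Sum.inl k))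
      simp only [map_sum, map_add, map_mul, map_neg, Fintype.sum_sum_type, Fin.sum_univ_two, hxl,
          hx0, hx1]
        at this
      change _ + (T (Sum.inl k) (Sum.inr 0) (Sum.inr 0) * ρ + _) =
        -A (Sum.inr 0) (Sum.inl k) at this
      simpa [hA0', hρ.ne'] using this
    change ∑ i, t k i i + (T (Sum.inl k) (Sum.inr 0) (Sum.inr 0) +
      T (Sum.inl k) (Sum.inr 1) (Sum.inr 1)) = 0 at h1
    rw [h2, h3] at h1
    simpa using h1
  have hkato := kato_trace_free l t ht12 ht23 hTrace
  -- the values of the scalar quantities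
  have hS : ev a2 = ∑ i, l i ^ 2 := by
    rw [ha2]
    simp only [map_sum, map_mul]
    change ∑ a, ∑ b, A a b * A a b = _
    simp only [Fintype.sum_sum_type, Fin.sum_univ_two, hA0, hA1, hA0', hA1', hAl]
    simp [sq]
  have hQ : ev (∑ a, ∑ b, (∑ d, D a (ν d) * D d (ν b)) ^ 2) = ∑ i, l i ^ 4 := by
    simp only [map_sum, map_mul, map_pow]
    change ∑ a, ∑ b, (∑ d, A a d * A d b) ^ 2 = _
    simp only [Fintype.sum_sum_type, Fin.sum_univ_two, hA0, hA1, hA0', hA1', hAl]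
    simp
    refine Finset.sum_congr rfl fun i _ => by ring
  have hr : ev (∑ b, x b * x b) = ρ ^ 2 := by
    simp only [map_sum, map_add, map_mul, Fintype.sum_sum_type, Fin.sum_univ_two, hxl, hx0, hx1]
    simp [sq]
  -- the entries with one radial index contribute `|A|² / ρ²` for each of its three positions, those
  -- with the normal in one of the last two positions contribute `∑ l i ^ 4` each
  have hDA : ∑ k, ∑ i, ∑ j, t k i j ^ 2 + 2 * ∑ i, l i ^ 4 + 3 * (∑ i, l i ^ 2) / ρ ^ 2 ≤
      ev (∑ c, ∑ a, ∑ b, D c (D a (ν b)) ^ 2) := by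
    simp only [map_sum, map_pow]
    change _ ≤ ∑ c, ∑ a, ∑ b, T c a b ^ 2
    have e1 : ∀ i j, T (Sum.inl i) (Sum.inr 1) (Sum.inl j) = if i = j then -l i ^ 2 else 0 :=
      fun i j => by rw [hTs, hT1]
    have e2 : ∀ i j, T (Sum.inl i) (Sum.inr 0) (Sum.inl j) = if i = j then -l i / ρ else 0 :=
      fun i j => by rw [hTs, hT0]
    simp only [Fintype.sum_sum_type, Fin.sum_univ_two, hT1, hT0, hTr, e1, e2,
      Finset.sum_add_distrib, ite_pow, ne_eq, OfNat.ofNat_ne_zero, not_false_eq_true, zero_pow,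
      Finset.sum_ite_eq, Finset.mem_univ, if_true, neg_sq, ← pow_mul, neg_div, div_pow,
      ← Finset.sum_div]
    norm_num only
    have p : ∀ c a b, 0 ≤ T c a b ^ 2 := fun c a b => sq_nonneg _
    have p1 : ∀ c a, 0 ≤ ∑ i, T c a (Sum.inl i) ^ 2 := fun c a => Finset.sum_nonneg fun _ _ =>
        p _ _ _
    have p2 : ∀ a b, 0 ≤ ∑ i, T (Sum.inl i) a b ^ 2 := fun c a => Finset.sum_nonneg fun _ _ =>
        p _ _ _
    have p3 : ∀ c b, 0 ≤ ∑ i, T c (Sum.inl i) b ^ 2 := fun c a => Finset.sum_nonneg fun _ _ =>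
        p _ _ _
    have p4 : 0 ≤ ∑ i, ∑ j, T (Sum.inr 1) (Sum.inl i) (Sum.inl j) ^ 2 :=
      Finset.sum_nonneg fun _ _ => p1 _ _
    have p5 : 3 * (∑ i, l i ^ 2) / ρ ^ 2 = (∑ i, l i ^ 2) / ρ ^ 2 + (∑ i, l i ^ 2) / ρ ^ 2 +
      (∑ i, l i ^ 2) / ρ ^ 2 := by ring
    rw [p5]
    change ∑ k, ∑ i, ∑ j, T (Sum.inl k) (Sum.inl i) (Sum.inl j) ^ 2 + _ + _ ≤ _
    linarith [p2 (Sum.inr 0) (Sum.inr 0), p2 (Sum.inr 0) (Sum.inr 1), p2 (Sum.inr 1) (Sum.inr 0),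
      p2 (Sum.inr 1) (Sum.inr 1), p3 (Sum.inr 0) (Sum.inr 0), p3 (Sum.inr 0) (Sum.inr 1),
      p3 (Sum.inr 1) (Sum.inr 0), p3 (Sum.inr 1) (Sum.inr 1), p1 (Sum.inr 0) (Sum.inr 0),
      p1 (Sum.inr 0) (Sum.inr 1), p1 (Sum.inr 1) (Sum.inr 0), p1 (Sum.inr 1) (Sum.inr 1),
      p (Sum.inr 0) (Sum.inr 0) (Sum.inr 0), p (Sum.inr 0) (Sum.inr 0) (Sum.inr 1),
      p (Sum.inr 0) (Sum.inr 1) (Sum.inr 0), p (Sum.inr 0) (Sum.inr 1) (Sum.inr 1),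
      p (Sum.inr 1) (Sum.inr 0) (Sum.inr 0), p (Sum.inr 1) (Sum.inr 0) (Sum.inr 1),
      p (Sum.inr 1) (Sum.inr 1) (Sum.inr 0), p (Sum.inr 1) (Sum.inr 1) (Sum.inr 1)]
  have hlap := congrArg ev h.laplacian_scaled
  have hcard : (Fintype.card (κ ⊕ Fin 2) : R) = (Fintype.card κ : R) + 2 := by
    simp [Fintype.card_sum]
  rw [← ha2, ← hf, hcard] at hlap
  simp only [map_mul, map_add, map_sub, map_pow, map_natCast, hQ, hr, map_ofNat] at hlap
  have hf' : ev f = ρ ^ 2 * ∑ i, l i ^ 2 := by rw [hf, map_mul, hr, hS]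
  have hρ2 : 0 < ρ ^ 2 := by positivity
  -- the defect in Simons' inequality
  set Y := ev (∑ c, D c (D c f)) / 2 - Fintype.card κ * ev a2 + ρ ^ 2 * ev a2 ^ 2 with hY
  set t2 := ∑ k, ∑ i, ∑ j, t k i j ^ 2 with ht2
  have hYt : ρ ^ 2 * t2 ≤ Y := by
    have e1 : Y = -3 * ev a2 + ρ ^ 2 * (ev (∑ c, ∑ a, ∑ b, D c (D a (ν b)) ^ 2) -
        2 * ∑ i, l i ^ 4) := by
      rw [hY, hlap]; ring
    have e2 : ρ ^ 2 * (t2 + 2 * ∑ i, l i ^ 4 + 3 * (∑ i, l i ^ 2) / ρ ^ 2) ≤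
        ρ ^ 2 * ev (∑ c, ∑ a, ∑ b, D c (D a (ν b)) ^ 2) :=
      mul_le_mul_of_nonneg_left hDA hρ2.le
    have e3 : ρ ^ 2 * (3 * (∑ i, l i ^ 2) / ρ ^ 2) = 3 * ∑ i, l i ^ 2 := by field_simp
    rw [e1, hS]
    rw [mul_add, mul_add, e3] at e2
    linarith
  have ht2' : 0 ≤ t2 := by positivity
  refine ⟨le_trans (by positivity) hYt, ?_⟩
  -- the gradient of `f`
  have hgrad : ∑ c, ev (D c f) ^ 2 = 4 * (ρ ^ 4 * ∑ k, (∑ i, l i * t k i i) ^ 2) := by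
    have g1 : ev (D (Sum.inr 1) f) = 0 := by
      have := congrArg ev (h.normal f)
      simpa [Fintype.sum_sum_type, hνl, hν0, hν1] using this
    have g0 : ev (D (Sum.inr 0) f) = 0 := by
      have := congrArg ev h.sum_coord_mul_deriv_scaled
      rw [← ha2, ← hf] at this
      simpa [Fintype.sum_sum_type, hxl, hx0, hx1, hρ.ne'] using this
    have gl : ∀ k, ev (D (Sum.inl k) f) = 2 * ρ ^ 2 * ∑ i, l i * t k i i := by
      intro k
      have e1 : ev (D (Sum.inl k) a2) = 2 * ∑ i, l i * t k i i := by
        rw [ha2]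
        simp only [map_sum, Derivation.leibniz, smul_eq_mul, map_add, map_mul]
        change ∑ a, ∑ b, (A a b * T (Sum.inl k) a b + A a b * T (Sum.inl k) a b) = _
        simp only [Fintype.sum_sum_type, Fin.sum_univ_two, hA0, hA1, hA0', hA1', hAl]
        simp [Finset.mul_sum, ← two_mul, ht]
      rw [hf, Derivation.leibniz, h.deriv_sum_coord_sq]
      simp only [smul_eq_mul, map_add, map_mul, hxl, hr, e1]
      ring
    simp only [Fintype.sum_sum_type, Fin.sum_univ_two, g0, g1, gl, mul_pow, ← Finset.mul_sum]
    ring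
  rw [hgrad, hf']
  calc (1 + 2 / (Fintype.card κ : ℝ)) * (4 * (ρ ^ 4 * ∑ k, (∑ i, l i * t k i i) ^ 2) / 4)
      = ρ ^ 4 * ((1 + 2 / (Fintype.card κ : ℝ)) * ∑ k, (∑ i, l i * t k i i) ^ 2) := by ring
    _ ≤ ρ ^ 4 * ((∑ i, l i ^ 2) * t2) := mul_le_mul_of_nonneg_left hkato (by positivity)
    _ = ρ ^ 2 * (∑ i, l i ^ 2) * (ρ ^ 2 * t2) := by ring
    _ ≤ _ := mul_le_mul_of_nonneg_left hYt (by positivity)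

end MinimalConeAlgebra

end PointwiseSimons

/-! ### The algebra of smooth functions on an open set -/

section LocalSmoothFunctions

variable {E : Type uE} [NormedAddCommGroup E] [NormedSpace ℝ E] [FiniteDimensional ℝ E]
  {H : Type uH} [TopologicalSpace H] {I : ModelWithCorners ℝ E H} [I.Boundaryless]
  {M : Type uM} [TopologicalSpace M] [ChartedSpace H M] [IsManifold I ∞ M]
  {V : Type uV} [NormedAddCommGroup V] [InnerProductSpace ℝ V]

variable (I) in
/-- The algebra of smooth functions on the open set `O`, as functions on `O` that extend to a
function on `M` which is smooth on `O`. -/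
def smoothOn (O : Set M) : Subalgebra ℝ (O → ℝ) where
  carrier := {f | ∃ g : M → ℝ, ContMDiffOn I 𝓘(ℝ, ℝ) ∞ g O ∧ ∀ y, f y = g y}
  mul_mem' := by
    rintro _ _ ⟨g, hg, e⟩ ⟨g', hg', e'⟩
    exact ⟨fun y => g y * g' y, hg.mul hg', fun y => by simp [e, e']⟩
  add_mem' := by
    rintro _ _ ⟨g, hg, e⟩ ⟨g', hg', e'⟩
    exact ⟨fun y => g y + g' y, hg.add hg', fun y => by simp [e, e']⟩
  algebraMap_mem' c := ⟨fun _ => c, contMDiffOn_const, fun _ => rfl⟩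

/-- The restriction to `O` of a function that is smooth there. -/
def smoothOn.mk {O : Set M} (g : M → ℝ) (hg : ContMDiffOn I 𝓘(ℝ, ℝ) ∞ g O) : smoothOn I O :=
  ⟨fun y => g y, g, hg, fun _ => rfl⟩

/-- Evaluation of smooth functions at a point. -/
def smoothOn.ev {O : Set M} (y : O) : smoothOn I O →ₐ[ℝ] ℝ :=
  (Pi.evalAlgHom ℝ (fun _ : O => ℝ) y).comp (smoothOn I O).val

theorem smoothOn.ext_ev {O : Set M} {f g : smoothOn I O}
    (h : ∀ y, smoothOn.ev y f = smoothOn.ev y g) :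
    f = g := Subtype.ext (funext h)

theorem smoothOn.ev_mk {O : Set M} (y : O) (g : M → ℝ) (hg : ContMDiffOn I 𝓘(ℝ, ℝ) ∞ g O) :
    smoothOn.ev y (smoothOn.mk g hg) = g y := rfl

theorem smoothOn.exists_eq_mk {O : Set M} (f : smoothOn I O) :
    ∃ g hg, f = smoothOn.mk (I := I) (O := O) g hg := by
  obtain ⟨f, g, hg, e⟩ := f
  exact ⟨g, hg, Subtype.ext (funext e)⟩

/-- The tangential derivative as an operator on the smooth functions on an open set. -/
def smoothOn.tanDFun {O : Set M} (hO : IsOpen O) {F : M → V} (hF : IsSmoothImmersion I F) (v : V)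
    (f : smoothOn I O) : smoothOn I O :=
  smoothOn.mk (tanD I F v f.2.choose) (contMDiffOn_tanD hF v hO f.2.choose_spec.1)

theorem smoothOn.ev_tanDFun_mk {O : Set M} (hO : IsOpen O) {F : M → V}
    (hF : IsSmoothImmersion I F) (v : V) (g : M → ℝ) (hg : ContMDiffOn I 𝓘(ℝ, ℝ) ∞ g O) (y : O) :
    smoothOn.ev y (smoothOn.tanDFun hO hF v (smoothOn.mk g hg)) = tanD I F v g y := by
  refine tanD_congr F v ?_
  filter_upwards [hO.mem_nhds y.2] with z hz
  exact ((smoothOn.mk g hg).2.choose_spec.2 ⟨z, hz⟩).symm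

/-- The tangential derivative as a derivation of the algebra of smooth functions on an open
set. -/
def smoothOn.tanDer {O : Set M} (hO : IsOpen O) {F : M → V} (hF : IsSmoothImmersion I F) (v : V) :
    Derivation ℝ (smoothOn I O) (smoothOn I O) :=
  Derivation.mk'
    { toFun := smoothOn.tanDFun hO hF v
      map_add' := fun f g => by
        obtain ⟨f, hf, rfl⟩ := smoothOn.exists_eq_mk f
        obtain ⟨g, hg, rfl⟩ := smoothOn.exists_eq_mk g
        refine smoothOn.ext_ev fun y => ?_
        have e : smoothOn.mk f hf + smoothOn.mk g hg =
          smoothOn.mk (fun z => f z + g z) (hf.add hg) := rfl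
        rw [e, map_add, ev_tanDFun_mk, ev_tanDFun_mk, ev_tanDFun_mk,
          tanD_add F v (hf.contMDiffAt (hO.mem_nhds y.2)) (hg.contMDiffAt (hO.mem_nhds y.2))]
      map_smul' := fun c g => by
        obtain ⟨g, hg, rfl⟩ := smoothOn.exists_eq_mk g
        refine smoothOn.ext_ev fun y => ?_
        have e : c • smoothOn.mk g hg =
          smoothOn.mk (fun z => c * g z) (contMDiffOn_const.mul hg) := rfl
        rw [e, RingHom.id_apply, map_smul, ev_tanDFun_mk, ev_tanDFun_mk,
          tanD_mul F v contMDiffAt_const (hg.contMDiffAt (hO.mem_nhds y.2)), tanD_const]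
        simp }
    fun f g => by
      obtain ⟨f, hf, rfl⟩ := smoothOn.exists_eq_mk f
      obtain ⟨g, hg, rfl⟩ := smoothOn.exists_eq_mk g
      refine smoothOn.ext_ev fun y => ?_
      have e : smoothOn.mk f hf * smoothOn.mk g hg =
        smoothOn.mk (fun z => f z * g z) (hf.mul hg) := rfl
      change smoothOn.ev y (smoothOn.tanDFun hO hF v _) = smoothOn.ev y
        (smoothOn.mk f hf * smoothOn.tanDFun hO hF v _ +
          smoothOn.mk g hg * smoothOn.tanDFun hO hF v _)
      rw [e, map_add, map_mul, map_mul, ev_tanDFun_mk, ev_tanDFun_mk, ev_tanDFun_mk, ev_mk, ev_mk,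
        tanD_mul F v (hf.contMDiffAt (hO.mem_nhds y.2)) (hg.contMDiffAt (hO.mem_nhds y.2))]

theorem smoothOn.tanDer_mk {O : Set M} (hO : IsOpen O) {F : M → V}
    (hF : IsSmoothImmersion I F) (v : V) (g : M → ℝ) (hg : ContMDiffOn I 𝓘(ℝ, ℝ) ∞ g O) :
    smoothOn.tanDer hO hF v (smoothOn.mk g hg) =
      smoothOn.mk (tanD I F v g) (contMDiffOn_tanD hF v hO hg) :=
  smoothOn.ext_ev fun y => smoothOn.ev_tanDFun_mk hO hF v g hg y

theorem contMDiffOn_inner_const {f : M → V} {O : Set M} (hf : ContMDiffOn I 𝓘(ℝ, V) ∞ f O)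
    (v : V) : ContMDiffOn I 𝓘(ℝ, ℝ) ∞ (fun z => inner ℝ v (f z)) O :=
  (innerSL ℝ v).contDiff.contMDiff.comp_contMDiffOn hf

theorem tanD_inner_const (F : M → V) (v w : V) {f : M → V} {x : M}
    (hf : ContMDiffAt I 𝓘(ℝ, V) ∞ f x) :
    tanD I F v (fun z => inner ℝ w (f z)) x = inner ℝ w (tanD I F v f x) :=
  tanD_clm F v (innerSL ℝ w) hf

/-- `F` parametrizes a cone: its position vector is tangential. -/
def IsConical (I : ModelWithCorners ℝ E H) (F : M → V) : Prop :=
  ∀ x, tanD I F (F x) F x = F x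

namespace IsUnitNormalOn

variable {F ν : M → V} {O : Set M}

theorem inner_position (hν : IsUnitNormalOn I F ν O) (hcone : IsConical I F) {x : M} (hx : x ∈ O) :
    inner ℝ (ν x) (F x) = 0 := by
  have h := hν.tanD_self x hx (F x)
  rw [hcone x] at h
  have h1 : inner ℝ (ν x) (F x) • ν x = 0 := by
    have : F x - inner ℝ (ν x) (F x) • ν x = F x - 0 := by rw [← h, sub_zero]
    exact sub_right_injective this
  have h2 := congrArg (fun w => inner ℝ (ν x) w) h1
  simp only [inner_smul_right, hν.inner_self hx, mul_one, inner_zero_right] at h2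
  exact h2

variable [FiniteDimensional ℝ V]

/-- The commutator of two tangential derivatives in terms of the shape operator. -/
theorem tanD_comm_eq (hν : IsUnitNormalOn I F ν O) (hF : IsSmoothImmersion I F) (a b : V)
    {f : M → ℝ} (hf : ContMDiffOn I 𝓘(ℝ, ℝ) ∞ f O) {x : M} (hx : x ∈ O) :
    tanD I F a (tanD I F b f) x - tanD I F b (tanD I F a f) x =
      inner ℝ (ν x) a * tanD I F (tanD I F b ν x) f x -
        inner ℝ (ν x) b * tanD I F (tanD I F a ν x) f x := by
  have h1 : ∀ a b, tanD I F a (tanD I F b F) x =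
      -(inner ℝ (ν x) b • tanD I F a ν x + inner ℝ (tanD I F a ν x) b • ν x) := by
    intro a b
    have hνx := hν.contMDiffAt hx
    have hin : ContMDiffAt I 𝓘(ℝ, ℝ) ∞ (fun z => inner ℝ b (ν z)) x :=
      (contMDiffOn_inner_const hν.contMDiffOn b).contMDiffAt (hν.isOpen.mem_nhds hx)
    have e : tanD I F b F =ᶠ[nhds x] fun z => b - inner ℝ b (ν z) • ν z := by
      filter_upwards [hν.isOpen.mem_nhds hx] with z hz
      rw [hν.tanD_self z hz, real_inner_comm]
    have hs : ContMDiffAt I 𝓘(ℝ, V) ∞ (fun z => inner ℝ b (ν z) • ν z) x := hin.smul hνx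
    rw [tanD_congr F a e, tanD_sub F a contMDiffAt_const hs, tanD_const,
      tanD_smul F a hin hνx, tanD_inner_const F a b hνx, zero_sub, real_inner_comm b,
      real_inner_comm b]
  rw [tanD_comm hF a b hν.isOpen hf hx, h1, h1, hν.inner_tanD_symm hF hx a b]
  have e : -(inner ℝ (ν x) b • tanD I F a ν x + inner ℝ (tanD I F b ν x) a • ν x) -
      -(inner ℝ (ν x) a • tanD I F b ν x + inner ℝ (tanD I F b ν x) a • ν x) =
      inner ℝ (ν x) a • tanD I F b ν x - inner ℝ (ν x) b • tanD I F a ν x := by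
    abel
  rw [e, tanD_sub_left, tanD_smul_left, tanD_smul_left]
  rfl

/-- The smooth functions near a point of a minimal hypersurface cone satisfy the algebraic
relations from which Simons' identity follows. -/
theorem minimalConeAlgebra (hν : IsUnitNormalOn I F ν O) (hF : IsSmoothImmersion I F)
    (hmin : IsMinimal I F) (hcone : IsConical I F) {ι : Type*} [Fintype ι] [DecidableEq ι]
    (e : OrthonormalBasis ι ℝ V) :
    MinimalConeAlgebra (fun a => smoothOn.tanDer hν.isOpen hF (e a))
      (fun a => smoothOn.mk (fun z => inner ℝ (e a) (ν z))
        (contMDiffOn_inner_const hν.contMDiffOn (e a)))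
      (fun a => smoothOn.mk (fun z => inner ℝ (e a) (F z))
        (contMDiffOn_inner_const hF.1.contMDiffOn (e a))) where
  unit := smoothOn.ext_ev fun y => by
    simp only [map_sum, map_mul, map_one, smoothOn.ev_mk]
    rw [← hν.inner_self y.2, ← e.sum_inner_mul_inner]
    simp only [real_inner_comm]
  normal u := smoothOn.ext_ev fun y => by
    obtain ⟨u, hu, rfl⟩ := smoothOn.exists_eq_mk u
    simp only [map_sum, map_mul, map_zero, smoothOn.ev_mk, smoothOn.tanDer_mk]
    rw [← hν.tanD_normal hF y.2 u, tanD_basis e]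
    rfl
  symm a b := smoothOn.ext_ev fun y => by
    simp only [smoothOn.ev_mk, smoothOn.tanDer_mk]
    rw [tanD_inner_const _ _ _ (hν.contMDiffAt y.2), tanD_inner_const _ _ _ (hν.contMDiffAt y.2),
      real_inner_comm, hν.inner_tanD_symm hF y.2, real_inner_comm]
  minimal := smoothOn.ext_ev fun y => by
    simp only [map_sum, map_zero, smoothOn.ev_mk, smoothOn.tanDer_mk]
    rw [← hν.sum_inner_tanD_eq_zero hF hmin e y.2]
    refine Finset.sum_congr rfl fun a _ => ?_
    rw [tanD_inner_const _ _ _ (hν.contMDiffAt y.2), real_inner_comm]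
  comm a b u := smoothOn.ext_ev fun y => by
    obtain ⟨u, hu, rfl⟩ := smoothOn.exists_eq_mk u
    simp only [map_sum, map_sub, map_mul, smoothOn.ev_mk, smoothOn.tanDer_mk]
    rw [hν.tanD_comm_eq hF _ _ hu y.2, tanD_basis e F (tanD I F (e b) ν y),
      tanD_basis e F (tanD I F (e a) ν y), Finset.mul_sum, Finset.mul_sum,
      ← Finset.sum_sub_distrib]
    refine Finset.sum_congr rfl fun c _ => ?_
    rw [tanD_inner_const _ _ _ (hν.contMDiffAt y.2), tanD_inner_const _ _ _ (hν.contMDiffAt y.2),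
      real_inner_comm (e a), real_inner_comm (e b)]
    simp only [smul_eq_mul]
    ring
  coord a b := smoothOn.ext_ev fun y => by
    rw [smoothOn.tanDer_mk, map_sub, map_mul, smoothOn.ev_mk, smoothOn.ev_mk, smoothOn.ev_mk,
      tanD_inner_const _ _ _ hF.1.contMDiffAt, hν.tanD_self y y.2, inner_sub_right,
      inner_smul_right, real_inner_comm (e a) (ν y), orthonormal_iff_ite.1 e.orthonormal b a]
    simp only [eq_comm (a := b)]
    split_ifs <;> simp
  cone := smoothOn.ext_ev fun y => by
    simp only [map_sum, map_mul, map_zero, smoothOn.ev_mk]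
    rw [← hν.inner_position hcone y.2, ← e.sum_inner_mul_inner]
    refine Finset.sum_congr rfl fun a _ => ?_
    rw [mul_comm, real_inner_comm]

end IsUnitNormalOn

end LocalSmoothFunctions

/-! ### The Simons–Kato inequality on a minimal cone -/

section ConeInequality

variable {E : Type uE} [NormedAddCommGroup E] [NormedSpace ℝ E] [FiniteDimensional ℝ E]
  {H : Type uH} [TopologicalSpace H] {I : ModelWithCorners ℝ E H} [I.Boundaryless]
  {M : Type uM} [TopologicalSpace M] [ChartedSpace H M] [IsManifold I ∞ M]
  {V : Type uV} [NormedAddCommGroup V] [InnerProductSpace ℝ V] [FiniteDimensional ℝ V]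

/-- The sum of the second tangential derivatives of `f`; on a minimal submanifold this is the
Laplace-Beltrami operator. -/
def tanLaplacian (I : ModelWithCorners ℝ E H) (F : M → V) (f : M → ℝ) (x : M) : ℝ :=
  ∑ a, tanD I F (stdOrthonormalBasis ℝ V a) (tanD I F (stdOrthonormalBasis ℝ V a) f) x

theorem tanLaplacian_eq_sum {ι : Type*} [Fintype ι] (e : OrthonormalBasis ι ℝ V) {F : M → V}
    (hF : IsSmoothImmersion I F) {f : M → ℝ} (hf : ContMDiff I 𝓘(ℝ, ℝ) ∞ f) (x : M) :
    tanLaplacian I F f x = ∑ a, tanD I F (e a) (tanD I F (e a) f) x := by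
  refine sum_orthonormalBasis_eq (stdOrthonormalBasis ℝ V) e
    (LinearMap.mk₂ ℝ (fun v w => tanD I F v (tanD I F w f) x) ?_ ?_ ?_ ?_)
  · intros; rw [tanD_add_left]
  · intros; rw [tanD_smul_left]
  · intro v w w'
    have : tanD I F (w + w') f = fun z => tanD I F w f z + tanD I F w' f z :=
      funext fun z => tanD_add_left _ _ _ _ _
    rw [this, tanD_add F v (contMDiff_tanD hF w hf).contMDiffAt
      (contMDiff_tanD hF w' hf).contMDiffAt]
  · intro c v w
    have : tanD I F (c • w) f = fun z => (fun y : ℝ => c * y) (tanD I F w f z) :=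
      funext fun z => tanD_smul_left _ _ _ _ _
    rw [this, tanD_comp_real F v (contMDiff_tanD hF w hf).contMDiffAt
      ((hasDerivAt_id' _).const_mul c)]
    simp

/-- At each point of a minimal cone of dimension `m + 1` there is an orthonormal basis made of `m`
principal directions, the direction of the position vector, and the normal. -/
theorem exists_adapted_basis {F ν : M → V} {O : Set M} (hν : IsUnitNormalOn I F ν O)
    (hF : IsSmoothImmersion I F) (hcone : IsConical I F) {m : ℕ}
    (hdim : Module.finrank ℝ V = m + 2) {x : M} (hx : x ∈ O) (hx0 : F x ≠ 0) :
    ∃ (e : OrthonormalBasis (Fin m ⊕ Fin 2) ℝ V) (l : Fin m → ℝ),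
      e (Sum.inr 0) = ‖F x‖⁻¹ • F x ∧ e (Sum.inr 1) = ν x ∧
      ∀ i j, inner ℝ (tanD I F (e (Sum.inl i)) ν x) (e (Sum.inl j)) = if i = j then l i else 0 := by
  set u := ‖F x‖⁻¹ • F x with hu
  have hun : ‖u‖ = 1 := by
    rw [hu, norm_smul, norm_inv, norm_norm, inv_mul_cancel₀ (norm_ne_zero_iff.2 hx0)]
  have huν : inner ℝ (ν x) u = 0 := by
    rw [hu, inner_smul_right, hν.inner_position hcone hx, mul_zero]
  have hon2 : Orthonormal ℝ ![u, ν x] := by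
    refine ⟨fun i => ?_, fun i j hij => ?_⟩
    · fin_cases i
      · exact hun
      · exact hν.norm_eq_one x hx
    · fin_cases i <;> fin_cases j
      · exact absurd rfl hij
      · exact (real_inner_comm _ _).trans huν
      · exact huν
      · exact absurd rfl hij
  set P := Submodule.span ℝ (Set.range ![u, ν x])
  have hfin : Module.finrank ℝ Pᗮ = m := by
    have h1 := Submodule.finrank_add_finrank_orthogonal P
    have h2 : Module.finrank ℝ P = 2 := by
      rw [finrank_span_eq_card hon2.linearIndependent, Fintype.card_fin]
    omega
  -- the compression of the shape operator to the complement of the last two vectors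
  let A : V →ₗ[ℝ] V :=
    { toFun := fun v => tanD I F v ν x
      map_add' := fun v w => tanD_add_left _ _ _ _ _
      map_smul' := fun c v => tanD_smul_left _ _ _ _ _ }
  let B : Pᗮ →ₗ[ℝ] Pᗮ := Pᗮ.orthogonalProjectionOnto.toLinearMap ∘ₗ A ∘ₗ Pᗮ.subtype
  have hB : ∀ v w : Pᗮ, inner ℝ (B v) w = inner ℝ (tanD I F (v : V) ν x) (w : V) := fun v w =>
    Submodule.inner_orthogonalProjectionOnto_eq_of_mem_right w _
  have hBs : B.IsSymmetric := fun v w => by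
    rw [hB, real_inner_comm (B w) v, hB, hν.inner_tanD_symm hF hx]
  let b := hBs.eigenvectorBasis hfin
  have hbP : ∀ i j, inner ℝ ((b i : V)) (![u, ν x] j) = 0 := fun i j =>
    Submodule.inner_left_of_mem_orthogonal (Submodule.subset_span (Set.mem_range_self j)) (b i).2
  let g : Fin m ⊕ Fin 2 → V := Sum.elim (fun i => (b i : V)) ![u, ν x]
  have hg : Orthonormal ℝ g := by
    rw [orthonormal_iff_ite]
    rintro (i | i) (j | j)
    · have := orthonormal_iff_ite.1 b.orthonormal i j
      simpa [g] using this
    · simpa [g] using hbP i j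
    · simpa [g, real_inner_comm] using hbP j i
    · have := orthonormal_iff_ite.1 hon2 i j
      simpa [g] using this
  have hspan : ⊤ ≤ Submodule.span ℝ (Set.range g) := by
    rw [hg.linearIndependent.span_eq_top_of_card_eq_finrank' (by simp [hdim])]
  refine ⟨OrthonormalBasis.mk hg hspan, hBs.eigenvalues hfin, ?_, ?_, fun i j => ?_⟩
  · simp [g]
  · simp [g]
  · simp only [OrthonormalBasis.coe_mk, g, Sum.elim_inl]
    rw [← hB, hBs.apply_eigenvectorBasis hfin i, inner_smul_left,
      orthonormal_iff_ite.1 (hBs.eigenvectorBasis hfin).orthonormal i j]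
    simp

variable {F : M → V} (hF : IsSmoothImmersion I F) (hmin : IsMinimal I F) (hcone : IsConical I F)
  (hF0 : ∀ x, F x ≠ 0) {m : ℕ} (hdimV : Module.finrank ℝ V = m + 2)
  (hdimE : Module.finrank ℝ E = m + 1)

/-- The function `|x|² |A|²`, which on a cone is homogeneous of degree zero. -/
def scaledNormSqA (I : ModelWithCorners ℝ E H) (F : M → V) (x : M) : ℝ :=
  ‖F x‖ ^ 2 * normSqA I F x

include hdimV hdimE in
theorem contMDiff_scaledNormSqA (hF : IsSmoothImmersion I F) :
    ContMDiff I 𝓘(ℝ, ℝ) ∞ (scaledNormSqA I F) :=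
  ContMDiff.mul ((contDiff_norm_sq ℝ).contMDiff.comp hF.1)
    (contMDiff_normSqA (by omega) hF)

include hF hmin hcone hF0 hdimV hdimE

/-- For `f = |x|² |A|²` on a minimal cone of dimension `m + 1`: the radial derivative of `f`
vanishes, and the defect `Δf / 2 - m |A|² + |x|² |A|⁴` is nonnegative and controls `|∇f|²` with the
factor of the sharp Kato inequality. The factor is `1 + 2 / m` rather than that of dimension `m + 1`
because `A` vanishes in the radial direction. -/
theorem simons_kato_cone (x : M) :
    tanD I F (F x) (scaledNormSqA I F) x = 0 ∧
    0 ≤ tanLaplacian I F (scaledNormSqA I F) x / 2 - m * normSqA I F x +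
      ‖F x‖ ^ 2 * normSqA I F x ^ 2 ∧
    (1 + 2 / (m : ℝ)) * (gradNormSq I F (scaledNormSqA I F) x / 4) ≤
      scaledNormSqA I F x * (tanLaplacian I F (scaledNormSqA I F) x / 2 - m * normSqA I F x +
      ‖F x‖ ^ 2 * normSqA I F x ^ 2) := by
  obtain ⟨ν, O, hx, hν⟩ := exists_isUnitNormalOn (by omega) hF x
  obtain ⟨e, l, he0, he1, hel⟩ := exists_adapted_basis hν hF hcone hdimV hx (hF0 x)
  have hf := contMDiff_scaledNormSqA hdimV hdimE hF
  have hA := contMDiff_normSqA (I := I) (F := F) (by omega) hF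
  set D := fun a => smoothOn.tanDer hν.isOpen hF (e a) with hD
  have halg := hν.minimalConeAlgebra hF hmin hcone e
  set n' := fun a => smoothOn.mk (I := I) (O := O) (fun z => inner ℝ (e a) (ν z))
        (contMDiffOn_inner_const hν.contMDiffOn (e a)) with hn'
  set x' := fun a => smoothOn.mk (I := I) (O := O) (fun z => inner ℝ (e a) (F z))
        (contMDiffOn_inner_const hF.1.contMDiffOn (e a)) with hx'
  set a2 : smoothOn I O := smoothOn.mk (normSqA I F) hA.contMDiffOn
  set f : smoothOn I O := smoothOn.mk (scaledNormSqA I F) hf.contMDiffOn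
  have hDn : ∀ (y : O) a b, smoothOn.ev y (D a (n' b)) = inner ℝ (tanD I F (e a) ν y) (e b) := by
    intro y a b
    rw [hD, hn', smoothOn.tanDer_mk, smoothOn.ev_mk, tanD_inner_const _ _ _ (hν.contMDiffAt y.2),
      real_inner_comm]
  have ha2 : a2 = ∑ a, ∑ b, D a (n' b) * D a (n' b) := smoothOn.ext_ev fun y => by
    simp only [map_sum, map_mul, hDn]
    rw [smoothOn.ev_mk, hν.normSqA_eq hF e y.2]
    simp only [sq]
  have hfa : f = (∑ b, x' b * x' b) * a2 := smoothOn.ext_ev fun y => by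
    simp only [map_sum, map_mul, f, x', a2, smoothOn.ev_mk, scaledNormSqA]
    rw [← real_inner_self_eq_norm_sq, ← e.sum_inner_mul_inner]
    simp only [real_inner_comm]
  have hρ : 0 < ‖F x‖ := norm_pos_iff.2 (hF0 x)
  have hon := orthonormal_iff_ite.1 e.orthonormal
  have hνe : ∀ a, inner ℝ (e a) (ν x) = if a = Sum.inr 1 then 1 else 0 := fun a => by
    rw [← he1, hon]
  have hFx : F x = ‖F x‖ • e (Sum.inr 0) := by
    rw [he0, smul_smul, mul_inv_cancel₀ hρ.ne', one_smul]
  have hxe : ∀ a, inner ℝ (e a) (F x) = ‖F x‖ * if a = Sum.inr 0 then 1 else 0 := fun a => by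
    conv_lhs => rw [hFx]
    rw [inner_smul_right, hon]
  have key := halg.simons_kato (smoothOn.ev ⟨x, hx⟩) l hρ
    (fun i => by rw [smoothOn.ev_mk, hνe]; simp) (by rw [smoothOn.ev_mk, hνe]; simp)
    (by rw [smoothOn.ev_mk, hνe]; simp) (fun i => by rw [smoothOn.ev_mk, hxe]; simp)
    (by rw [smoothOn.ev_mk, hxe]; simp) (by rw [smoothOn.ev_mk, hxe]; simp)
    (fun i j => by rw [← hel]; exact hDn ⟨x, hx⟩ (Sum.inl i) (Sum.inl j)) ha2 hfa
  have hlap : smoothOn.ev ⟨x, hx⟩ (∑ c, D c (D c f)) = tanLaplacian I F (scaledNormSqA I F) x := by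
    rw [tanLaplacian_eq_sum e hF hf, map_sum]
    refine Finset.sum_congr rfl fun c _ => ?_
    simp only [hD, f, smoothOn.tanDer_mk, smoothOn.ev_mk]
  have hgrad : ∑ c, smoothOn.ev ⟨x, hx⟩ (D c f) ^ 2 = gradNormSq I F (scaledNormSqA I F) x := by
    rw [gradNormSq_eq_sum e hF]
    refine Finset.sum_congr rfl fun c _ => ?_
    simp only [hD, f, smoothOn.tanDer_mk, smoothOn.ev_mk]
  have hrad : tanD I F (F x) (scaledNormSqA I F) x = 0 := by
    have h1 := congrArg (smoothOn.ev ⟨x, hx⟩) halg.sum_coord_mul_deriv_scaled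
    rw [← ha2, ← hfa, map_sum, map_zero] at h1
    rw [tanD_basis e, ← h1]
    refine Finset.sum_congr rfl fun c _ => ?_
    simp only [f, smoothOn.tanDer_mk, map_mul, smoothOn.ev_mk, smul_eq_mul]
    rfl
  rw [hlap, hgrad] at key
  simp only [Fintype.card_fin] at key
  exact ⟨hrad, key⟩

end ConeInequality

/-! ### Integration in a chart -/

section LocalIntegrals

open MeasureTheory

variable {E : Type uE} [NormedAddCommGroup E] [NormedSpace ℝ E] [FiniteDimensional ℝ E]
  [MeasurableSpace E] [BorelSpace E] {μ : Measure E} [μ.IsAddHaarMeasure]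

/-- A function that is continuous on an open set and vanishes off a compact subset is
integrable. -/
theorem integrableOn_of_forall_eq_zero {U K : Set E} (hU : IsOpen U) (hK : IsCompact K)
    (hKU : K ⊆ U) {P : E → ℝ} (hP : ContinuousOn P U) (h0 : ∀ y ∈ U \ K, P y = 0) :
    IntegrableOn P U μ :=
  ((hP.mono hKU).integrableOn_compact hK).of_forall_sdiff_eq_zero hU.measurableSet h0

/-- The integral of a partial derivative of a compactly supported function vanishes. -/
theorem integral_fderiv_eq_zero {U K : Set E} (hU : IsOpen U) (hK : IsCompact K)
    (hKU : K ⊆ U) {P : E → ℝ} (hP : ContDiffOn ℝ ∞ P U) (h0 : ∀ y ∈ U \ K, P y = 0) (e : E) :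
    ∫ y in U, fderiv ℝ P y e ∂μ = 0 := by
  set Q : E → ℝ := U.indicator P with hQ
  have hQU : ∀ y ∈ U, Q =ᶠ[nhds y] P := fun y hy => by
    filter_upwards [hU.mem_nhds hy] with z hz
    exact Set.indicator_of_mem hz P
  have hQK : ∀ y ∉ K, Q =ᶠ[nhds y] fun _ => 0 := fun y hy => by
    filter_upwards [hK.isClosed.isOpen_compl.mem_nhds hy] with z hz
    by_cases hzU : z ∈ U
    · rw [hQ, Set.indicator_of_mem hzU, h0 z ⟨hzU, hz⟩]
    · exact Set.indicator_of_notMem hzU P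
  have hQs : ContDiff ℝ ∞ Q := contDiff_iff_contDiffAt.2 fun y => by
    by_cases hy : y ∈ U
    · exact (hP.contDiffAt (hU.mem_nhds hy)).congr_of_eventuallyEq (hQU y hy)
    · exact contDiffAt_const.congr_of_eventuallyEq (hQK y fun h => hy (hKU h))
  have hQc : HasCompactSupport Q := HasCompactSupport.intro hK fun y hy => (hQK y hy).self_of_nhds
  have h1 : ∫ y in U, fderiv ℝ P y e ∂μ = ∫ y in U, fderiv ℝ Q y e ∂μ :=
    setIntegral_congr_fun hU.measurableSet fun y hy => by
      rw [(hQU y hy).fderiv_eq]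
  have h2 : ∫ y in U, fderiv ℝ Q y e ∂μ = ∫ y, fderiv ℝ Q y e ∂μ :=
    setIntegral_eq_integral_of_forall_compl_eq_zero fun y hy => by
      rw [(hQK y fun h => hy (hKU h)).fderiv_eq]
      simp
  have h3 : Continuous fun y => fderiv ℝ Q y e :=
    (hQs.continuous_fderiv (by simp)).clm_apply continuous_const
  have h4 : HasCompactSupport fun y => fderiv ℝ Q y e := hQc.fderiv_apply ℝ e
  have h5 := integral_mul_fderiv_eq_neg_fderiv_mul_of_integrable (μ := μ)
      (f := fun _ : E => (1 : ℝ))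
    (g := Q) (v := e) (by simp) (by simpa using h3.integrable_of_hasCompactSupport h4)
    (by simpa using hQs.continuous.integrable_of_hasCompactSupport hQc)
    (fun _ _ => differentiableAt_const _) (fun y _ => hQs.differentiable (by simp) y)
  rw [h1, h2]
  simpa using h5

end LocalIntegrals

section ChartIntegrals

open MeasureTheory

variable {E : Type uE} [NormedAddCommGroup E] [NormedSpace ℝ E] [FiniteDimensional ℝ E]
  {H : Type uH} [TopologicalSpace H] {I : ModelWithCorners ℝ E H} [I.Boundaryless]
  {M : Type uM} [TopologicalSpace M] [ChartedSpace H M] [IsManifold I ∞ M]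
  {V : Type uV} [NormedAddCommGroup V] [InnerProductSpace ℝ V]

/-- The volume density of the induced metric in the chart around `c`. -/
def volumeDensity (I : ModelWithCorners ℝ E H) (F : M → V) (c : M) (y : E) : ℝ :=
  Real.sqrt (gramOf (fderiv ℝ (inChart I F c) y)).det

/-- The integral of `h` over the domain of the chart around `c`, with respect to the volume of
the induced metric. -/
def chartIntegral (I : ModelWithCorners ℝ E H) (F : M → V) (c : M) (h : M → ℝ) : ℝ :=
  letI : MeasurableSpace E := borel E
  haveI : BorelSpace E := ⟨rfl⟩
  ∫ y in (extChartAt I c).target, inChart I h c y * volumeDensity I F c y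
    ∂(coordBasis E).addHaar

/-- `h` is continuous, and its support is a compact subset of the domain of the chart around
`c`. -/
structure IsChartSupported (I : ModelWithCorners ℝ E H) (c : M) (h : M → ℝ) : Prop where
  continuous : Continuous h
  hasCompactSupport : HasCompactSupport h
  tsupport_subset : tsupport h ⊆ (extChartAt I c).source

theorem continuousOn_volumeDensity {F : M → V} (hF : IsSmoothImmersion I F) (c : M) :
    ContinuousOn (volumeDensity I F c) (extChartAt I c).target :=
  (hF.isLocalImmersion c).contDiffOn_sqrt_det.continuousOn

theorem volumeDensity_pos {F : M → V} (hF : IsSmoothImmersion I F) {c : M} {y : E}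
    (hy : y ∈ (extChartAt I c).target) : 0 < volumeDensity I F c y :=
  Real.sqrt_pos.2 (gramOf_det_pos ((hF.isLocalImmersion c).injective y hy))

/-- The support of `h` in coordinates. -/
theorem isCompact_image_tsupport {c : M} {h : M → ℝ} (hh : HasCompactSupport h)
    (hs : tsupport h ⊆ (extChartAt I c).source) : IsCompact (extChartAt I c '' tsupport h) :=
  hh.isCompact.image_of_continuousOn ((continuousOn_extChartAt c).mono hs)

theorem image_tsupport_subset {c : M} {h : M → ℝ}
    (hs : tsupport h ⊆ (extChartAt I c).source) :
    extChartAt I c '' tsupport h ⊆ (extChartAt I c).target :=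
  ((extChartAt I c).mapsTo.mono_left hs).image_subset

theorem symm_notMem_tsupport {c : M} {h : M → ℝ} {y : E}
    (hy : y ∈ (extChartAt I c).target \ (extChartAt I c '' tsupport h)) :
    (extChartAt I c).symm y ∉ tsupport h :=
  fun h' => hy.2 ⟨_, h', (extChartAt I c).right_inv hy.1⟩

theorem IsChartSupported.integrableOn [MeasurableSpace E] [BorelSpace E] {F : M → V}
    (hF : IsSmoothImmersion I F) {c : M} {h : M → ℝ} (hh : IsChartSupported I c h) :
    IntegrableOn (fun y => inChart I h c y * volumeDensity I F c y) (extChartAt I c).target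
      (coordBasis E).addHaar := by
  refine integrableOn_of_forall_eq_zero (isOpen_extChartAt_target c)
    (isCompact_image_tsupport hh.hasCompactSupport hh.tsupport_subset)
    (image_tsupport_subset hh.tsupport_subset)
    ((hh.continuous.comp_continuousOn (continuousOn_extChartAt_symm c)).mul
      (continuousOn_volumeDensity hF c)) fun y hy => ?_
  rw [inChart, Function.comp_apply, image_eq_zero_of_notMem_tsupport (symm_notMem_tsupport hy),
    zero_mul]

theorem chartIntegral_sum {F : M → V} (hF : IsSmoothImmersion I F) {c : M} {ι : Type*}
    (s : Finset ι) {h : ι → M → ℝ} (hh : ∀ i ∈ s, IsChartSupported I c (h i)) :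
    chartIntegral I F c (fun x => ∑ i ∈ s, h i x) = ∑ i ∈ s, chartIntegral I F c (h i) := by
  let _ : MeasurableSpace E := borel E
  have _ : BorelSpace E := ⟨rfl⟩
  simp only [chartIntegral]
  rw [← integral_finsetSum s fun i hi => (hh i hi).integrableOn hF]
  refine integral_congr_ae (Filter.Eventually.of_forall fun y => ?_)
  simp only [inChart, Function.comp_apply, Finset.sum_mul]

theorem chartIntegral_const_mul (F : M → V) (c : M) (h : M → ℝ) (r : ℝ) :
    chartIntegral I F c (fun x => r * h x) = r * chartIntegral I F c h := by
  let _ : MeasurableSpace E := borel E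
  have _ : BorelSpace E := ⟨rfl⟩
  simp only [chartIntegral]
  rw [← integral_const_mul]
  refine integral_congr_ae (Filter.Eventually.of_forall fun y => ?_)
  simp only [inChart, Function.comp_apply, mul_assoc]

theorem chartIntegral_nonneg {F : M → V} {c : M} {h : M → ℝ} (h0 : ∀ x, 0 ≤ h x) :
    0 ≤ chartIntegral I F c h := by
  let _ : MeasurableSpace E := borel E
  have _ : BorelSpace E := ⟨rfl⟩
  exact integral_nonneg fun y => mul_nonneg (h0 _) (Real.sqrt_nonneg _)

theorem chartIntegral_pos {F : M → V} (hF : IsSmoothImmersion I F) {c x : M} {h : M → ℝ}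
    (hh : IsChartSupported I c h) (h0 : ∀ x, 0 ≤ h x) (hx : 0 < h x) :
    0 < chartIntegral I F c h := by
  let _ : MeasurableSpace E := borel E
  have _ : BorelSpace E := ⟨rfl⟩
  have hU := isOpen_extChartAt_target (I := I) c
  have hxc : x ∈ (extChartAt I c).source :=
    hh.tsupport_subset (subset_tsupport _ (Function.mem_support.2 hx.ne'))
  have hxU := (extChartAt I c).map_source hxc
  have hcont := (hh.continuous.comp_continuousOn (continuousOn_extChartAt_symm (I := I) c)).mul
      (continuousOn_volumeDensity hF c)
  have hpos : 0 < inChart I h c (extChartAt I c x) * volumeDensity I F c (extChartAt I c x) := by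
    rw [inChart_apply h hxc]
    exact mul_pos hx (volumeDensity_pos hF hxU)
  refine (setIntegral_pos_iff_support_of_nonneg_ae
    (Filter.Eventually.of_forall fun y => mul_nonneg (h0 _) (Real.sqrt_nonneg _))
    (hh.integrableOn hF)).2 ?_
  have hO : IsOpen ((extChartAt I c).target ∩
      (fun y => inChart I h c y * volumeDensity I F c y) ⁻¹' Set.Ioi 0) :=
    hcont.isOpen_inter_preimage hU isOpen_Ioi
  refine (hO.measure_pos _ ⟨_, hxU, hpos⟩).trans_le (measure_mono fun y hy => ⟨?_, hy.1⟩)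
  exact (Set.mem_Ioi.1 hy.2).ne'

end ChartIntegrals

/-! ### Change of charts and the divergence theorem in a chart -/

section ChangeOfCharts

open MeasureTheory

variable {E : Type uE} [NormedAddCommGroup E] [NormedSpace ℝ E] [FiniteDimensional ℝ E]
  {H : Type uH} [TopologicalSpace H] {I : ModelWithCorners ℝ E H} [I.Boundaryless]
  {M : Type uM} [TopologicalSpace M] [ChartedSpace H M] [IsManifold I ∞ M]
  {V : Type uV} [NormedAddCommGroup V] [InnerProductSpace ℝ V]

theorem det_gramOf_comp (T : E →L[ℝ] V) (A : E →L[ℝ] E) :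
    (gramOf (T.comp A)).det = A.det ^ 2 * (gramOf T).det := by
  set J := LinearMap.toMatrix (coordBasis E) (coordBasis E) (A : E →ₗ[ℝ] E) with hJ
  have hA : ∀ i, A (coordBasis E i) = ∑ k, J k i • coordBasis E k := fun i => by
    rw [hJ]
    simp only [LinearMap.toMatrix_apply]
    exact ((coordBasis E).sum_repr _).symm
  have h : gramOf (T.comp A) = J.transpose * gramOf T * J := by
    ext i j
    simp only [gramOf, Matrix.gram_apply, ContinuousLinearMap.comp_apply, hA, map_sum, map_smul,
      sum_inner, inner_sum, inner_smul_left, inner_smul_right, Matrix.mul_apply,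
      Matrix.transpose_apply, Finset.sum_mul]
    simp only [Finset.mul_sum, conj_trivial]
    refine Finset.sum_congr rfl fun k _ => Finset.sum_congr rfl fun l _ => ?_
    rw [real_inner_comm]
    ring
  have hdet : J.det = A.det := LinearMap.det_toMatrix _ _
  rw [h, Matrix.det_mul, Matrix.det_mul, Matrix.det_transpose, hdet]
  ring

/-- The volume density changes by the Jacobian determinant. -/
theorem volumeDensity_eq {F : M → V} (hF : IsSmoothImmersion I F) (c d : M) {y : E}
    (hy : y ∈ chartDomain I c (extChartAt I d).source) :
    volumeDensity I F c y = |(fderiv ℝ (transition I c d) y).det| *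
      volumeDensity I F d (transition I c d y) := by
  have h := fderiv_inChart_transition isOpen_univ hF.1.contMDiffOn trivial
    ((extChartAt I c).map_target hy.1) hy.2
  rw [(extChartAt I c).right_inv hy.1] at h
  rw [volumeDensity, h, det_gramOf_comp, Real.sqrt_mul (sq_nonneg _), Real.sqrt_sq_eq_abs]
  rfl

/-- The integral of a function supported in the domains of two charts does not depend on the
chart. -/
theorem chartIntegral_eq_chartIntegral {F : M → V} (hF : IsSmoothImmersion I F) {c d : M}
    {h : M → ℝ} (hc : tsupport h ⊆ (extChartAt I c).source)
    (hd : tsupport h ⊆ (extChartAt I d).source) :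
    chartIntegral I F c h = chartIntegral I F d h := by
  let _ : MeasurableSpace E := borel E
  have _ : BorelSpace E := ⟨rfl⟩
  have key : ∀ c d : M, tsupport h ⊆ (extChartAt I d).source → chartIntegral I F c h =
      ∫ y in chartDomain I c (extChartAt I d).source, inChart I h c y * volumeDensity I F c y
        ∂(coordBasis E).addHaar := fun c d hd =>
    setIntegral_eq_of_subset_of_forall_sdiff_eq_zero (isOpen_extChartAt_target c).measurableSet
      Set.inter_subset_left fun y hy => by
        rw [inChart, Function.comp_apply,
          image_eq_zero_of_notMem_tsupport fun h' => hy.2 ⟨hy.1, hd h'⟩, zero_mul]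
  have himg : transition I c d '' chartDomain I c (extChartAt I d).source =
      chartDomain I d (extChartAt I c).source := by
    refine Set.Subset.antisymm (Set.image_subset_iff.2 fun y hy => transition_mem c d hy)
      fun y hy => ⟨_, transition_mem d c hy, transition_transition d c hy⟩
  rw [key c d hd, key d c hc, ← himg, integral_image_eq_integral_abs_det_fderiv_smul _
    (isOpen_chartDomain c (isOpen_extChartAt_source d)).measurableSet
    (fun y hy => (differentiableAt_transition c d hy).hasFDerivAt.hasFDerivWithinAt)
    (fun y hy z hz hyz => by
      rw [← transition_transition c d hy, hyz, transition_transition c d hz])]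
  refine setIntegral_congr_fun (isOpen_chartDomain c (isOpen_extChartAt_source d)).measurableSet
    fun y hy => ?_
  simp only [smul_eq_mul]
  rw [volumeDensity_eq hF c d hy]
  have : inChart I h c y = inChart I h d (transition I c d y) := by
    have h' : (extChartAt I c).symm y ∈ (extChartAt I d).source := hy.2
    simp only [inChart, transition, Function.comp_apply, (extChartAt I d).left_inv h']
  rw [this]
  ring

end ChangeOfCharts

section ChartDivergence

open MeasureTheory

variable {E : Type uE} [NormedAddCommGroup E] [NormedSpace ℝ E] [FiniteDimensional ℝ E]
  {H : Type uH} [TopologicalSpace H] {I : ModelWithCorners ℝ E H} [I.Boundaryless]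
  {M : Type uM} [TopologicalSpace M] [ChartedSpace H M] [IsManifold I ∞ M]
  {V : Type uV} [NormedAddCommGroup V] [InnerProductSpace ℝ V] [FiniteDimensional ℝ V]

/-- The mean curvature vector of a minimal hypersurface vanishes in all charts. -/
theorem IsMinimal.sum_gramOf_inv_smul_eq_zero {F : M → V} (hmin : IsMinimal I F)
    (hF : IsSmoothImmersion I F) (hdim : Module.finrank ℝ V = Module.finrank ℝ E + 1) {c x : M}
    (hc : x ∈ (extChartAt I c).source) :
    ∑ i, ∑ j, (gramOf (fderiv ℝ (inChart I F c) (extChartAt I c x)))⁻¹ i j •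
      ((fderiv ℝ (inChart I F c) (extChartAt I c x)).toLinearMap.range)ᗮ.starProjection
        (fderiv ℝ (fderiv ℝ (inChart I F c)) (extChartAt I c x)
          (coordBasis E i) (coordBasis E j)) = 0 := by
  obtain ⟨ν, O, hx, hν⟩ := exists_isUnitNormalOn hdim hF x
  have hinj := fderiv_inChart_injective hF hc
  set T := fderiv ℝ (inChart I F c) (extChartAt I c x)
  set D := fderiv ℝ (fderiv ℝ (inChart I F c)) (extChartAt I c x)
  have h1 : ∀ v, (T.toLinearMap.range)ᗮ.starProjection v = inner ℝ (ν x) v • ν x := fun v => by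
    rw [starProjection_range_orthogonal hinj]
    have h2 := hν.tanD_self x hx v
    rw [tanD_eq_tanDeriv hF v isOpen_univ hF.1.contMDiffOn trivial hc, tanDeriv] at h2
    rw [h2, sub_sub_cancel]
  let B : E →ₗ[ℝ] E →ₗ[ℝ] V := LinearMap.mk₂ ℝ
    (fun a b => (T.toLinearMap.range)ᗮ.starProjection (D a b))
    (by intros; simp only [map_add, add_apply]) (by intros; simp only [map_smul, smul_apply])
    (by intros; simp only [map_add]) (by intros; simp only [map_smul])
  have h3 := sum_gramOf_inv_smul (stdOrthonormalBasis ℝ V) hinj B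
  refine h3.trans ?_
  have h4 : ∀ a, B (pinv T (stdOrthonormalBasis ℝ V a)) (pinv T (stdOrthonormalBasis ℝ V a)) =
      -inner ℝ (tanD I F (stdOrthonormalBasis ℝ V a) ν x) (stdOrthonormalBasis ℝ V a) • ν x :=
    fun a => by
      rw [← hν.inner_fderiv_fderiv_pinv hF hx hc]
      exact h1 _
  simp_rw [h4]
  rw [← Finset.sum_smul, Finset.sum_neg_distrib, hν.sum_inner_tanD_eq_zero hF hmin _ hx]
  simp

theorem inChart_eq_zero_of_notMem {c : M} {φ : M → ℝ} {y : E}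
    (hy : y ∈ (extChartAt I c).target \ (extChartAt I c '' tsupport φ)) : inChart I φ c y = 0 := by
  rw [inChart, Function.comp_apply, image_eq_zero_of_notMem_tsupport (symm_notMem_tsupport hy)]

/-- The divergence theorem in a chart: on a minimal hypersurface, the tangential parts of constant
vectors are divergence free. -/
theorem chartIntegral_tanD_eq_zero {F : M → V} (hF : IsSmoothImmersion I F)
    (hmin : IsMinimal I F) (hdim : Module.finrank ℝ V = Module.finrank ℝ E + 1) (v : V) {c : M}
    {φ : M → ℝ} (hφ : ContMDiff I 𝓘(ℝ, ℝ) ∞ φ) (hh : IsChartSupported I c φ) :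
    chartIntegral I F c (tanD I F v φ) = 0 := by
  let _ : MeasurableSpace E := borel E
  have _ : BorelSpace E := ⟨rfl⟩
  have hloc := hF.isLocalImmersion c
  have hU := isOpen_extChartAt_target (I := I) c
  set u := inChart I φ c with hu
  set G := inChart I F c
  have hus : ContDiffOn ℝ ∞ u (extChartAt I c).target := contDiffOn_inChart_target hφ c
  let Z : Fin (Module.finrank ℝ E) → E → ℝ := fun j y =>
    volumeDensity I F c y * (coordBasis E).coord j (pinv (fderiv ℝ G y) v)
  have hZ : ∀ j, ContDiffOn ℝ ∞ (Z j) (extChartAt I c).target := fun j =>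
    hloc.contDiffOn_sqrt_det.mul
      (((coordBasis E).coord j).toContinuousLinearMap.contDiff.comp_contDiffOn
        (hloc.contDiffOn_pinv v))
  have hP : ∀ j, ContDiffOn ℝ ∞ (fun y => u y * Z j y) (extChartAt I c).target :=
    fun j => hus.mul (hZ j)
  have hK := isCompact_image_tsupport hh.hasCompactSupport hh.tsupport_subset
  have hKU := image_tsupport_subset hh.tsupport_subset
  have hP0 : ∀ j, ∀ y ∈ (extChartAt I c).target \ (extChartAt I c '' tsupport φ),
      u y * Z j y = 0 := fun j y hy => by rw [hu, inChart_eq_zero_of_notMem hy, zero_mul]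
  have hint : ∀ j, IntegrableOn (fun y => fderiv ℝ (fun y => u y * Z j y) y (coordBasis E j))
      (extChartAt I c).target (coordBasis E).addHaar := fun j => by
    refine integrableOn_of_forall_eq_zero hU hK hKU
      (((hP j).continuousOn_fderiv_of_isOpen hU (by simp)).clm_apply continuousOn_const)
      fun y hy => ?_
    have : (fun y => u y * Z j y) =ᶠ[nhds y] fun _ => 0 := by
      filter_upwards [(hU.sdiff hK.isClosed).mem_nhds hy] with z hz using hP0 j z hz
    rw [this.fderiv_eq]
    simp
  have hsum : chartIntegral I F c (tanD I F v φ) =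
      ∫ y in (extChartAt I c).target,
        ∑ j, fderiv ℝ (fun y => u y * Z j y) y (coordBasis E j) ∂(coordBasis E).addHaar := by
    refine setIntegral_congr_fun hU.measurableSet fun y hy => ?_
    have hdiv : ∑ j, fderiv ℝ (Z j) y (coordBasis E j) = 0 := by
      have h1 := hloc.sum_fderiv_sqrt_det_mul_pinv v hy
      have h2 := hmin.sum_gramOf_inv_smul_eq_zero hF hdim ((extChartAt I c).map_target hy)
      rw [(extChartAt I c).right_inv hy] at h2
      rw [h2, inner_zero_left, mul_zero] at h1
      exact h1
    have hpr : ∀ j, fderiv ℝ (fun y => u y * Z j y) y (coordBasis E j) =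
        u y * fderiv ℝ (Z j) y (coordBasis E j) +
          Z j y * fderiv ℝ u y (coordBasis E j) := fun j => by
      rw [fderiv_fun_mul (differentiableAt_of_contDiffOn hU hus hy)
        (differentiableAt_of_contDiffOn hU (hZ j) hy)]
      simp
    simp only [hpr, Finset.sum_add_distrib, ← Finset.mul_sum, hdiv, mul_zero, zero_add]
    rw [inChart_tanD hF v isOpen_univ hφ.contMDiffOn c ⟨hy, trivial⟩, tanDeriv]
    conv_lhs => rw [← (coordBasis E).sum_repr (pinv (fderiv ℝ (inChart I F c) y) v)]
    simp only [map_sum, map_smul, smul_eq_mul, Finset.sum_mul]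
    refine Finset.sum_congr rfl fun j _ => ?_
    simp only [Z, Module.Basis.coord_apply]
    ring
  rw [hsum, integral_finsetSum _ fun j _ => hint j]
  exact Finset.sum_eq_zero fun j _ => integral_fderiv_eq_zero hU hK hKU (hP j) (hP0 j) _

end ChartDivergence

/-! ### Integration over the hypersurface -/

section GlobalIntegral

variable {E : Type uE} [NormedAddCommGroup E] [NormedSpace ℝ E] [FiniteDimensional ℝ E]
  {H : Type uH} [TopologicalSpace H] {I : ModelWithCorners ℝ E H} [I.Boundaryless]
  {M : Type uM} [TopologicalSpace M] [ChartedSpace H M] [IsManifold I ∞ M]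
  [SigmaCompactSpace M] [T2Space M]
  {V : Type uV} [NormedAddCommGroup V] [InnerProductSpace ℝ V] [FiniteDimensional ℝ V]

theorem tsupport_chartPartition_subset (c : M) :
    tsupport (chartPartition I M c) ⊆ (extChartAt I c).source := by
  rw [extChartAt_source]
  exact (SmoothPartitionOfUnity.exists_isSubordinate_chartAt_source I M).choose_spec c

theorem isChartSupported_chartPartition_mul (c : M) {f : M → ℝ} (hf : Continuous f)
    (hs : HasCompactSupport f) : IsChartSupported I c fun x => chartPartition I M c x * f x where
  continuous := (chartPartition I M c).contMDiff.continuous.mul hf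
  hasCompactSupport := hs.mul_left
  tsupport_subset := (tsupport_mul_subset_left (f := ⇑(chartPartition I M c))).trans
    (tsupport_chartPartition_subset c)

variable (I) in
/-- Only finitely many functions of the partition of unity are nonzero near a compact set. -/
theorem exists_finset_chartPartition {K : Set M} (hK : IsCompact K) :
    ∃ s : Finset M, ∀ c ∉ s, ∀ x ∈ K, chartPartition I M c x = 0 := by
  have h := (chartPartition I M).locallyFinite.finite_nonempty_inter_compact hK
  refine ⟨h.toFinset, fun c hc x hx => ?_⟩
  by_contra hne
  exact hc (h.mem_toFinset.2 ⟨x, hne, hx⟩)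

theorem sum_chartPartition {K : Set M} {s : Finset M}
    (hs : ∀ c ∉ s, ∀ x ∈ K, chartPartition I M c x = 0) {x : M} (hx : x ∈ K) :
    ∑ c ∈ s, chartPartition I M c x = 1 := by
  rw [← (chartPartition I M).sum_eq_one (Set.mem_univ x)]
  refine (finsum_eq_sum_of_support_subset _ fun c hc => ?_).symm
  by_contra hcs
  exact hc (hs c hcs x hx)

theorem sum_chartPartition_mul {f : M → ℝ} {s : Finset M}
    (hs : ∀ c ∉ s, ∀ x ∈ tsupport f, chartPartition I M c x = 0) (x : M) :
    ∑ c ∈ s, chartPartition I M c x * f x = f x := by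
  rw [← Finset.sum_mul]
  by_cases hx : x ∈ tsupport f
  · rw [sum_chartPartition hs hx, one_mul]
  · rw [image_eq_zero_of_notMem_tsupport hx, mul_zero]

theorem integral_eq_sum (F : M → V) {f : M → ℝ} {s : Finset M}
    (hs : ∀ c ∉ s, ∀ x ∈ tsupport f, chartPartition I M c x = 0) :
    integral I F f = ∑ c ∈ s, chartIntegral I F c fun x => chartPartition I M c x * f x := by
  refine finsum_eq_sum_of_support_subset _ fun c hc => ?_
  by_contra hcs
  refine hc ?_
  have h0 : (fun x => chartPartition I M c x * f x) = fun x => 0 * f x := funext fun x => by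
    by_cases hx : x ∈ tsupport f
    · rw [hs c hcs x hx]
    · rw [image_eq_zero_of_notMem_tsupport hx, mul_zero, mul_zero]
  change chartIntegral I F c (fun x => chartPartition I M c x * f x) = 0
  rw [h0, chartIntegral_const_mul, zero_mul]

/-- The integral of a function supported in the domain of a chart is computed in that chart. -/
theorem integral_eq_chartIntegral {F : M → V} (hF : IsSmoothImmersion I F) {d : M} {h : M → ℝ}
    (hh : IsChartSupported I d h) : integral I F h = chartIntegral I F d h := by
  obtain ⟨s, hs⟩ := exists_finset_chartPartition I hh.hasCompactSupport.isCompact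
  have h1 : ∀ c, tsupport (fun x => chartPartition I M c x * h x) ⊆ (extChartAt I d).source :=
    fun c => (tsupport_mul_subset_right (f := ⇑(chartPartition I M c))).trans hh.tsupport_subset
  have h2 : ∀ c, IsChartSupported I c fun x => chartPartition I M c x * h x := fun c =>
    isChartSupported_chartPartition_mul c hh.continuous hh.hasCompactSupport
  rw [integral_eq_sum F hs, Finset.sum_congr rfl fun c _ =>
    chartIntegral_eq_chartIntegral hF (h2 c).tsupport_subset (h1 c),
    ← chartIntegral_sum hF s fun c _ => ⟨(h2 c).continuous, (h2 c).hasCompactSupport, h1 c⟩]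
  exact congrArg _ (funext fun x => sum_chartPartition_mul hs x)

theorem integral_const_mul (F : M → V) {f : M → ℝ} (hs : HasCompactSupport f) (r : ℝ) :
    integral I F (fun x => r * f x) = r * integral I F f := by
  obtain ⟨s, hs⟩ := exists_finset_chartPartition I hs.isCompact
  rw [integral_eq_sum F hs, integral_eq_sum F fun c hc x hx =>
    hs c hc x (tsupport_mul_subset_right (f := fun _ => r) hx), Finset.mul_sum]
  refine Finset.sum_congr rfl fun c _ => ?_
  rw [← chartIntegral_const_mul]
  exact congrArg _ (funext fun x => mul_left_comm _ _ _)

theorem integral_sum {F : M → V} (hF : IsSmoothImmersion I F) {ι : Type*} (t : Finset ι)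
    {f : ι → M → ℝ} (hf : ∀ i ∈ t, Continuous (f i)) (hs : ∀ i ∈ t, HasCompactSupport (f i)) :
    integral I F (fun x => ∑ i ∈ t, f i x) = ∑ i ∈ t, integral I F (f i) := by
  have hK : IsCompact (⋃ i ∈ t, tsupport (f i)) := t.isCompact_biUnion fun i hi =>
      (hs i hi).isCompact
  obtain ⟨s, hsK⟩ := exists_finset_chartPartition I hK
  have h1 : tsupport (fun x => ∑ i ∈ t, f i x) ⊆ ⋃ i ∈ t, tsupport (f i) := by
    refine closure_minimal (fun x hx => ?_) hK.isClosed
    by_contra hne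
    refine hx (Finset.sum_eq_zero fun i hi => image_eq_zero_of_notMem_tsupport fun h => hne ?_)
    exact Set.mem_biUnion hi h
  rw [integral_eq_sum F fun c hc x hx => hsK c hc x (h1 hx),
    Finset.sum_congr (f := fun i => integral I F (f i)) rfl fun i hi =>
      integral_eq_sum F fun c hc x hx => hsK c hc x (Set.mem_biUnion hi hx), Finset.sum_comm]
  refine Finset.sum_congr rfl fun c _ => ?_
  rw [← chartIntegral_sum hF t fun i hi =>
    isChartSupported_chartPartition_mul c (hf i hi) (hs i hi)]
  exact congrArg _ (funext fun x => Finset.mul_sum _ _ _)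

theorem integral_add {F : M → V} (hF : IsSmoothImmersion I F) {f g : M → ℝ} (hf : Continuous f)
    (hfs : HasCompactSupport f) (hg : Continuous g) (hgs : HasCompactSupport g) :
    integral I F (fun x => f x + g x) = integral I F f + integral I F g := by
  have h := integral_sum hF Finset.univ (f := ![f, g])
    (by intro i _; fin_cases i <;> assumption) (by intro i _; fin_cases i <;> assumption)
  simpa using h

theorem integral_sub {F : M → V} (hF : IsSmoothImmersion I F) {f g : M → ℝ} (hf : Continuous f)
    (hfs : HasCompactSupport f) (hg : Continuous g) (hgs : HasCompactSupport g) :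
    integral I F (fun x => f x - g x) = integral I F f - integral I F g := by
  have h := integral_add hF hf hfs (hg.const_mul (-1)) (hgs.mul_left (f := fun _ => (-1 : ℝ)))
  rw [integral_const_mul F hgs] at h
  simpa [sub_eq_add_neg] using h

theorem integral_nonneg (F : M → V) {f : M → ℝ} (h0 : ∀ x, 0 ≤ f x) : 0 ≤ integral I F f :=
  finsum_nonneg fun c => chartIntegral_nonneg (F := F) (c := c)
    (h := fun x => chartPartition I M c x * f x)
    fun x => mul_nonneg ((chartPartition I M).nonneg c x) (h0 x)

theorem integral_mono {F : M → V} (hF : IsSmoothImmersion I F) {f g : M → ℝ} (hf : Continuous f)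
    (hfs : HasCompactSupport f) (hg : Continuous g) (hgs : HasCompactSupport g)
    (hfg : ∀ x, f x ≤ g x) : integral I F f ≤ integral I F g := by
  have h := integral_nonneg (I := I) F fun x => sub_nonneg.2 (hfg x)
  rw [integral_sub hF hg hgs hf hfs] at h
  linarith

theorem integral_pos {F : M → V} (hF : IsSmoothImmersion I F) {f : M → ℝ} (hf : Continuous f)
    (hfs : HasCompactSupport f) (h0 : ∀ x, 0 ≤ f x) {x : M} (hx : 0 < f x) :
    0 < integral I F f := by
  obtain ⟨s, hs⟩ := exists_finset_chartPartition I hfs.isCompact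
  have hnn : ∀ c x, 0 ≤ chartPartition I M c x * f x := fun c x =>
    mul_nonneg ((chartPartition I M).nonneg c x) (h0 x)
  have hxs : x ∈ tsupport f := subset_tsupport _ (Function.mem_support.2 hx.ne')
  obtain ⟨c, hc, hcx⟩ : ∃ c ∈ s, 0 < chartPartition I M c x := by
    by_contra! hne
    have h1 := sum_chartPartition hs hxs
    have h2 : ∑ c ∈ s, chartPartition I M c x ≤ 0 := Finset.sum_nonpos hne
    linarith
  rw [integral_eq_sum F hs]
  exact Finset.sum_pos' (fun c _ => chartIntegral_nonneg (hnn c)) ⟨c, hc,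
    chartIntegral_pos hF (isChartSupported_chartPartition_mul c hf hfs) (hnn c) (mul_pos hcx hx)⟩

theorem hasCompactSupport_tanD (F : M → V) (v : V) {f : M → ℝ} (hs : HasCompactSupport f) :
    HasCompactSupport (tanD I F v f) := by
  refine HasCompactSupport.intro hs.isCompact fun x hx => ?_
  have : f =ᶠ[nhds x] fun _ => 0 := notMem_tsupport_iff_eventuallyEq.1 hx
  rw [tanD_congr F v this, tanD_const]

/-- The divergence theorem: on a minimal hypersurface, the tangential parts of constant vectors
are divergence free. -/
theorem integral_tanD_eq_zero {F : M → V} (hF : IsSmoothImmersion I F) (hmin : IsMinimal I F)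
    (hdim : Module.finrank ℝ V = Module.finrank ℝ E + 1) (v : V) {φ : M → ℝ}
    (hφ : ContMDiff I 𝓘(ℝ, ℝ) ∞ φ) (hs : HasCompactSupport φ) :
    integral I F (tanD I F v φ) = 0 := by
  obtain ⟨s, hsK⟩ := exists_finset_chartPartition I hs.isCompact
  have hsm : ∀ c, ContMDiff I 𝓘(ℝ, ℝ) ∞ fun x => chartPartition I M c x * φ x := fun c =>
    (chartPartition I M c).contMDiff.mul hφ
  have hcs := fun c => isChartSupported_chartPartition_mul (I := I) c hφ.continuous hs
  have h1 : tanD I F v φ = fun x => ∑ c ∈ s, tanD I F v (fun x => chartPartition I M c x * φ x) x :=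
    funext fun x => by
      rw [← tanD_sum F v s fun c => (hsm c).contMDiffAt]
      exact congrArg (fun f => tanD I F v f x)
        (funext fun x => (sum_chartPartition_mul hsK x).symm)
  rw [h1, integral_sum hF s (fun c _ => (contMDiff_tanD hF v (hsm c)).continuous)
    fun c _ => hasCompactSupport_tanD F v (hcs c).hasCompactSupport]
  refine Finset.sum_eq_zero fun c _ => ?_
  have hsupp : tsupport (tanD I F v fun x => chartPartition I M c x * φ x) ⊆
      tsupport fun x => chartPartition I M c x * φ x :=
    closure_minimal (fun x hx => by
      by_contra hne
      refine hx ?_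
      rw [tanD_congr F v (notMem_tsupport_iff_eventuallyEq.1 hne)]
      exact tanD_const F v 0 x) (isClosed_tsupport _)
  rw [integral_eq_chartIntegral hF ⟨(contMDiff_tanD hF v (hsm c)).continuous,
    hasCompactSupport_tanD F v (hcs c).hasCompactSupport, hsupp.trans (hcs c).tsupport_subset⟩]
  exact chartIntegral_tanD_eq_zero hF hmin hdim v (hsm c) (hcs c)

end GlobalIntegral

/-! ### Radial functions and integration by parts on cones -/

section RadialCalculus

variable {E : Type uE} [NormedAddCommGroup E] [NormedSpace ℝ E] [FiniteDimensional ℝ E]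
  {H : Type uH} [TopologicalSpace H] {I : ModelWithCorners ℝ E H} [I.Boundaryless]
  {M : Type uM} [TopologicalSpace M] [ChartedSpace H M] [IsManifold I ∞ M]
  {V : Type uV} [NormedAddCommGroup V] [InnerProductSpace ℝ V] [FiniteDimensional ℝ V]

/-- The logarithm `t` of the distance `r = exp t` to the origin. -/
def logNorm (F : M → V) (x : M) : ℝ := Real.log ‖F x‖

/-- `F` is a minimal hypersurface which is a cone with its vertex removed, and the part of it
between any two concentric spheres is compact. -/
structure IsMinimalCone (I : ModelWithCorners ℝ E H) (F : M → V) : Prop where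
  immersion : IsSmoothImmersion I F
  minimal : IsMinimal I F
  conical : IsConical I F
  ne_zero : ∀ x, F x ≠ 0
  isCompact_preimage : ∀ K : Set ℝ, IsCompact K → IsCompact (logNorm F ⁻¹' K)
  finrank_eq : Module.finrank ℝ V = Module.finrank ℝ E + 1

theorem hasCompactSupport_tanD_position [T2Space M] (F : M → V)
    {u : M → ℝ} (hs : HasCompactSupport u) :
    HasCompactSupport fun x => tanD I F (F x) u x := by
  refine HasCompactSupport.intro hs.isCompact fun x hx => ?_
  have : u =ᶠ[nhds x] fun _ => 0 := notMem_tsupport_iff_eventuallyEq.1 hx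
  rw [tanD_congr F _ this, tanD_const]

theorem contMDiff_gradNormSq {F : M → V} (hF : IsSmoothImmersion I F) {φ : M → ℝ}
    (hφ : ContMDiff I 𝓘(ℝ, ℝ) ∞ φ) : ContMDiff I 𝓘(ℝ, ℝ) ∞ (gradNormSq I F φ) := by
  rw [funext fun x => gradNormSq_eq_sum (stdOrthonormalBasis ℝ V) hF φ x]
  have h1 : ∀ a ∈ Finset.univ, ContMDiff I 𝓘(ℝ, ℝ) ∞ fun x =>
      tanD I F (stdOrthonormalBasis ℝ V a) φ x ^ 2 := fun a _ => (contMDiff_tanD hF _ hφ).pow 2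
  exact contMDiff_finsetSum h1

theorem hasCompactSupport_gradNormSq [T2Space M] {F : M → V} (hF : IsSmoothImmersion I F)
    {φ : M → ℝ} (hs : HasCompactSupport φ) : HasCompactSupport (gradNormSq I F φ) := by
  refine HasCompactSupport.intro hs.isCompact fun x hx => ?_
  have : φ =ᶠ[nhds x] fun _ => 0 := notMem_tsupport_iff_eventuallyEq.1 hx
  rw [gradNormSq_eq_sum (stdOrthonormalBasis ℝ V) hF]
  simp only [tanD_congr F _ this, tanD_const]
  simp

namespace IsMinimalCone

variable [T2Space M] {F : M → V} (hM : IsMinimalCone I F)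
include hM

theorem exp_logNorm (x : M) : Real.exp (logNorm F x) = ‖F x‖ :=
  Real.exp_log (norm_pos_iff.2 (hM.ne_zero x))

theorem exp_neg_two_mul_norm_sq (x : M) : Real.exp (-2 * logNorm F x) * ‖F x‖ ^ 2 = 1 := by
  rw [← hM.exp_logNorm x, ← Real.exp_nat_mul, ← Real.exp_add]
  simp

theorem contMDiff_logNorm : ContMDiff I 𝓘(ℝ, ℝ) ∞ (logNorm F) := fun x =>
  ((contDiffAt_norm ℝ (hM.ne_zero x)).log
    (norm_ne_zero_iff.2 (hM.ne_zero x))).contMDiffAt.comp x (hM.immersion.1 x)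

theorem hasCompactSupport_comp {χ : ℝ → ℝ} (hχ : HasCompactSupport χ) :
    HasCompactSupport fun x => χ (logNorm F x) := by
  refine HasCompactSupport.of_support_subset_isCompact (hM.isCompact_preimage _ hχ) fun x hx => ?_
  exact subset_tsupport _ hx

theorem contMDiff_comp {g : ℝ → ℝ} (hg : ContDiff ℝ ∞ g) :
    ContMDiff I 𝓘(ℝ, ℝ) ∞ fun x => g (logNorm F x) :=
  hg.contMDiff.comp hM.contMDiff_logNorm

theorem tanD_logNorm (v : V) (x : M) :
    tanD I F v (logNorm F) x = Real.exp (-2 * logNorm F x) * inner ℝ (F x) v := by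
  obtain ⟨ν, O, hx, hν⟩ := exists_isUnitNormalOn hM.finrank_eq hM.immersion x
  have hpos : ∀ z, 0 < ‖F z‖ := fun z => norm_pos_iff.2 (hM.ne_zero z)
  have h1 : logNorm F = fun z => (fun s => 1 / 2 * Real.log s) (inner ℝ (F z) (F z)) :=
    funext fun z => by
      simp only [real_inner_self_eq_norm_sq, Real.log_pow, logNorm]
      push_cast
      ring
  have hFx : ContMDiffAt I 𝓘(ℝ, V) ∞ F x := hM.immersion.1 x
  have hsq : inner ℝ (F x) (F x) ≠ (0 : ℝ) := by
    rw [real_inner_self_eq_norm_sq]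
    exact (pow_pos (hpos x) 2).ne'
  have h2 : ContMDiffAt I 𝓘(ℝ, ℝ) ∞ (fun z => inner ℝ (F z) (F z) : M → ℝ) x := by
    have := (contDiff_norm_sq ℝ (E := V) (n := ∞)).contMDiff.contMDiffAt.comp x hFx
    refine this.congr_of_eventuallyEq (Filter.Eventually.of_forall fun z => ?_)
    exact real_inner_self_eq_norm_sq _
  have h3 := tanD_comp_real (I := I) F v h2 ((Real.hasDerivAt_log hsq).const_mul (1 / 2 : ℝ))
  have h4 := hM.exp_neg_two_mul_norm_sq x
  rw [← real_inner_self_eq_norm_sq] at h4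
  have h5 : (inner ℝ (F x) (F x) : ℝ)⁻¹ = Real.exp (-2 * logNorm F x) :=
    (eq_inv_of_mul_eq_one_left h4).symm
  rw [h1, h3, tanD_inner F v hFx hFx, hν.tanD_self x hx, inner_sub_right, inner_sub_left,
    inner_smul_right, inner_smul_left, hν.inner_position hM.conical hx,
    real_inner_comm (ν x) (F x), hν.inner_position hM.conical hx, h5, real_inner_comm v (F x)]
  simp only [mul_zero, sub_zero]
  have h6 : logNorm F x = (1 / 2 : ℝ) * Real.log (inner ℝ (F x) (F x)) := congrFun h1 x
  rw [← h6]
  ring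

theorem tanD_comp_logNorm (v : V) {g : ℝ → ℝ} (hg : ContDiff ℝ ∞ g) (x : M) :
    tanD I F v (fun z => g (logNorm F z)) x =
      deriv g (logNorm F x) * (Real.exp (-2 * logNorm F x) * inner ℝ (F x) v) := by
  rw [tanD_comp_real F v hM.contMDiff_logNorm.contMDiffAt
    (hg.differentiable (by simp) _).hasDerivAt, hM.tanD_logNorm]

theorem tanD_position_comp_logNorm {g : ℝ → ℝ} (hg : ContDiff ℝ ∞ g) (x : M) :
    tanD I F (F x) (fun z => g (logNorm F z)) x = deriv g (logNorm F x) := by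
  rw [hM.tanD_comp_logNorm _ hg, real_inner_self_eq_norm_sq, hM.exp_neg_two_mul_norm_sq, mul_one]

theorem sum_inner_tanD_self {ι : Type*} [Fintype ι] (e : OrthonormalBasis ι ℝ V) (x : M) :
    ∑ a, inner ℝ (e a) (tanD I F (e a) F x) = (Module.finrank ℝ E : ℝ) := by
  classical
  obtain ⟨ν, O, hx, hν⟩ := exists_isUnitNormalOn hM.finrank_eq hM.immersion x
  have h1 : ∑ a, inner ℝ (ν x) (e a) * inner ℝ (e a) (ν x) = (1 : ℝ) :=
    (e.sum_inner_mul_inner _ _).trans (hν.inner_self hx)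
  have h2 : ∀ a, inner ℝ (e a) (tanD I F (e a) F x) =
      1 - inner ℝ (ν x) (e a) * inner ℝ (e a) (ν x) := fun a => by
    rw [hν.tanD_self x hx, inner_sub_right, inner_smul_right,
      orthonormal_iff_ite.1 e.orthonormal a a, if_pos rfl]
  have h3 := Module.finrank_eq_card_basis e.toBasis
  rw [hM.finrank_eq] at h3
  simp_rw [h2]
  rw [Finset.sum_sub_distrib, h1, Finset.sum_const, Finset.card_univ, ← h3]
  simp

theorem contMDiff_tanD_position {u : M → ℝ} (hu : ContMDiff I 𝓘(ℝ, ℝ) ∞ u) :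
    ContMDiff I 𝓘(ℝ, ℝ) ∞ fun x => tanD I F (F x) u x := by
  have h : (fun x => tanD I F (F x) u x) = fun x => ∑ a,
      inner ℝ (stdOrthonormalBasis ℝ V a) (F x) • tanD I F (stdOrthonormalBasis ℝ V a) u x :=
    funext fun x => tanD_basis _ F _ u x
  rw [h]
  have h1 : ∀ a ∈ Finset.univ, ContMDiff I 𝓘(ℝ, ℝ) ∞ fun x =>
      inner ℝ (stdOrthonormalBasis ℝ V a) (F x) • tanD I F (stdOrthonormalBasis ℝ V a) u x :=
    fun a _ => (contMDiffOn_univ.1 (contMDiffOn_inner_const hM.immersion.1.contMDiffOn _)).smul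
      (contMDiff_tanD hM.immersion _ hu)
  exact contMDiff_finsetSum h1

variable [SigmaCompactSpace M]

/-- The first variation formula for dilations: the divergence of `u` times the position field
integrates to zero. -/
theorem integral_position {u : M → ℝ} (hu : ContMDiff I 𝓘(ℝ, ℝ) ∞ u) (hs : HasCompactSupport u) :
    integral I F (fun x => Module.finrank ℝ E * u x + tanD I F (F x) u x) = 0 := by
  set e := stdOrthonormalBasis ℝ V
  have hx : ∀ a, ContMDiff I 𝓘(ℝ, ℝ) ∞ fun x => (inner ℝ (e a) (F x) : ℝ) := fun a =>
    contMDiffOn_univ.1 (contMDiffOn_inner_const hM.immersion.1.contMDiffOn _)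
  have hsm : ∀ a, ContMDiff I 𝓘(ℝ, ℝ) ∞ fun x => inner ℝ (e a) (F x) * u x := fun a =>
    (hx a).mul hu
  have h1 : (fun x => Module.finrank ℝ E * u x + tanD I F (F x) u x) =
      fun x => ∑ a, tanD I F (e a) (fun x => inner ℝ (e a) (F x) * u x) x := funext fun x => by
    have h2 : ∀ a, tanD I F (e a) (fun x => inner ℝ (e a) (F x) * u x) x =
        inner ℝ (e a) (F x) * tanD I F (e a) u x +
          u x * inner ℝ (e a) (tanD I F (e a) F x) := fun a => by
      rw [tanD_mul F _ (hx a).contMDiffAt hu.contMDiffAt,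
        tanD_inner_const F _ _ hM.immersion.1.contMDiffAt]
    simp_rw [h2]
    rw [Finset.sum_add_distrib, ← Finset.mul_sum, hM.sum_inner_tanD_self e, tanD_basis e]
    simp only [smul_eq_mul]
    ring
  rw [h1, integral_sum hM.immersion _ (fun a _ =>
    (contMDiff_tanD hM.immersion _ (hsm a)).continuous)
    fun a _ => hasCompactSupport_tanD F _ hs.mul_left]
  exact Finset.sum_eq_zero fun a _ =>
    integral_tanD_eq_zero hM.immersion hM.minimal hM.finrank_eq _ (hsm a) hs.mul_left

/-- Integration of a radial derivative against a function that is homogeneous of degree zero. -/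
theorem integral_mul_deriv {k : M → ℝ} (hk : ContMDiff I 𝓘(ℝ, ℝ) ∞ k)
    (hk0 : ∀ x, tanD I F (F x) k x = 0) {ψ : ℝ → ℝ} (hψ : ContDiff ℝ ∞ ψ)
    (hs : HasCompactSupport ψ) :
    integral I F (fun x => k x * (deriv ψ (logNorm F x) *
      Real.exp (-Module.finrank ℝ E * logNorm F x))) = 0 := by
  set N : ℝ := (Module.finrank ℝ E : ℝ)
  have hexp : ContDiff ℝ ∞ fun t => Real.exp (-N * t) :=
    Real.contDiff_exp.comp (contDiff_const.mul contDiff_id)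
  have hg : ContDiff ℝ ∞ fun t => ψ t * Real.exp (-N * t) := hψ.mul hexp
  have hgs : HasCompactSupport fun t => ψ t * Real.exp (-N * t) := hs.mul_right
  have hg' : ∀ t, deriv (fun t => ψ t * Real.exp (-N * t)) t =
      deriv ψ t * Real.exp (-N * t) - N * (ψ t * Real.exp (-N * t)) := fun t => by
    have h1 := (hψ.differentiable (by simp) t).hasDerivAt
    have h2 := ((hasDerivAt_id' t).const_mul (-N)).exp
    have h3 : HasDerivAt (fun t => ψ t * Real.exp (-N * t)) _ t := h1.mul h2
    rw [h3.deriv]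
    ring
  have h := hM.integral_position (hk.mul (hM.contMDiff_comp hg))
    (hM.hasCompactSupport_comp hgs).mul_left
  rw [← h]
  congr 1
  funext x
  have h3 : tanD I F (F x) (k * fun z => ψ (logNorm F z) * Real.exp (-N * logNorm F z)) x = _ :=
    tanD_mul F (F x) hk.contMDiffAt (hM.contMDiff_comp hg).contMDiffAt
  rw [h3, hM.tanD_position_comp_logNorm hg, hk0, hg']
  simp only [Pi.mul_apply]
  ring

/-- Green's formula. -/
theorem integral_green {u f : M → ℝ} (hu : ContMDiff I 𝓘(ℝ, ℝ) ∞ u)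
    (hs : HasCompactSupport u) (hf : ContMDiff I 𝓘(ℝ, ℝ) ∞ f) :
    integral I F (fun x => u x * tanLaplacian I F f x +
      ∑ a, tanD I F (stdOrthonormalBasis ℝ V a) u x *
        tanD I F (stdOrthonormalBasis ℝ V a) f x) = 0 := by
  set e := stdOrthonormalBasis ℝ V
  have hDf := fun a => contMDiff_tanD hM.immersion (e a) hf
  have h1 : (fun x => u x * tanLaplacian I F f x +
      ∑ a, tanD I F (e a) u x * tanD I F (e a) f x) =
      fun x => ∑ a, tanD I F (e a) (fun x => u x * tanD I F (e a) f x) x := funext fun x => by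
    have h2 : ∀ a, tanD I F (e a) (fun x => u x * tanD I F (e a) f x) x = _ := fun a =>
      tanD_mul F (e a) hu.contMDiffAt (hDf a).contMDiffAt
    simp_rw [h2]
    rw [Finset.sum_add_distrib, ← Finset.mul_sum]
    congr 1
    exact Finset.sum_congr rfl fun a _ => mul_comm _ _
  have hsm : ∀ a, ContMDiff I 𝓘(ℝ, ℝ) ∞ fun x => u x * tanD I F (e a) f x := fun a =>
    hu.mul (hDf a)
  rw [h1, integral_sum hM.immersion _
    (fun a _ => (contMDiff_tanD hM.immersion _ (hsm a)).continuous)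
    fun a _ => hasCompactSupport_tanD F _ hs.mul_right]
  exact Finset.sum_eq_zero fun a _ => integral_tanD_eq_zero hM.immersion hM.minimal hM.finrank_eq _
    (hsm a) hs.mul_right

/-- Hardy's inequality on a minimal cone of dimension `N`: expand the square of
`∇φ + β φ x / |x|²` with `β = (N - 2) / 2`, and remove the cross term by the first variation formula
for dilations, applied to `φ² / |x|²`. -/
theorem hardy {φ : M → ℝ} (hφ : ContMDiff I 𝓘(ℝ, ℝ) ∞ φ) (hs : HasCompactSupport φ) :
    ((Module.finrank ℝ E : ℝ) - 2) ^ 2 / 4 *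
        integral I F (fun x => Real.exp (-2 * logNorm F x) * φ x ^ 2) ≤
      integral I F (gradNormSq I F φ) := by
  set N : ℝ := (Module.finrank ℝ E : ℝ) with hN
  set β : ℝ := (N - 2) / 2 with hβ
  set e := stdOrthonormalBasis ℝ V
  have hexp : ContDiff ℝ ∞ fun t : ℝ => Real.exp (-2 * t) :=
    Real.contDiff_exp.comp (contDiff_const.mul contDiff_id)
  have hw : ContMDiff I 𝓘(ℝ, ℝ) ∞ fun x => Real.exp (-2 * logNorm F x) := hM.contMDiff_comp hexp
  set u : M → ℝ := fun x => Real.exp (-2 * logNorm F x) * φ x ^ 2 with hu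
  have hφ2 : ContMDiff I 𝓘(ℝ, ℝ) ∞ fun x => φ x ^ 2 := hφ.pow 2
  have hus : ContMDiff I 𝓘(ℝ, ℝ) ∞ u := hw.mul hφ2
  have huc : HasCompactSupport u := by
    have : HasCompactSupport fun x => φ x ^ 2 := hs.comp_left (g := fun s => s ^ 2) (by simp)
    exact this.mul_left
  have hDu : ∀ x, tanD I F (F x) u x = -2 * u x +
      2 * (Real.exp (-2 * logNorm F x) * φ x * tanD I F (F x) φ x) := fun x => by
    have h1 : deriv (fun t : ℝ => Real.exp (-2 * t)) (logNorm F x) =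
        Real.exp (-2 * logNorm F x) * -2 := by
      simpa using ((hasDerivAt_id' (logNorm F x)).const_mul (-2 : ℝ)).exp.deriv
    rw [hu, tanD_mul F _ hw.contMDiffAt hφ2.contMDiffAt, hM.tanD_position_comp_logNorm hexp, h1,
      tanD_comp_real F _ hφ.contMDiffAt (hasDerivAt_pow 2 (φ x))]
    simp only [Nat.cast_ofNat, Nat.add_one_sub_one, pow_one]
    ring
  have hpt : ∀ x, β ^ 2 * u x ≤ gradNormSq I F φ x + β * (N * u x + tanD I F (F x) u x) := by
    intro x
    have h0 : 0 ≤ ∑ a, (tanD I F (e a) φ x +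
        β * Real.exp (-2 * logNorm F x) * φ x * inner ℝ (e a) (F x)) ^ 2 :=
      Finset.sum_nonneg fun a _ => sq_nonneg _
    have h1 : ∑ a, (tanD I F (e a) φ x +
        β * Real.exp (-2 * logNorm F x) * φ x * inner ℝ (e a) (F x)) ^ 2 =
        gradNormSq I F φ x + 2 * β * Real.exp (-2 * logNorm F x) * φ x * tanD I F (F x) φ x +
          β ^ 2 * Real.exp (-2 * logNorm F x) * φ x ^ 2 *
            (Real.exp (-2 * logNorm F x) * ‖F x‖ ^ 2) := by
      rw [gradNormSq_eq_sum e hM.immersion, tanD_basis e, ← real_inner_self_eq_norm_sq,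
        ← e.sum_inner_mul_inner, Finset.mul_sum, Finset.mul_sum, Finset.mul_sum,
        ← Finset.sum_add_distrib, ← Finset.sum_add_distrib]
      refine Finset.sum_congr rfl fun a _ => ?_
      rw [real_inner_comm (e a) (F x), smul_eq_mul]
      ring
    rw [h1, hM.exp_neg_two_mul_norm_sq] at h0
    rw [hDu]
    have h2 : N = 2 * β + 2 := by rw [hβ]; ring
    rw [h2]
    simp only [hu] at h0 ⊢
    linarith
  have hP0 : integral I F (fun x => β * (N * u x + tanD I F (F x) u x)) = 0 := by
    have h3 : HasCompactSupport fun x => N * u x + tanD I F (F x) u x :=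
      huc.mul_left.add (hasCompactSupport_tanD_position F huc)
    rw [integral_const_mul F h3, hM.integral_position hus huc, mul_zero]
  have hPc : Continuous fun x => β * (N * u x + tanD I F (F x) u x) :=
    ((hus.continuous.const_mul N).add (hM.contMDiff_tanD_position hus).continuous).const_mul β
  have hPs : HasCompactSupport fun x => β * (N * u x + tanD I F (F x) u x) :=
    (huc.mul_left.add (hasCompactSupport_tanD_position F huc)).mul_left
  have hgc := (contMDiff_gradNormSq hM.immersion hφ).continuous
  have hgs := hasCompactSupport_gradNormSq hM.immersion hs
  have h := integral_mono hM.immersion (hus.continuous.const_mul (β ^ 2)) huc.mul_left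
    (hgc.add hPc) (hgs.add hPs) hpt
  have h3 := integral_add hM.immersion hgc hgs hPc hPs
  rw [hP0, add_zero] at h3
  rw [integral_const_mul F huc] at h
  have h4 : β ^ 2 = (N - 2) ^ 2 / 4 := by rw [hβ]; ring
  rw [← h4, ← h3]
  exact h

end IsMinimalCone

end RadialCalculus

/-! ### Cutoff functions -/

section Cutoff

/-- A compactly supported function on the line with integral zero has a compactly supported
primitive. -/
theorem exists_primitive_of_integral_eq_zero {ψ : ℝ → ℝ} (hψ : ContDiff ℝ ∞ ψ) {a b : ℝ}
    (h0 : ∀ t, t ∉ Set.Ioo a b → ψ t = 0) (hint : ∫ t in a..b, ψ t = 0) :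
    ∃ Ψ : ℝ → ℝ, ContDiff ℝ ∞ Ψ ∧ HasCompactSupport Ψ ∧ deriv Ψ = ψ := by
  set Ψ : ℝ → ℝ := fun t => ∫ s in a..t, ψ s with hΨ
  have hd : ∀ t, HasDerivAt Ψ (ψ t) t := fun t =>
    hψ.continuous.integral_hasStrictDerivAt a t |>.hasDerivAt
  have hderiv : deriv Ψ = ψ := funext fun t => (hd t).deriv
  refine ⟨Ψ, ?_, ?_, hderiv⟩
  · rw [contDiff_infty_iff_deriv, hderiv]
    exact ⟨fun t => (hd t).differentiableAt, hψ⟩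
  · refine HasCompactSupport.intro (isCompact_Icc (a := a) (b := b)) fun t ht => ?_
    rcases lt_or_ge t a with h | h
    · refine intervalIntegral.integral_zero_ae (Filter.Eventually.of_forall fun s hs => h0 s ?_)
      rw [Set.uIoc_of_ge h.le] at hs
      exact fun h => absurd h.1 (not_lt.2 hs.2)
    · have hb : b < t := by
        by_contra hne
        exact ht ⟨h, not_lt.1 hne⟩
      have h1 := intervalIntegral.integral_add_adjacent_intervals
        (hψ.continuous.intervalIntegrable (μ := MeasureTheory.volume) a b)
        (hψ.continuous.intervalIntegrable (μ := MeasureTheory.volume) b t)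
      rw [hΨ]
      simp only
      rw [← h1, hint, zero_add]
      refine intervalIntegral.integral_zero_ae (Filter.Eventually.of_forall fun s hs => h0 s ?_)
      rw [Set.uIoc_of_le hb.le] at hs
      exact fun h => absurd h.2 (not_lt.2 hs.1.le)

/-- There are cutoff functions `χ` on the line whose derivative is arbitrarily small in mean
compared to `χ`: up to the derivative of a compactly supported function, `χ' ^ 2` is a small
multiple of `χ ^ 2`. In the integrals over a cone, the term `deriv Ψ` drops out by integration by
parts. -/
theorem exists_cutoff (t₀ : ℝ) {κ : ℝ} (hκ : 0 < κ) :
    ∃ (χ Ψ : ℝ → ℝ) (θ : ℝ), ContDiff ℝ ∞ χ ∧ HasCompactSupport χ ∧ χ t₀ = 1 ∧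
      ContDiff ℝ ∞ Ψ ∧ HasCompactSupport Ψ ∧ θ ≤ κ ∧
      ∀ t, deriv χ t ^ 2 = deriv Ψ t + θ * χ t ^ 2 := by
  let b : ContDiffBump (0 : ℝ) := ⟨1, 2, one_pos, one_lt_two⟩
  have hb : ContDiff ℝ ∞ b := b.contDiff
  have hb' : ContDiff ℝ ∞ (deriv b) := (contDiff_infty_iff_deriv.1 hb).2
  have hsupp : ∀ t, t ∉ Set.Icc (-2 : ℝ) 2 → b t = 0 := fun t ht => by
    refine b.zero_of_le_dist ?_
    rw [Real.dist_eq, sub_zero]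
    by_contra hne
    exact ht (abs_le.1 (not_le.1 hne).le)
  have hsupp' : ∀ t, t ∉ Set.Icc (-2 : ℝ) 2 → deriv b t = 0 := fun t ht => by
    have : (b : ℝ → ℝ) =ᶠ[nhds t] fun _ => 0 := by
      filter_upwards [isClosed_Icc.isOpen_compl.mem_nhds ht] with s hs using hsupp s hs
    rw [this.deriv_eq]
    simp
  set A := ∫ t in (-3 : ℝ)..3, deriv b t ^ 2 with hA
  set B := ∫ t in (-3 : ℝ)..3, b t ^ 2 with hB
  have hBpos : 0 < B := by
    refine intervalIntegral.integral_pos (by norm_num) (hb.continuous.pow 2).continuousOn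
      (fun _ _ => sq_nonneg _) ⟨0, by norm_num, ?_⟩
    rw [b.one_of_mem_closedBall (by simp [b])]
    norm_num
  set θ₀ := A / B with hθ₀
  have hψ : ContDiff ℝ ∞ fun t => deriv b t ^ 2 - θ₀ * b t ^ 2 :=
    (hb'.pow 2).sub (contDiff_const.mul (hb.pow 2))
  obtain ⟨Ψ, hΨ, hΨs, hΨd⟩ := exists_primitive_of_integral_eq_zero (a := -3) (b := 3) hψ
    (fun t ht => by
      have ht' : t ∉ Set.Icc (-2 : ℝ) 2 := fun h => ht ⟨by linarith [h.1], by linarith [h.2]⟩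
      rw [hsupp t ht', hsupp' t ht']
      ring) (by
      rw [intervalIntegral.integral_sub ((hb'.pow 2).continuous.intervalIntegrable _ _)
        ((contDiff_const.mul (hb.pow 2)).continuous.intervalIntegrable _ _),
        intervalIntegral.integral_const_mul, ← hA, ← hB, hθ₀, div_mul_cancel₀ _ hBpos.ne',
            sub_self])
  -- stretching by a factor `L` divides the mean square of the derivative by `L ^ 2`
  obtain ⟨L, hL1, hL⟩ : ∃ L : ℝ, 1 ≤ L ∧ θ₀ ≤ κ * L := by
    refine ⟨max 1 (θ₀ / κ), le_max_left _ _, ?_⟩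
    calc θ₀ = κ * (θ₀ / κ) := by field_simp
      _ ≤ _ := by gcongr; exact le_max_right _ _
  have hL0 : 0 < L := by linarith
  have hlin : ContDiff ℝ ∞ fun t : ℝ => L⁻¹ * (t - t₀) :=
    contDiff_const.mul (contDiff_id.sub contDiff_const)
  have hlind : ∀ t, HasDerivAt (fun t : ℝ => L⁻¹ * (t - t₀)) L⁻¹ t := fun t => by
    simpa using ((hasDerivAt_id' t).sub_const t₀).const_mul L⁻¹
  have hcs : ∀ {g : ℝ → ℝ}, HasCompactSupport g →
      HasCompactSupport fun t => g (L⁻¹ * (t - t₀)) := by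
    intro g hg
    exact hg.comp_homeomorph
      ((Homeomorph.subRight t₀).trans (Homeomorph.mulLeft₀ L⁻¹ (inv_ne_zero hL0.ne')))
  refine ⟨fun t => b (L⁻¹ * (t - t₀)), fun t => L⁻¹ * Ψ (L⁻¹ * (t - t₀)), L⁻¹ ^ 2 * θ₀,
    hb.comp hlin, hcs b.hasCompactSupport, ?_, contDiff_const.mul (hΨ.comp hlin),
    (hcs hΨs).mul_left, ?_, fun t => ?_⟩
  · simp only [sub_self, mul_zero]
    exact b.one_of_mem_closedBall (by simp [b])
  · rw [inv_pow, inv_mul_le_iff₀ (by positivity)]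
    nlinarith [mul_le_mul_of_nonneg_left hL1 (mul_pos hκ hL0).le]
  · have h1 := ((hb.differentiable (by simp) (L⁻¹ * (t - t₀))).hasDerivAt.comp t (hlind t)).deriv
    have h2 := (((hΨ.differentiable (by simp) (L⁻¹ * (t - t₀))).hasDerivAt.comp t
      (hlind t)).const_mul L⁻¹).deriv
    simp only [Function.comp_def] at h1 h2
    rw [h1, h2, hΨd]
    ring

end Cutoff

/-! ### Stable minimal cones -/

section StableCones

/-- The pointwise inequality behind the stability argument: Simons' inequality `Y ≥ 0`,
`(1 + 2 / m) G / 4 ≤ f Y` absorbs the gradient term of the stability inequality as soon as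
`δ ≥ 1 - 2 / m`. Here `w = f + ε` and `z = w ^ (δ - 2)`, while `G`, `L`, `a`, `r2` and `q` are the
values of `|∇f|²`, `Δf`, `|A|²`, `|x|²` and `|x|⁻²`, and `h`, `h'` those of the radial factor and of
its derivative. The left side is the integrand of the stability inequality minus a multiple of that
of Green's formula. -/
theorem stability_sub_green_le {m δ f w ε G L a q r2 z h h' : ℝ} (hδ : 0 < δ) (hδm : 1 - 2 / m ≤ δ)
    (hε : 0 < ε) (hw : w = f + ε) (hf : f = r2 * a) (hq : q * r2 = 1) (ha : 0 ≤ a)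
    (hG : 0 ≤ G) (hz : 0 < z) (hf0 : 0 ≤ f)
    (hY : 0 ≤ L / 2 - m * a + r2 * a ^ 2)
    (hK : (1 + 2 / m) * (G / 4) ≤ f * (L / 2 - m * a + r2 * a ^ 2)) :
    (h ^ 2 * ((δ / 2) ^ 2 * z * G) + w ^ 2 * z * h' ^ 2 * q - δ * (a * (w ^ 2 * z * h ^ 2))) -
      δ / 2 * (w * z * h ^ 2 * L + h ^ 2 * ((δ - 1) * z * G)) ≤
      w ^ 2 * z * (h' ^ 2 * q) - δ * m * (w * z) * (h ^ 2 * q) * (w - ε) := by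
  have hqf : q * f = a := by rw [hf, ← mul_assoc, hq, one_mul]
  have h1 : f * (L / 2 - m * a + r2 * a ^ 2) ≤ w * (L / 2 - m * a + w * a) := by
    have h2 : r2 * a ^ 2 = f * a := by rw [hf]; ring
    rw [h2] at hY ⊢
    have h3 : L / 2 - m * a + f * a ≤ L / 2 - m * a + w * a := by nlinarith
    nlinarith
  have h4 : G * (δ / 4 - (δ - 1) / 2) ≤ w * (L / 2 - m * a + w * a) := by
    have : G * (δ / 4 - (δ - 1) / 2) ≤ (1 + 2 / m) * (G / 4) := by nlinarith
    linarith
  have h5 : 0 ≤ δ * (z * h ^ 2) *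
      (w * (L / 2 - m * a + w * a) - G * (δ / 4 - (δ - 1) / 2)) :=
    mul_nonneg (by positivity) (sub_nonneg.2 h4)
  have h6 : w - ε = f := by rw [hw]; ring
  rw [h6]
  have h7 : δ * m * (w * z) * (h ^ 2 * q) * f = δ * m * (w * z) * h ^ 2 * a := by
    rw [← hqf]; ring
  rw [h7]
  nlinarith

/-- A lower bound, uniform as `ε → 0`, which absorbs the term of lower order in `f + ε`: this term
is only large where `f + ε` is of the order of `ε`. -/
theorem rpow_sub_ge {δ κ B f ε : ℝ} (hδ : 0 < δ) (hκ : 0 < κ) (hB : 0 < B) (hf : 0 ≤ f)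
    (hε : 0 < ε) :
    κ / 2 * f ^ δ - B * (2 * B / κ) ^ δ * ε ^ δ ≤
      κ * (f + ε) ^ δ - B * ε * (f + ε) ^ (δ - 1) := by
  have hw : 0 < f + ε := by linarith
  have h1 : f ^ δ ≤ (f + ε) ^ δ := Real.rpow_le_rpow hf (by linarith) hδ.le
  have h2 : (f + ε) ^ δ = (f + ε) ^ (δ - 1) * (f + ε) := by
    rw [Real.rpow_sub_one hw.ne', div_mul_cancel₀ _ hw.ne']
  have hp : 0 < (f + ε) ^ (δ - 1) := Real.rpow_pos_of_pos hw _
  have h0 : 0 ≤ B * (2 * B / κ) ^ δ * ε ^ δ := by positivity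
  rcases le_or_gt (B * ε) (κ / 2 * (f + ε)) with h | h
  · have h3 : B * ε * (f + ε) ^ (δ - 1) ≤ κ / 2 * (f + ε) ^ δ := by
      rw [h2]
      nlinarith
    nlinarith
  · have h3 : (f + ε) ^ δ ≤ (2 * B / κ) ^ δ * ε ^ δ := by
      rw [← Real.mul_rpow (by positivity) hε.le]
      refine Real.rpow_le_rpow hw.le ?_ hδ.le
      rw [div_mul_eq_mul_div, le_div_iff₀ hκ]
      linarith
    have h4 : ε * (f + ε) ^ (δ - 1) ≤ (f + ε) ^ δ := by
      rw [h2]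
      nlinarith
    have h5 : B * ε * (f + ε) ^ (δ - 1) ≤ B * ((2 * B / κ) ^ δ * ε ^ δ) := by
      rw [mul_assoc]
      exact mul_le_mul_of_nonneg_left (h4.trans h3) hB.le
    have h6 : 0 ≤ (f + ε) ^ δ := (Real.rpow_pos_of_pos hw _).le
    nlinarith

variable {E : Type uE} [NormedAddCommGroup E] [NormedSpace ℝ E] [FiniteDimensional ℝ E]
  {H : Type uH} [TopologicalSpace H] {I : ModelWithCorners ℝ E H} [I.Boundaryless]
  {M : Type uM} [TopologicalSpace M] [ChartedSpace H M] [IsManifold I ∞ M]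
  {V : Type uV} [NormedAddCommGroup V] [InnerProductSpace ℝ V] [FiniteDimensional ℝ V]
  [T2Space M]

namespace IsMinimalCone

variable {F : M → V} (hM : IsMinimalCone I F)
include hM

/-- The square of the gradient of the product of a function that is homogeneous of degree zero and a
radial function has no cross term. -/
theorem gradNormSq_mul_comp {k : M → ℝ} (hk : ContMDiff I 𝓘(ℝ, ℝ) ∞ k)
    (hk0 : ∀ x, tanD I F (F x) k x = 0) {g : ℝ → ℝ} (hg : ContDiff ℝ ∞ g) (x : M) :
    gradNormSq I F (fun x => k x * g (logNorm F x)) x =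
      g (logNorm F x) ^ 2 * gradNormSq I F k x +
        k x ^ 2 * deriv g (logNorm F x) ^ 2 * Real.exp (-2 * logNorm F x) := by
  set e := stdOrthonormalBasis ℝ V
  set D := deriv g (logNorm F x)
  have h0 : ∑ a, inner ℝ (e a) (F x) * tanD I F (e a) k x = 0 := by
    rw [← hk0 x, tanD_basis e F (F x)]
    rfl
  have h1 : ∑ a, inner ℝ (F x) (e a) * inner ℝ (e a) (F x) = ‖F x‖ ^ 2 := by
    rw [e.sum_inner_mul_inner, real_inner_self_eq_norm_sq]
  have h2 := hM.exp_neg_two_mul_norm_sq x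
  set q := Real.exp (-2 * logNorm F x)
  have h3 : k x ^ 2 * D ^ 2 * q = k x ^ 2 * D ^ 2 * q * (q * ‖F x‖ ^ 2) := by rw [h2, mul_one]
  have h4 : g (logNorm F x) ^ 2 * gradNormSq I F k x = g (logNorm F x) ^ 2 * gradNormSq I F k x +
    2 * g (logNorm F x) * k x * D * q * ∑ a, inner ℝ (e a) (F x) * tanD I F (e a) k x := by
    rw [h0, mul_zero, add_zero]
  rw [h3, h4, ← h1, gradNormSq_eq_sum e hM.immersion, gradNormSq_eq_sum e hM.immersion,
    Finset.mul_sum, Finset.mul_sum, Finset.mul_sum, Finset.mul_sum, ← Finset.sum_add_distrib,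
    ← Finset.sum_add_distrib]
  refine Finset.sum_congr rfl fun a _ => ?_
  rw [tanD_mul F _ hk.contMDiffAt (hM.contMDiff_comp hg).contMDiffAt, hM.tanD_comp_logNorm _ hg,
    real_inner_comm (e a) (F x)]
  ring

/-- A radial factor does not contribute to the product of the gradients when the other function is
homogeneous of degree zero. -/
theorem sum_tanD_mul_comp {k f : M → ℝ} (hk : ContMDiff I 𝓘(ℝ, ℝ) ∞ k)
    (hf0 : ∀ x, tanD I F (F x) f x = 0) {g : ℝ → ℝ} (hg : ContDiff ℝ ∞ g) (x : M) :
    ∑ a, tanD I F (stdOrthonormalBasis ℝ V a) (fun x => k x * g (logNorm F x)) x *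
        tanD I F (stdOrthonormalBasis ℝ V a) f x =
      g (logNorm F x) * ∑ a, tanD I F (stdOrthonormalBasis ℝ V a) k x *
        tanD I F (stdOrthonormalBasis ℝ V a) f x := by
  set e := stdOrthonormalBasis ℝ V
  set D := deriv g (logNorm F x)
  have h0 : ∑ a, inner ℝ (e a) (F x) * tanD I F (e a) f x = 0 := by
    rw [← hf0 x, tanD_basis e F (F x)]
    rfl
  set q := Real.exp (-2 * logNorm F x) with hq
  have h4 : g (logNorm F x) * ∑ a, tanD I F (e a) k x * tanD I F (e a) f x =
      g (logNorm F x) * ∑ a, tanD I F (e a) k x * tanD I F (e a) f x +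
        k x * D * q * ∑ a, inner ℝ (e a) (F x) * tanD I F (e a) f x := by
    rw [h0, mul_zero, add_zero]
  rw [h4, Finset.mul_sum, Finset.mul_sum, ← Finset.sum_add_distrib]
  refine Finset.sum_congr rfl fun a _ => ?_
  rw [tanD_mul F _ hk.contMDiffAt (hM.contMDiff_comp hg).contMDiffAt, hM.tanD_comp_logNorm _ hg,
    real_inner_comm (e a) (F x)]
  ring

variable [SigmaCompactSpace M] {m : ℕ} (hm : 1 ≤ m) (hdimV : Module.finrank ℝ V = m + 2)
  (hdimE : Module.finrank ℝ E = m + 1) {δ : ℝ} (hδ : ((m : ℝ) - 1) ^ 2 / (4 * m) < δ)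
  (hst : IsDeltaStable I F δ)

include hm hdimV hdimE hδ hst

/-- The integral estimate from the test function `(f + ε) ^ (δ / 2) r ^ (-(m - 1) / 2) χ(log r)`,
where `f = |x|² |A|²`. In the proof, `S` is the integrand of the stability inequality, `Γ` that of
Green's formula for `f`, and `R` that of a radial derivative; the integrand `T` of the claim is at
most `R + δ / 2 * Γ - S`. -/
theorem integral_scaledNormSqA_rpow_le {χ Ψ : ℝ → ℝ} {θ ε : ℝ} (hχ : ContDiff ℝ ∞ χ)
    (hχs : HasCompactSupport χ) (hΨ : ContDiff ℝ ∞ Ψ) (hΨs : HasCompactSupport Ψ)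
    (hθ : θ ≤ (δ * m - ((m : ℝ) - 1) ^ 2 / 4) / 2)
    (hχΨ : ∀ t, deriv χ t ^ 2 = deriv Ψ t + θ * χ t ^ 2) (hε : 0 < ε) :
    integral I F (fun x => χ (logNorm F x) ^ 2 * Real.exp (-(m + 1 : ℝ) * logNorm F x) *
      ((δ * m - ((m : ℝ) - 1) ^ 2 / 4) / 2 / 2 * scaledNormSqA I F x ^ δ -
        δ * m * (2 * (δ * m) / ((δ * m - ((m : ℝ) - 1) ^ 2 / 4) / 2)) ^ δ * ε ^ δ)) ≤ 0 := by
  have hm0 : (0 : ℝ) < m := by exact_mod_cast hm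
  have hδ0 : 0 < δ := lt_of_le_of_lt (by positivity) hδ
  rw [div_lt_iff₀ (by positivity)] at hδ
  set c := (δ * m - ((m : ℝ) - 1) ^ 2 / 4) / 2 with hc
  have hc0 : 0 < c := by
    rw [hc]
    linarith
  -- the critical constant is at least `1 - 2 / m`; the difference is `(m - 3) ^ 2 / (4 * m)`
  have hδm : 1 - 2 / (m : ℝ) ≤ δ := by
    have h1 : (m : ℝ) * (1 - 2 / m) ≤ m * δ := by
      rw [mul_sub, mul_div_cancel₀ _ hm0.ne']
      nlinarith [sq_nonneg ((m : ℝ) - 3)]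
    exact le_of_mul_le_mul_left h1 hm0
  set f := scaledNormSqA I F with hf
  have hfs : ContMDiff I 𝓘(ℝ, ℝ) ∞ f := contMDiff_scaledNormSqA hdimV hdimE hM.immersion
  have hfnn : ∀ x, 0 ≤ f x := fun x =>
    mul_nonneg (sq_nonneg _) (normSqA_nonneg hM.immersion x)
  have hw : ∀ x, 0 < f x + ε := fun x => by linarith [hfnn x]
  have hsk := simons_kato_cone hM.immersion hM.minimal hM.conical hM.ne_zero hdimV hdimE
  have hrad : ∀ x, tanD I F (F x) f x = 0 := fun x => (hsk x).1
  -- powers of `f + ε`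
  have hpow : ∀ p : ℝ, ContMDiff I 𝓘(ℝ, ℝ) ∞ fun x => (f x + ε) ^ p := fun p x =>
    ((contDiffAt_id.add contDiffAt_const).rpow_const_of_ne
      (n := ∞) (f := fun s : ℝ => s + ε) (x := f x) (hw x).ne').contMDiffAt.comp x (hfs x)
  have hDpow : ∀ (p : ℝ) (v : V) (x : M), tanD I F v (fun x => (f x + ε) ^ p) x =
      p * (f x + ε) ^ (p - 1) * tanD I F v f x := fun p v x => by
    refine tanD_comp_real (g := fun s => (s + ε) ^ p) F v hfs.contMDiffAt ?_
    simpa using ((hasDerivAt_id' (f x)).add_const ε).rpow_const (p := p) (Or.inl (hw x).ne')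
  have hrpow : ∀ (p : ℝ) (x : M), tanD I F (F x) (fun x => (f x + ε) ^ p) x = 0 := fun p x => by
    rw [hDpow, hrad, mul_zero]
  -- the radial factor
  set η : ℝ → ℝ := fun t => Real.exp (-((m : ℝ) - 1) / 2 * t) * χ t with hη
  have hηs : ContDiff ℝ ∞ η :=
    (Real.contDiff_exp.comp (contDiff_const.mul contDiff_id)).mul hχ
  have hηc : HasCompactSupport η := hχs.mul_left
  have hη' : ∀ t, deriv η t =
      Real.exp (-((m : ℝ) - 1) / 2 * t) * (deriv χ t - ((m : ℝ) - 1) / 2 * χ t) := fun t => by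
    have h1 := (hχ.differentiable (by simp) t).hasDerivAt
    have h2 := ((hasDerivAt_id' t).const_mul (-((m : ℝ) - 1) / 2)).exp
    have h3 : HasDerivAt η _ t := h2.mul h1
    rw [h3.deriv]
    ring
  have hη2 : ContDiff ℝ ∞ fun t => η t ^ 2 := hηs.pow 2
  have hη2c : HasCompactSupport fun t => η t ^ 2 := hηc.comp_left (g := fun s => s ^ 2) (by simp)
  have hexp : ∀ t : ℝ, Real.exp (-((m : ℝ) - 1) / 2 * t) ^ 2 * Real.exp (-2 * t) =
      Real.exp (-(m + 1 : ℝ) * t) := fun t => by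
    rw [← Real.exp_nat_mul, ← Real.exp_add]
    congr 1
    push_cast
    ring
  -- stability
  set φ : M → ℝ := fun x => (f x + ε) ^ (δ / 2) * η (logNorm F x) with hφ
  have hφs : ContMDiff I 𝓘(ℝ, ℝ) ∞ φ := (hpow _).mul (hM.contMDiff_comp hηs)
  have hφc : HasCompactSupport φ := (hM.hasCompactSupport_comp hηc).mul_left
  have hφ2c : HasCompactSupport fun x => φ x ^ 2 := hφc.comp_left (g := fun s => s ^ 2) (by simp)
  have hAc : Continuous fun x => normSqA I F x * φ x ^ 2 :=
    (contMDiff_normSqA hM.finrank_eq hM.immersion).continuous.mul (hφs.continuous.pow 2)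
  have hAs : HasCompactSupport fun x => normSqA I F x * φ x ^ 2 := hφ2c.mul_left
  have hGc := (contMDiff_gradNormSq hM.immersion hφs).continuous
  have hGs := hasCompactSupport_gradNormSq hM.immersion hφc
  set S : M → ℝ := fun x => gradNormSq I F φ x - δ * (normSqA I F x * φ x ^ 2) with hS
  have hSc : Continuous S := hGc.sub (hAc.const_mul δ)
  have hSs : HasCompactSupport S := by
    have : HasCompactSupport fun x => δ * (normSqA I F x * φ x ^ 2) := hAs.mul_left
    exact hGs.sub this
  have hSint : 0 ≤ integral I F S := by
    rw [hS, integral_sub hM.immersion hGc hGs (hAc.const_mul δ) hAs.mul_left,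
      integral_const_mul F hAs]
    exact sub_nonneg.2 (hst φ hφs hφc)
  -- Green's formula
  set u : M → ℝ := fun x => (f x + ε) ^ (δ - 1) * η (logNorm F x) ^ 2 with hu
  have hus : ContMDiff I 𝓘(ℝ, ℝ) ∞ u := (hpow _).mul (hM.contMDiff_comp hη2)
  have huc : HasCompactSupport u := (hM.hasCompactSupport_comp hη2c).mul_left
  set e := stdOrthonormalBasis ℝ V
  set Γ : M → ℝ := fun x => u x * tanLaplacian I F f x +
    ∑ a, tanD I F (e a) u x * tanD I F (e a) f x with hΓ
  have hΓint : integral I F Γ = 0 := hM.integral_green hus huc hfs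
  have hΓc : Continuous Γ := by
    refine (hus.continuous.mul (continuous_finsetSum _ fun a _ => ?_)).add
      (continuous_finsetSum _ fun a _ => ?_)
    · exact (contMDiff_tanD hM.immersion _ (contMDiff_tanD hM.immersion _ hfs)).continuous
    · exact (contMDiff_tanD hM.immersion _ hus).continuous.mul
        (contMDiff_tanD hM.immersion _ hfs).continuous
  have hΓs : HasCompactSupport Γ := by
    refine HasCompactSupport.intro huc.isCompact fun x hx => ?_
    have h1 : u =ᶠ[nhds x] fun _ => 0 := notMem_tsupport_iff_eventuallyEq.1 hx
    simp only [hΓ, h1.self_of_nhds, tanD_congr F _ h1, tanD_const]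
    simp
  -- the cross term `χ χ'` and the exact part `Ψ'` of `χ' ^ 2` form a radial derivative
  set ψ : ℝ → ℝ := fun t => Ψ t - ((m : ℝ) - 1) / 2 * χ t ^ 2 with hψ
  have hψs : ContDiff ℝ ∞ ψ := hΨ.sub (contDiff_const.mul (hχ.pow 2))
  have hχ2c : HasCompactSupport fun t => χ t ^ 2 := hχs.comp_left (g := fun s => s ^ 2) (by simp)
  have hψc : HasCompactSupport ψ := by
    have : HasCompactSupport fun t => ((m : ℝ) - 1) / 2 * χ t ^ 2 := hχ2c.mul_left
    exact hΨs.sub this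
  have hψ' : ∀ t, deriv ψ t = deriv Ψ t - ((m : ℝ) - 1) * (χ t * deriv χ t) := fun t => by
    have h1 := (hχ.differentiable (by simp) t).hasDerivAt
    have h2 := (hΨ.differentiable (by simp) t).hasDerivAt
    have h3 : HasDerivAt ψ _ t := h2.sub ((h1.pow 2).const_mul (((m : ℝ) - 1) / 2))
    rw [h3.deriv]
    push_cast
    ring
  set R : M → ℝ := fun x => (f x + ε) ^ δ * (deriv ψ (logNorm F x) *
    Real.exp (-Module.finrank ℝ E * logNorm F x)) with hR
  have hRint : integral I F R = 0 := hM.integral_mul_deriv (hpow δ) (hrpow δ) hψs hψc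
  have hψ's : ContDiff ℝ ∞ (deriv ψ) := (contDiff_infty_iff_deriv.1 hψs).2
  have hRc : Continuous R := (hpow δ).continuous.mul
    ((hM.contMDiff_comp hψ's).continuous.mul
      (Real.continuous_exp.comp (continuous_const.mul hM.contMDiff_logNorm.continuous)))
  have hRs : HasCompactSupport R := by
    have : HasCompactSupport fun x => deriv ψ (logNorm F x) := hM.hasCompactSupport_comp hψc.deriv
    exact this.mul_right.mul_left
  -- the pointwise inequality
  set C := δ * m * (2 * (δ * m) / c) ^ δ with hC
  set T : M → ℝ := fun x => χ (logNorm F x) ^ 2 * Real.exp (-(m + 1 : ℝ) * logNorm F x) *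
    (c / 2 * f x ^ δ - C * ε ^ δ) with hT
  have hTc : Continuous T := by
    refine Continuous.mul ?_ ((hfs.continuous.rpow_const fun _ => Or.inr hδ0.le).const_mul _ |>.sub
      continuous_const)
    exact (hM.contMDiff_comp (hχ.pow 2)).continuous.mul
      (Real.continuous_exp.comp (continuous_const.mul hM.contMDiff_logNorm.continuous))
  have hTs : HasCompactSupport T := by
    have : HasCompactSupport fun x => χ (logNorm F x) ^ 2 := hM.hasCompactSupport_comp hχ2c
    exact this.mul_right.mul_right
  have hpt : ∀ x, T x + S x ≤ R x + δ / 2 * Γ x := fun x => by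
    obtain ⟨-, hY, hK⟩ := hsk x
    set t := logNorm F x with ht
    set w := f x + ε with hwx
    set z := w ^ (δ - 2) with hz
    have hw0 : 0 < w := hw x
    have hz0 : 0 < z := Real.rpow_pos_of_pos hw0 _
    have hwz : w ^ (δ - 1) = w * z := by
      rw [hz, mul_comm, ← Real.rpow_add_one hw0.ne']
      congr 1
      ring
    have hwz2 : w ^ δ = w ^ 2 * z := by
      rw [hz, mul_comm, ← Real.rpow_natCast w 2, ← Real.rpow_add hw0]
      congr 1
      push_cast
      ring
    have hsq : ∀ p : ℝ, (w ^ p) ^ 2 = w ^ (2 * p) := fun p => by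
      rw [← Real.rpow_natCast, ← Real.rpow_mul hw0.le]
      congr 1
      push_cast
      ring
    have hk2 : (w ^ (δ / 2)) ^ 2 = w ^ 2 * z := by
      rw [hsq, ← hwz2]
      congr 1
      ring
    have hgradk : gradNormSq I F (fun x => (f x + ε) ^ (δ / 2)) x =
        (δ / 2) ^ 2 * z * gradNormSq I F f x := by
      rw [gradNormSq_eq_sum e hM.immersion, gradNormSq_eq_sum e hM.immersion, Finset.mul_sum]
      refine Finset.sum_congr rfl fun a _ => ?_
      have h1 : z = (w ^ (δ / 2 - 1)) ^ 2 := by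
        rw [hsq, hz]
        congr 1
        ring
      rw [hDpow, h1]
      ring
    have hS' : S x = (η t ^ 2 * ((δ / 2) ^ 2 * z * gradNormSq I F f x) +
        w ^ 2 * z * deriv η t ^ 2 * Real.exp (-2 * t)) -
        δ * (normSqA I F x * (w ^ 2 * z * η t ^ 2)) := by
      have h1 := hM.gradNormSq_mul_comp (hpow (δ / 2)) (hrpow (δ / 2)) hηs x
      rw [hgradk, ← hwx, ← ht, hk2] at h1
      have h2 : φ x ^ 2 = w ^ 2 * z * η t ^ 2 := by rw [← hk2, ← mul_pow]
      change gradNormSq I F φ x - δ * (normSqA I F x * φ x ^ 2) = _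
      rw [h2, ← h1]
    have hΓ' : Γ x = w * z * η t ^ 2 * tanLaplacian I F f x +
        η t ^ 2 * ((δ - 1) * z * gradNormSq I F f x) := by
      have h0 : ∑ a, tanD I F (e a) u x * tanD I F (e a) f x = η t ^ 2 *
          ∑ a, tanD I F (e a) (fun x => (f x + ε) ^ (δ - 1)) x * tanD I F (e a) f x :=
        hM.sum_tanD_mul_comp (hpow (δ - 1)) hrad hη2 x
      have h2 : u x = w * z * η t ^ 2 := by rw [← hwz]
      change u x * tanLaplacian I F f x + ∑ a, tanD I F (e a) u x * tanD I F (e a) f x = _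
      rw [h2, h0, gradNormSq_eq_sum e hM.immersion, Finset.mul_sum _ _ ((δ - 1) * z)]
      congr 2
      refine Finset.sum_congr rfl fun a _ => ?_
      have h1 : z = w ^ (δ - 1 - 1) := by
        rw [hz]
        congr 1
        ring
      rw [hDpow, h1]
      ring
    have hq := hM.exp_neg_two_mul_norm_sq x
    have hG0 : 0 ≤ gradNormSq I F f x := by
      rw [gradNormSq_eq_sum e hM.immersion]
      exact Finset.sum_nonneg fun a _ => sq_nonneg _
    have hmain := stability_sub_green_le (h := η t) (h' := deriv η t) hδ0 hδm hε hwx rfl hq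
      (normSqA_nonneg hM.immersion x) hG0 hz0 (hfnn x) hY hK
    rw [← hS', ← hΓ'] at hmain
    set E₀ := Real.exp (-(m + 1 : ℝ) * t) with hE₀
    have hE0 : 0 < E₀ := Real.exp_pos _
    have h1 : η t ^ 2 * Real.exp (-2 * t) = E₀ * χ t ^ 2 := by
      rw [hE₀, ← hexp, hη]
      ring
    have h2 : deriv η t ^ 2 * Real.exp (-2 * t) =
        E₀ * (deriv χ t - ((m : ℝ) - 1) / 2 * χ t) ^ 2 := by
      rw [hE₀, ← hexp, hη']
      ring
    rw [h1, h2] at hmain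
    have hR' : R x = w ^ 2 * z * ((deriv Ψ t - ((m : ℝ) - 1) * (χ t * deriv χ t)) * E₀) := by
      simp only [hR]
      rw [← hwz2, hdimE, hψ']
      push_cast
      rfl
    have hge := rpow_sub_ge (B := δ * m) hδ0 hc0 (by positivity) (hfnn x) hε
    rw [← hC, ← hwx, hwz, hwz2] at hge
    have hT' : T x ≤ χ t ^ 2 * E₀ * (c * (w ^ 2 * z) - δ * m * ε * (w * z)) :=
      mul_le_mul_of_nonneg_left hge (by positivity)
    have hθ' : 0 ≤ E₀ * (w ^ 2 * z) * χ t ^ 2 * (c - θ) :=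
      mul_nonneg (by positivity) (sub_nonneg.2 hθ)
    have hΨ' : deriv Ψ t = deriv χ t ^ 2 - θ * χ t ^ 2 := by
      rw [hχΨ]
      ring
    have hcm : ((m : ℝ) - 1) ^ 2 = 4 * (δ * m - 2 * c) := by
      rw [hc]
      ring
    have hexpand : w ^ 2 * z * (E₀ * (deriv χ t - ((m : ℝ) - 1) / 2 * χ t) ^ 2) =
        w ^ 2 * z * E₀ * (deriv χ t ^ 2 - ((m : ℝ) - 1) * (χ t * deriv χ t) +
          (δ * m - 2 * c) * χ t ^ 2) := by
      have : (deriv χ t - ((m : ℝ) - 1) / 2 * χ t) ^ 2 = deriv χ t ^ 2 -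
          ((m : ℝ) - 1) * (χ t * deriv χ t) + ((m : ℝ) - 1) ^ 2 / 4 * χ t ^ 2 := by ring
      rw [this, hcm]
      ring
    rw [hexpand] at hmain
    rw [hR', hΨ']
    linarith
  have hΓδ : integral I F (fun x => δ / 2 * Γ x) = 0 := by
    rw [integral_const_mul F hΓs, hΓint, mul_zero]
  have h := integral_mono hM.immersion (hTc.add hSc) (hTs.add hSs)
    (hRc.add (hΓc.const_mul (δ / 2))) (hRs.add hΓs.mul_left) hpt
  have h1 := integral_add hM.immersion hTc hTs hSc hSs
  have h2 := integral_add hM.immersion hRc hRs (hΓc.const_mul (δ / 2)) hΓs.mul_left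
  rw [hRint, hΓδ] at h2
  change integral I F T ≤ 0
  have h3 : integral I F (T + S) ≤ integral I F (R + fun x => δ / 2 * Γ x) := h
  have h4 : integral I F (T + S) = integral I F T + integral I F S := h1
  have h5 : integral I F (R + fun x => δ / 2 * Γ x) = 0 + 0 := h2
  linarith

/-- A minimal cone which is stable beyond the critical constant is flat: otherwise, a cutoff
function that equals `1` at a point with `A ≠ 0` contradicts the integral estimate as `ε → 0`. -/
theorem isFlat_of_isDeltaStable : IsFlat I F := by
  have hm0 : (0 : ℝ) < m := by exact_mod_cast hm
  have hδ0 : 0 < δ := lt_of_le_of_lt (by positivity) hδ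
  set c := (δ * m - ((m : ℝ) - 1) ^ 2 / 4) / 2 with hc
  have hc0 : 0 < c := by
    rw [div_lt_iff₀ (by positivity)] at hδ
    rw [hc]
    linarith
  have hfnn : ∀ x, 0 ≤ scaledNormSqA I F x := fun x =>
    mul_nonneg (sq_nonneg _) (normSqA_nonneg hM.immersion x)
  refine isFlat_of_normSqA_eq_zero hM.immersion fun x₀ => ?_
  by_contra hne
  have hf0 : 0 < scaledNormSqA I F x₀ := mul_pos (pow_pos (norm_pos_iff.2 (hM.ne_zero x₀)) 2)
    (lt_of_le_of_ne (normSqA_nonneg hM.immersion x₀) (Ne.symm hne))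
  obtain ⟨χ, Ψ, θ, hχ, hχs, hχ1, hΨ, hΨs, hθ, hχΨ⟩ := exists_cutoff (logNorm F x₀) hc0
  set u : M → ℝ := fun x => χ (logNorm F x) ^ 2 * Real.exp (-(m + 1 : ℝ) * logNorm F x) with hu
  have hg : ContDiff ℝ ∞ fun t => χ t ^ 2 * Real.exp (-(m + 1 : ℝ) * t) :=
    (hχ.pow 2).mul (Real.contDiff_exp.comp (contDiff_const.mul contDiff_id))
  have hgs : HasCompactSupport fun t => χ t ^ 2 * Real.exp (-(m + 1 : ℝ) * t) := by
    have : HasCompactSupport fun t => χ t ^ 2 := hχs.comp_left (g := fun s => s ^ 2) (by simp)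
    exact this.mul_right
  have huc : Continuous u := (hM.contMDiff_comp hg).continuous
  have hus : HasCompactSupport u := hM.hasCompactSupport_comp hgs
  have hfc : Continuous fun x => scaledNormSqA I F x ^ δ :=
    (contMDiff_scaledNormSqA hdimV hdimE hM.immersion).continuous.rpow_const
      fun _ => Or.inr hδ0.le
  have hunn : ∀ x, 0 ≤ u x := fun x => mul_nonneg (sq_nonneg _) (Real.exp_pos _).le
  set P := integral I F fun x => u x * scaledNormSqA I F x ^ δ with hP
  have hPpos : 0 < P := integral_pos hM.immersion (huc.mul hfc) hus.mul_right
    (fun x => mul_nonneg (hunn x) (Real.rpow_nonneg (hfnn x) _)) (x := x₀)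
    (mul_pos (mul_pos (by rw [hχ1]; norm_num) (Real.exp_pos _)) (Real.rpow_pos_of_pos hf0 _))
  set Q := integral I F u with hQ
  have hQnn : 0 ≤ Q := integral_nonneg F hunn
  set C := δ * m * (2 * (δ * m) / c) ^ δ with hC
  have hCnn : 0 ≤ C := by positivity
  have key : ∀ ε : ℝ, 0 < ε → c / 2 * P ≤ C * ε ^ δ * Q := fun ε hε => by
    have h := hM.integral_scaledNormSqA_rpow_le hm hdimV hdimE hδ hst hχ hχs hΨ hΨs hθ hχΨ hε
    have h1 : (fun x => χ (logNorm F x) ^ 2 * Real.exp (-(m + 1 : ℝ) * logNorm F x) *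
        (c / 2 * scaledNormSqA I F x ^ δ - C * ε ^ δ)) =
        fun x => c / 2 * (u x * scaledNormSqA I F x ^ δ) - C * ε ^ δ * u x := funext fun x => by
      simp only [hu]
      ring
    rw [h1, integral_sub (f := fun x => c / 2 * (u x * scaledNormSqA I F x ^ δ))
      (g := fun x => C * ε ^ δ * u x) hM.immersion ((huc.mul hfc).const_mul (c / 2))
          hus.mul_right.mul_left
      (huc.const_mul _) hus.mul_left, integral_const_mul F hus,
      integral_const_mul F (f := fun x => u x * scaledNormSqA I F x ^ δ) hus.mul_right] at h
    linarith
  -- the error term tends to zero with `ε`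
  set s := c / 2 * P / (2 * (C * Q + 1)) with hs
  have hs0 : 0 < s := by positivity
  have h := key (s ^ δ⁻¹) (Real.rpow_pos_of_pos hs0 _)
  rw [Real.rpow_inv_rpow hs0.le hδ0.ne'] at h
  have h2 : s * (2 * (C * Q + 1)) = c / 2 * P := div_mul_cancel₀ _ (by positivity)
  have h3 : 0 ≤ C * Q := mul_nonneg hCnn hQnn
  nlinarith

end IsMinimalCone

end StableCones

/-! ### The cone over a spherical immersion -/

section ConeMap

variable {E : Type uE} [NormedAddCommGroup E] [NormedSpace ℝ E] [FiniteDimensional ℝ E]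
  {H : Type uH} [TopologicalSpace H] {I : ModelWithCorners ℝ E H} [I.Boundaryless]
  {S : Type uM} [TopologicalSpace S] [ChartedSpace H S] [IsManifold I ∞ S]
  {V : Type uV} [NormedAddCommGroup V] [InnerProductSpace ℝ V] {ξ : S → V}

theorem inChart_coneMap (ξ : S → V) (c : S × ℝ) :
    inChart (I.prod 𝓘(ℝ, ℝ)) (coneMap ξ) c =
      fun y : E × ℝ => Real.exp y.2 • inChart I ξ c.1 y.1 := by
  funext y
  simp only [inChart, Function.comp_apply, extChartAt_prod, coneMap]
  rfl

variable (hξ : IsSphericalImmersion I ξ)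
include hξ

theorem IsSphericalImmersion.norm_coneMap (z : S × ℝ) : ‖coneMap ξ z‖ = Real.exp z.2 := by
  rw [coneMap, norm_smul, hξ.2, mul_one, Real.norm_of_nonneg (Real.exp_pos _).le]

theorem IsSphericalImmersion.logNorm_coneMap (z : S × ℝ) : logNorm (coneMap ξ) z = z.2 := by
  rw [logNorm, hξ.norm_coneMap, Real.log_exp]

theorem IsSphericalImmersion.contMDiff_coneMap :
    ContMDiff (I.prod 𝓘(ℝ, ℝ)) 𝓘(ℝ, V) ∞ (coneMap ξ) :=
  (Real.contDiff_exp.contMDiff.comp contMDiff_snd).smul (hξ.1.1.comp contMDiff_fst)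

/-- The differential of the cone map in product coordinates. -/
theorem IsSphericalImmersion.fderiv_coneMap {c : S × ℝ} {y : E × ℝ}
    (hy : y.1 ∈ (extChartAt I c.1).target) (h : E) (s : ℝ) :
    fderiv ℝ (inChart (I.prod 𝓘(ℝ, ℝ)) (coneMap ξ) c) y (h, s) =
      Real.exp y.2 • (fderiv ℝ (inChart I ξ c.1) y.1 h + s • inChart I ξ c.1 y.1) := by
  have h1 : HasFDerivAt (inChart I ξ c.1) (fderiv ℝ (inChart I ξ c.1) y.1) y.1 :=
    (differentiableAt_of_contDiffOn (isOpen_extChartAt_target c.1)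
      (contDiffOn_inChart_target hξ.1.1 c.1) hy).hasFDerivAt
  have h2 : HasFDerivAt (fun y : E × ℝ => inChart I ξ c.1 y.1) _ y := h1.comp y hasFDerivAt_fst
  have h3 : HasFDerivAt (fun y : E × ℝ => Real.exp y.2) _ y := hasFDerivAt_snd.exp
  have h4 : HasFDerivAt (fun y : E × ℝ => Real.exp y.2 • inChart I ξ c.1 y.1) _ y := h3.smul h2
  rw [inChart_coneMap, h4.fderiv]
  simp [smul_smul]

theorem IsSphericalImmersion.inner_fderiv {c : S} {y : E} (hy : y ∈ (extChartAt I c).target)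
    (h : E) : inner ℝ (inChart I ξ c y) (fderiv ℝ (inChart I ξ c) y h) = 0 := by
  have h1 : DifferentiableAt ℝ (inChart I ξ c) y :=
    differentiableAt_of_contDiffOn (isOpen_extChartAt_target c) (contDiffOn_inChart_target hξ.1.1 c)
      hy
  have h2 := fderiv_inner_apply ℝ h1 h1 h
  have h3 : (fun y => inner ℝ (inChart I ξ c y) (inChart I ξ c y)) = fun _ => (1 : ℝ) :=
    funext fun y => by rw [real_inner_self_eq_norm_sq, inChart, Function.comp_apply, hξ.2, one_pow]
  rw [h3, real_inner_comm (inChart I ξ c y)] at h2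
  simp at h2
  linarith

theorem IsSphericalImmersion.isSmoothImmersion_coneMap :
    IsSmoothImmersion (I.prod 𝓘(ℝ, ℝ)) (coneMap ξ) := by
  refine ⟨hξ.contMDiff_coneMap, fun x => ?_⟩
  have h0 : Function.Injective (fderiv ℝ (inChart (I.prod 𝓘(ℝ, ℝ)) (coneMap ξ) x)
      (extChartAt (I.prod 𝓘(ℝ, ℝ)) x x)) := by
    set y := extChartAt (I.prod 𝓘(ℝ, ℝ)) x x
    have hy : y.1 ∈ (extChartAt I x.1).target := mem_extChartAt_target (I := I) x.1
    have hinj : Function.Injective (fderiv ℝ (inChart I ξ x.1) y.1) :=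
      fderiv_inChart_injective hξ.1 (mem_extChartAt_source (I := I) x.1)
    refine (injective_iff_map_eq_zero _).2 fun ⟨h, s⟩ hz => ?_
    rw [hξ.fderiv_coneMap hy, smul_eq_zero, or_iff_right (Real.exp_pos _).ne'] at hz
    have h1 := congrArg (fun w => inner ℝ (inChart I ξ x.1 y.1) w) hz
    have h2 : inner ℝ (inChart I ξ x.1 y.1) (inChart I ξ x.1 y.1) = (1 : ℝ) := by
      rw [real_inner_self_eq_norm_sq, inChart, Function.comp_apply, hξ.2, one_pow]
    simp only [inner_add_right, inner_smul_right, hξ.inner_fderiv hy, h2, inner_zero_right] at h1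
    have hs : s = 0 := by linarith
    rw [hs, zero_smul, add_zero] at hz
    rw [hs, hinj (hz.trans (map_zero _).symm)]
    rfl
  rw [(hξ.contMDiff_coneMap.mdifferentiableAt (by simp)).mfderiv,
    (I.prod 𝓘(ℝ, ℝ)).range_eq_univ, fderivWithin_univ]
  exact h0

/-- The position vector is the derivative of the cone map in the direction of the factor `ℝ`. -/
theorem IsSphericalImmersion.isConical_coneMap : IsConical (I.prod 𝓘(ℝ, ℝ)) (coneMap ξ) := by
  intro x
  have hx := mem_extChartAt_source (I := I.prod 𝓘(ℝ, ℝ)) x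
  have h1 : fderiv ℝ (inChart (I.prod 𝓘(ℝ, ℝ)) (coneMap ξ) x)
      (extChartAt (I.prod 𝓘(ℝ, ℝ)) x x) (0, 1) = coneMap ξ x := by
    rw [hξ.fderiv_coneMap (mem_extChartAt_target (I := I) x.1), map_zero, zero_add, one_smul]
    exact congrArg (fun w => Real.exp x.2 • w) (inChart_self (I := I) ξ x.1)
  have h2 := pinv_comp_apply (fderiv_inChart_injective hξ.isSmoothImmersion_coneMap hx)
    ((0, 1) : E × ℝ)
  rw [tanD, tanDeriv]
  rw [h1] at h2
  rw [h2, h1]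

/-- A minimal cone over a closed hypersurface of the sphere. -/
theorem IsSphericalImmersion.isMinimalCone [FiniteDimensional ℝ V] [CompactSpace S]
    (hmin : IsMinimal (I.prod 𝓘(ℝ, ℝ)) (coneMap ξ))
    (hdim : Module.finrank ℝ V = Module.finrank ℝ E + 2) :
    IsMinimalCone (I.prod 𝓘(ℝ, ℝ)) (coneMap ξ) where
  immersion := hξ.isSmoothImmersion_coneMap
  minimal := hmin
  conical := hξ.isConical_coneMap
  ne_zero z h := by
    have := hξ.norm_coneMap z
    rw [h, norm_zero] at this
    exact (Real.exp_pos _).ne this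
  isCompact_preimage K hK := by
    have : logNorm (coneMap ξ) ⁻¹' K = Set.univ ×ˢ K := by
      ext z
      simp [hξ.logNorm_coneMap]
    rw [this]
    exact isCompact_univ.prod hK
  finrank_eq := by
    rw [hdim, Module.finrank_prod, Module.finrank_self]

end ConeMap

/-! ### Quadratic cones -/

section QuadraticCones

variable {E : Type uE} [NormedAddCommGroup E] [NormedSpace ℝ E] [FiniteDimensional ℝ E]
  {H : Type uH} [TopologicalSpace H] {I : ModelWithCorners ℝ E H} [I.Boundaryless]
  {M : Type uM} [TopologicalSpace M] [ChartedSpace H M] [IsManifold I ∞ M]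
  {V : Type uV} [NormedAddCommGroup V] [InnerProductSpace ℝ V] [FiniteDimensional ℝ V]
  {ι : Type*} [Fintype ι]

/-- `F` is an immersed hypersurface, away from the origin, in the zero set of the quadratic form of
the self-adjoint operator `K`, where `K ^ 2 = c K + 1` and the trace of `K`, computed in the
orthonormal basis `e`, is `c`. -/
structure IsQuadraticCone (I : ModelWithCorners ℝ E H) (F : M → V) (K : V →L[ℝ] V) (c : ℝ)
    (e : OrthonormalBasis ι ℝ V) : Prop where
  immersion : IsSmoothImmersion I F
  ne_zero : ∀ x, F x ≠ 0
  finrank_eq : Module.finrank ℝ V = Module.finrank ℝ E + 1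
  symm : ∀ v w, inner ℝ (K v) w = inner ℝ v (K w)
  sq : ∀ v, K (K v) = c • K v + v
  trace : ∑ a, inner ℝ (K (e a)) (e a) = c
  inner_eq_zero : ∀ x, inner ℝ (K (F x)) (F x) = 0

/-- The unit normal of a quadratic cone. -/
def quadraticNormal (F : M → V) (K : V →L[ℝ] V) (x : M) : V := ‖F x‖⁻¹ • K (F x)

namespace IsQuadraticCone

variable {F : M → V} {K : V →L[ℝ] V} {c : ℝ} {e : OrthonormalBasis ι ℝ V}
  (hC : IsQuadraticCone I F K c e)
include hC

theorem inner_apply_apply (v : V) : inner ℝ (K v) (K v) = c * inner ℝ (K v) v + inner ℝ v v := by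
  rw [← hC.symm, hC.sq, inner_add_left, inner_smul_left]
  rfl

theorem norm_quadraticNormal (x : M) : ‖quadraticNormal F K x‖ = 1 := by
  have h := hC.inner_apply_apply (F x)
  rw [hC.inner_eq_zero, mul_zero, zero_add, real_inner_self_eq_norm_sq,
    real_inner_self_eq_norm_sq] at h
  have h1 : ‖K (F x)‖ = ‖F x‖ := (sq_eq_sq₀ (norm_nonneg _) (norm_nonneg _)).1 h
  rw [quadraticNormal, norm_smul, norm_inv, norm_norm, h1,
    inv_mul_cancel₀ (norm_ne_zero_iff.2 (hC.ne_zero x))]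

theorem contMDiff_inv_norm : ContMDiff I 𝓘(ℝ, ℝ) ∞ fun x => ‖F x‖⁻¹ := fun x =>
  ((contDiffAt_norm ℝ (hC.ne_zero x)).inv
    (norm_ne_zero_iff.2 (hC.ne_zero x))).contMDiffAt.comp x (hC.immersion.1 x)

theorem isUnitNormalOn : IsUnitNormalOn I F (quadraticNormal F K) Set.univ where
  isOpen := isOpen_univ
  contMDiffOn :=
    (hC.contMDiff_inv_norm.smul (K.contDiff.contMDiff.comp hC.immersion.1)).contMDiffOn
  norm_eq_one x _ := hC.norm_quadraticNormal x
  tanD_self x _ v := by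
    have hFx : ContMDiffAt I 𝓘(ℝ, V) ∞ F x := hC.immersion.1 x
    have hKF : ContMDiffAt I 𝓘(ℝ, V) ∞ (fun z => K (F z)) x :=
      K.contDiff.contMDiff.contMDiffAt.comp x hFx
    refine tanD_self_of_normal hC.finrank_eq hC.immersion (hC.norm_quadraticNormal x)
      (fun v => ?_) v
    have h1 := tanD_inner (I := I) F v hKF hFx
    rw [funext hC.inner_eq_zero, tanD_const, tanD_clm F v K hFx] at h1
    have h2 := hC.symm (tanD I F v F x) (F x)
    rw [real_inner_comm (K (F x))] at h2
    have h3 : inner ℝ (K (F x)) (tanD I F v F x) = (0 : ℝ) := by linarith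
    rw [quadraticNormal, inner_smul_left, h3, mul_zero]

/-- The shape operator of a quadratic cone is the tangential part of `K`, divided by the distance
to the origin. -/
theorem tanD_quadraticNormal (v : V) (x : M) :
    tanD I F v (quadraticNormal F K) x = ‖F x‖⁻¹ • (K (tanD I F v F x) -
      inner ℝ (quadraticNormal F K x) (K (tanD I F v F x)) • quadraticNormal F K x) := by
  have hν := hC.isUnitNormalOn
  have hFx : ContMDiffAt I 𝓘(ℝ, V) ∞ F x := hC.immersion.1 x
  have hKF : ContMDiffAt I 𝓘(ℝ, V) ∞ (fun z => K (F z)) x :=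
    K.contDiff.contMDiff.contMDiffAt.comp x hFx
  have hr := norm_ne_zero_iff.2 (hC.ne_zero x)
  have h1 : tanD I F v (quadraticNormal F K) x = ‖F x‖⁻¹ • K (tanD I F v F x) +
      tanD I F v (fun x => ‖F x‖⁻¹) x • K (F x) := by
    rw [← tanD_clm F v K hFx, ← tanD_smul F v hC.contMDiff_inv_norm.contMDiffAt hKF]
    rfl
  have h2 : K (F x) = ‖F x‖ • quadraticNormal F K x := by
    rw [quadraticNormal, smul_smul, mul_inv_cancel₀ hr, one_smul]
  set D := tanD I F v (fun x => ‖F x‖⁻¹) x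
  have h3 := hν.inner_tanD_normal (Set.mem_univ x) v
  rw [h1, h2, inner_add_left, inner_smul_left, inner_smul_left, inner_smul_left,
    hν.inner_self (Set.mem_univ x), real_inner_comm] at h3
  simp only [conj_trivial, mul_one] at h3
  have h4 : D * ‖F x‖ = -(‖F x‖⁻¹ * inner ℝ (quadraticNormal F K x) (K (tanD I F v F x))) := by
    linarith
  rw [h1, h2, smul_smul, h4, smul_sub, smul_smul, neg_smul, sub_eq_add_neg]

/-- On the cone, `⟪K ν, ν⟫ = c`, so that the restriction of `K` to the tangent space is trace
free. -/
theorem inner_apply_normal (x : M) :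
    inner ℝ (K (quadraticNormal F K x)) (quadraticNormal F K x) = c := by
  have h0 : inner ℝ (K (K (F x))) (K (F x)) = c * ‖F x‖ ^ 2 := by
    rw [hC.sq, inner_add_left, inner_smul_left, hC.inner_apply_apply, hC.inner_eq_zero,
      ← hC.symm, hC.inner_eq_zero, real_inner_self_eq_norm_sq]
    simp
  have hr := norm_ne_zero_iff.2 (hC.ne_zero x)
  rw [quadraticNormal, map_smul, inner_smul_left, inner_smul_right, h0, conj_trivial]
  field_simp

theorem inner_apply_tanD (v w : V) (x : M) :
    inner ℝ (K (tanD I F v F x)) w = inner ℝ (K v) w -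
      inner ℝ (quadraticNormal F K x) v * inner ℝ (K (quadraticNormal F K x)) w := by
  rw [hC.isUnitNormalOn.tanD_self x (Set.mem_univ x), map_sub, map_smul, inner_sub_left,
    inner_smul_left]
  rfl

/-- The trace of the shape operator is `(tr K - ⟪K ν, ν⟫) / |x| = 0`. -/
theorem isMinimal : IsMinimal I F := fun x => by
  have hν := hC.isUnitNormalOn
  set n := quadraticNormal F K x with hn
  have hnn : inner ℝ n n = (1 : ℝ) := hν.inner_self (Set.mem_univ x)
  have h1 : ∀ a, inner ℝ (tanD I F (e a) (quadraticNormal F K) x) (e a) =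
      ‖F x‖⁻¹ * (inner ℝ (K (e a)) (e a) - inner ℝ (K n) (e a) * inner ℝ (e a) n -
        (inner ℝ (K n) (e a) * inner ℝ (e a) n - c * (inner ℝ n (e a) * inner ℝ (e a) n))) :=
    fun a => by
    rw [hC.tanD_quadraticNormal, inner_smul_left, inner_sub_left, inner_smul_left,
      real_inner_comm _ (quadraticNormal F K x), hC.inner_apply_tanD, hC.inner_apply_tanD,
      hC.inner_apply_normal, ← hn, hC.symm (e a) n, real_inner_comm (K n) (e a),
      real_inner_comm n (e a)]
    simp only [conj_trivial]
    ring
  rw [hν.meanCurvatureVector_eq hC.immersion e (Set.mem_univ x)]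
  simp_rw [h1]
  rw [← Finset.mul_sum, Finset.sum_sub_distrib, Finset.sum_sub_distrib, Finset.sum_sub_distrib,
    ← Finset.mul_sum, e.sum_inner_mul_inner, e.sum_inner_mul_inner, hnn, hC.inner_apply_normal,
    hC.trace]
  simp

/-- As `|A|² |x|² = tr K² - 2 |K ν|² + ⟪K ν, ν⟫²`, where `K ^ 2 = c K + 1`, only the dimension
remains. -/
theorem normSqA_eq (x : M) :
    normSqA I F x = (‖F x‖⁻¹) ^ 2 * ((Module.finrank ℝ V : ℝ) - 2) := by
  have hν := hC.isUnitNormalOn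
  set n := quadraticNormal F K x with hn
  have hnn : inner ℝ n n = (1 : ℝ) := hν.inner_self (Set.mem_univ x)
  have hKn : inner ℝ (K n) n = c := hC.inner_apply_normal x
  have hKK : inner ℝ (K n) (K n) = c * c + 1 := by rw [hC.inner_apply_apply, hKn, hnn]
  have hcard : (Fintype.card ι : ℝ) = Module.finrank ℝ V := by
    rw [Module.finrank_eq_card_basis e.toBasis]
  have h1 : ∀ a, ∑ b, inner ℝ (tanD I F (e a) (quadraticNormal F K) x) (e b) ^ 2 =
      (‖F x‖⁻¹) ^ 2 * (c * inner ℝ (K (e a)) (e a) + 1 -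
        2 * (inner ℝ n (e a) * (c * inner ℝ (K n) (e a) + inner ℝ n (e a))) +
        inner ℝ n (e a) ^ 2 * (c * c + 1) -
        (inner ℝ (K n) (e a) - inner ℝ n (e a) * c) ^ 2) := fun a => by
    have h0 : ∀ w : V, ∑ b, inner ℝ w (e b) ^ 2 = (inner ℝ w w : ℝ) := fun w => by
      rw [← e.sum_inner_mul_inner]
      refine Finset.sum_congr rfl fun b _ => ?_
      rw [real_inner_comm w (e b), _root_.sq]
    have haa : inner ℝ (e a) (e a) = (1 : ℝ) := by
      rw [real_inner_self_eq_norm_sq, e.orthonormal.1 a, one_pow]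
    have h2 : inner ℝ (K (tanD I F (e a) F x)) n = inner ℝ (K n) (e a) - inner ℝ n (e a) * c := by
      rw [hC.inner_apply_tanD, ← hn, hKn, hC.symm (e a) n, real_inner_comm (K n) (e a)]
    have h3 : K (tanD I F (e a) F x) = K (e a) - inner ℝ n (e a) • K n := by
      rw [hν.tanD_self x (Set.mem_univ x), map_sub, map_smul]
    rw [h0, hC.tanD_quadraticNormal, inner_smul_left, inner_smul_right, ← hn,
      real_inner_comm (K (tanD I F (e a) F x)) n]
    simp only [inner_sub_left, inner_sub_right, inner_smul_left, inner_smul_right, conj_trivial,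
      hnn, real_inner_comm (K (tanD I F (e a) F x)) n, h2]
    have h4 : inner ℝ (K (tanD I F (e a) F x)) (K (tanD I F (e a) F x)) =
        c * inner ℝ (K (e a)) (e a) + 1 -
        2 * (inner ℝ n (e a) * (c * inner ℝ (K n) (e a) + inner ℝ n (e a))) +
        inner ℝ n (e a) ^ 2 * (c * c + 1) := by
      have h5 : inner ℝ (K n) (K (e a)) = c * inner ℝ (K n) (e a) + inner ℝ n (e a) := by
        rw [← hC.symm, hC.sq, inner_add_left, inner_smul_left]
        rfl
      rw [h3]
      simp only [inner_sub_left, inner_sub_right, inner_smul_left, inner_smul_right, conj_trivial,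
        hKK, real_inner_comm (K n) (K (e a)), h5, hC.inner_apply_apply (e a), haa]
      ring
    rw [h4]
    ring
  rw [hν.normSqA_eq hC.immersion e (Set.mem_univ x)]
  simp_rw [h1]
  rw [← Finset.mul_sum]
  congr 1
  have h2 : ∑ a, inner ℝ n (e a) * inner ℝ (e a) n = (1 : ℝ) :=
    (e.sum_inner_mul_inner _ _).trans hnn
  have h3 : ∑ a, inner ℝ (K n) (e a) * inner ℝ (e a) n = c := (e.sum_inner_mul_inner _ _).trans hKn
  have h4 : ∑ a, inner ℝ (K n) (e a) * inner ℝ (e a) (K n) = c * c + 1 :=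
    (e.sum_inner_mul_inner _ _).trans hKK
  have h5 : ∀ a, (c * inner ℝ (K (e a)) (e a) + 1 -
        2 * (inner ℝ n (e a) * (c * inner ℝ (K n) (e a) + inner ℝ n (e a))) +
        inner ℝ n (e a) ^ 2 * (c * c + 1) -
        (inner ℝ (K n) (e a) - inner ℝ n (e a) * c) ^ 2) =
      c * inner ℝ (K (e a)) (e a) + 1 - inner ℝ (K n) (e a) * inner ℝ (e a) (K n) -
        inner ℝ n (e a) * inner ℝ (e a) n := fun a => by
    rw [real_inner_comm (K n) (e a), real_inner_comm n (e a)]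
    ring
  simp_rw [h5]
  rw [Finset.sum_sub_distrib, Finset.sum_sub_distrib, Finset.sum_add_distrib, ← Finset.mul_sum, h2,
    h4, hC.trace, Finset.sum_const, Finset.card_univ, nsmul_eq_mul, hcard]
  ring

end IsQuadraticCone

end QuadraticCones

/-! ### Simons-type cones -/

section SimonsCone

variable {p q : ℕ}

/-- The space `ℝ^(p+1) × ℝ^(q+1)` with the Euclidean norm is the product of its factors. -/
def simonsEquiv (p q : ℕ) : ProdSpace p q ≃L[ℝ]
    EuclideanSpace ℝ (Fin (p + 1)) × EuclideanSpace ℝ (Fin (q + 1)) :=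
  WithLp.prodContinuousLinearEquiv 2 ℝ _ _

theorem contMDiff_coe_unitSphere (p : ℕ) :
    ContMDiff (𝓡 p) 𝓘(ℝ, EuclideanSpace ℝ (Fin (p + 1))) ∞
      fun x : UnitSphere p => (x : EuclideanSpace ℝ (Fin (p + 1))) :=
  have := Fact.mk (finrank_euclideanSpace_fin (𝕜 := ℝ) (n := p + 1))
  contMDiff_coe_sphere

theorem injective_mfderiv_coe_unitSphere {p : ℕ} (x : UnitSphere p) :
    Function.Injective (mfderiv (𝓡 p) 𝓘(ℝ, EuclideanSpace ℝ (Fin (p + 1)))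
      (fun x : UnitSphere p => (x : EuclideanSpace ℝ (Fin (p + 1)))) x) :=
  have := Fact.mk (finrank_euclideanSpace_fin (𝕜 := ℝ) (n := p + 1))
  injective_mvfderiv_subtypeVal_sphere x

/-- The operator `(x, y) ↦ (√(q / p) x, -√(p / q) y)`, whose quadratic form vanishes on the cone
`q |x|² = p |y|²`. -/
def simonsOperator (p q : ℕ) : ProdSpace p q →L[ℝ] ProdSpace p q :=
  (simonsEquiv p q).symm.toContinuousLinearMap ∘L
    ((Real.sqrt ((q : ℝ) / p) • ContinuousLinearMap.id ℝ (EuclideanSpace ℝ (Fin (p + 1)))).prodMap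
      (-(Real.sqrt ((p : ℝ) / q)) • ContinuousLinearMap.id ℝ (EuclideanSpace ℝ (Fin (q + 1))))) ∘L
    (simonsEquiv p q).toContinuousLinearMap

theorem simonsLink_fst (z : UnitSphere p × UnitSphere q) : (simonsLink p q z).fst =
    Real.sqrt ((p : ℝ) / (p + q)) • (z.1 : EuclideanSpace ℝ (Fin (p + 1))) := rfl

theorem simonsLink_snd (z : UnitSphere p × UnitSphere q) : (simonsLink p q z).snd =
    Real.sqrt ((q : ℝ) / (p + q)) • (z.2 : EuclideanSpace ℝ (Fin (q + 1))) := rfl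

theorem norm_simonsLink (hp : 1 ≤ p) (z : UnitSphere p × UnitSphere q) :
    ‖simonsLink p q z‖ = 1 := by
  have hp0 : (0 : ℝ) < p := by exact_mod_cast hp
  have h : ‖simonsLink p q z‖ ^ 2 = 1 := by
    rw [WithLp.prod_norm_sq_eq_of_L2, simonsLink_fst, simonsLink_snd, norm_smul, norm_smul,
      norm_eq_of_mem_sphere, norm_eq_of_mem_sphere, mul_one, mul_one, Real.norm_eq_abs,
      Real.norm_eq_abs, sq_abs, sq_abs, Real.sq_sqrt (by positivity), Real.sq_sqrt (by positivity)]
    field_simp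
  exact (sq_eq_sq₀ (norm_nonneg _) zero_le_one).1 (h.trans (one_pow 2).symm)

/-- The link of a Simons-type cone is immersed in the unit sphere. -/
theorem isSphericalImmersion_simonsLink (hp : 1 ≤ p) (hq : 1 ≤ q) :
    IsSphericalImmersion ((𝓡 p).prod (𝓡 q)) (simonsLink p q) := by
  have hp0 : (0 : ℝ) < p := by exact_mod_cast hp
  have hq0 : (0 : ℝ) < q := by exact_mod_cast hq
  have h1 := (contMDiff_coe_unitSphere p).comp
    (contMDiff_fst (I := 𝓡 p) (J := 𝓡 q) (N := UnitSphere q))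
  have h2 := (contMDiff_coe_unitSphere q).comp
    (contMDiff_snd (I := 𝓡 p) (J := 𝓡 q) (M := UnitSphere p))
  have hsm : ContMDiff ((𝓡 p).prod (𝓡 q)) 𝓘(ℝ, ProdSpace p q) ∞ (simonsLink p q) :=
    (simonsEquiv p q).symm.contDiff.contMDiff.comp
      (((contDiff_const_smul (Real.sqrt ((p : ℝ) / (p + q)))).contMDiff.comp h1).prodMk_space
        ((contDiff_const_smul (Real.sqrt ((q : ℝ) / (p + q)))).contMDiff.comp h2))
  refine ⟨⟨hsm, fun z => ?_⟩, norm_simonsLink hp⟩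
  -- the two factors of the link are recovered from it by linear maps
  let L1 : ProdSpace p q →L[ℝ] EuclideanSpace ℝ (Fin (p + 1)) :=
    (Real.sqrt ((p : ℝ) / (p + q)))⁻¹ • (ContinuousLinearMap.fst ℝ _ _ ∘L
        (simonsEquiv p q).toContinuousLinearMap)
  let L2 : ProdSpace p q →L[ℝ] EuclideanSpace ℝ (Fin (q + 1)) :=
    (Real.sqrt ((q : ℝ) / (p + q)))⁻¹ • (ContinuousLinearMap.snd ℝ _ _ ∘L
        (simonsEquiv p q).toContinuousLinearMap)
  have e1 : (L1 ∘ simonsLink p q) = (fun x : UnitSphere p =>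
      (x : EuclideanSpace ℝ (Fin (p + 1)))) ∘ Prod.fst :=
    funext fun z => inv_smul_smul₀ (Real.sqrt_ne_zero'.2 (by positivity)) _
  have e2 : (L2 ∘ simonsLink p q) = (fun x : UnitSphere q =>
      (x : EuclideanSpace ℝ (Fin (q + 1)))) ∘ Prod.snd :=
    funext fun z => inv_smul_smul₀ (Real.sqrt_ne_zero'.2 (by positivity)) _
  have hsmz : MDifferentiableAt ((𝓡 p).prod (𝓡 q)) 𝓘(ℝ, ProdSpace p q) (simonsLink p q) z :=
    hsm.mdifferentiableAt (by simp)
  refine (injective_iff_map_eq_zero _).2 fun v hv => ?_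
  have v1 : (mfderiv ((𝓡 p).prod (𝓡 q)) 𝓘(ℝ, EuclideanSpace ℝ (Fin (p + 1)))
      (L1 ∘ simonsLink p q) z v :
      EuclideanSpace ℝ (Fin (p + 1))) = 0 := by
    rw [mfderiv_comp z L1.mdifferentiableAt hsmz]
    change mfderiv _ _ L1 _ (mfderiv _ _ (simonsLink p q) z v) = 0
    rw [hv, map_zero]
  have v2 : (mfderiv ((𝓡 p).prod (𝓡 q)) 𝓘(ℝ, EuclideanSpace ℝ (Fin (q + 1)))
      (L2 ∘ simonsLink p q) z v :
      EuclideanSpace ℝ (Fin (q + 1))) = 0 := by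
    rw [mfderiv_comp z L2.mdifferentiableAt hsmz]
    change mfderiv _ _ L2 _ (mfderiv _ _ (simonsLink p q) z v) = 0
    rw [hv, map_zero]
  rw [e1, mfderiv_comp (I' := 𝓡 p) z ((contMDiff_coe_unitSphere p).mdifferentiableAt (by simp))
    mdifferentiableAt_fst, mfderiv_fst] at v1
  rw [e2, mfderiv_comp (I' := 𝓡 q) z ((contMDiff_coe_unitSphere q).mdifferentiableAt (by simp))
    mdifferentiableAt_snd, mfderiv_snd] at v2
  exact Prod.ext (injective_mfderiv_coe_unitSphere z.1 (v1.trans (map_zero _).symm))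
    (injective_mfderiv_coe_unitSphere z.2 (v2.trans (map_zero _).symm))

end SimonsCone

section SimonsConeGeometry

variable {p q : ℕ}

theorem sqrt_div_mul_sqrt_div (hp : 1 ≤ p) (hq : 1 ≤ q) :
    Real.sqrt ((q : ℝ) / p) * Real.sqrt ((p : ℝ) / q) = 1 := by
  have hp0 : (0 : ℝ) < p := by exact_mod_cast hp
  have hq0 : (0 : ℝ) < q := by exact_mod_cast hq
  rw [← Real.sqrt_mul (by positivity), div_mul_div_cancel₀ hp0.ne', div_self hq0.ne', Real.sqrt_one]

theorem mul_sqrt_div (hp : 1 ≤ p) (hq : 1 ≤ q) :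
    p * Real.sqrt ((q : ℝ) / p) = q * Real.sqrt ((p : ℝ) / q) := by
  have hp0 : (0 : ℝ) < p := by exact_mod_cast hp
  have h1 := sqrt_div_mul_sqrt_div hp hq
  have h2 : Real.sqrt ((q : ℝ) / p) ^ 2 * p = q := by
    rw [Real.sq_sqrt (by positivity), div_mul_cancel₀ _ hp0.ne']
  linear_combination (-(p : ℝ) * Real.sqrt ((q : ℝ) / p)) * h1 + Real.sqrt ((p : ℝ) / q) * h2

theorem inner_simonsOperator (z w : ProdSpace p q) : inner ℝ (simonsOperator p q z) w =
    Real.sqrt ((q : ℝ) / p) * inner ℝ z.fst w.fst -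
      Real.sqrt ((p : ℝ) / q) * inner ℝ z.snd w.snd := by
  rw [WithLp.prod_inner_apply]
  change inner ℝ (Real.sqrt ((q : ℝ) / p) • z.fst) w.fst +
    inner ℝ (-(Real.sqrt ((p : ℝ) / q)) • z.snd) w.snd = _
  rw [inner_smul_left, inner_smul_left]
  simp only [conj_trivial]
  ring

theorem norm_sq_coneMap_simonsLink_fst (z : (UnitSphere p × UnitSphere q) × ℝ) :
    ‖(coneMap (simonsLink p q) z).fst‖ ^ 2 = Real.exp z.2 ^ 2 * ((p : ℝ) / (p + q)) := by
  rw [coneMap, WithLp.smul_fst, simonsLink_fst, norm_smul, norm_smul, norm_eq_of_mem_sphere,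
    mul_one, mul_pow, Real.norm_eq_abs, Real.norm_eq_abs, sq_abs, sq_abs,
    Real.sq_sqrt (by positivity)]

theorem norm_sq_coneMap_simonsLink_snd (z : (UnitSphere p × UnitSphere q) × ℝ) :
    ‖(coneMap (simonsLink p q) z).snd‖ ^ 2 = Real.exp z.2 ^ 2 * ((q : ℝ) / (p + q)) := by
  rw [coneMap, WithLp.smul_snd, simonsLink_snd, norm_smul, norm_smul, norm_eq_of_mem_sphere,
    mul_one, mul_pow, Real.norm_eq_abs, Real.norm_eq_abs, sq_abs, sq_abs,
    Real.sq_sqrt (by positivity)]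

theorem coneMap_simonsLink_ne_zero (hp : 1 ≤ p) (z : (UnitSphere p × UnitSphere q) × ℝ) :
    coneMap (simonsLink p q) z ≠ 0 := by
  rw [coneMap, ← norm_ne_zero_iff, norm_smul, norm_simonsLink hp, mul_one, norm_ne_zero_iff]
  exact (Real.exp_pos _).ne'

theorem finrank_prodSpace (p q : ℕ) : Module.finrank ℝ (ProdSpace p q) = p + q + 2 := by
  rw [(simonsEquiv p q).toLinearEquiv.finrank_eq, Module.finrank_prod, finrank_euclideanSpace_fin,
    finrank_euclideanSpace_fin]
  ring

theorem isQuadraticCone_simonsLink (hp : 1 ≤ p) (hq : 1 ≤ q) :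
    IsQuadraticCone (((𝓡 p).prod (𝓡 q)).prod 𝓘(ℝ, ℝ)) (coneMap (simonsLink p q))
      (simonsOperator p q) (Real.sqrt ((q : ℝ) / p) - Real.sqrt ((p : ℝ) / q))
      ((EuclideanSpace.basisFun (Fin (p + 1)) ℝ).prod
        (EuclideanSpace.basisFun (Fin (q + 1)) ℝ)) where
  immersion := (isSphericalImmersion_simonsLink hp hq).isSmoothImmersion_coneMap
  ne_zero := coneMap_simonsLink_ne_zero hp
  finrank_eq := by
    rw [finrank_prodSpace, Module.finrank_prod, Module.finrank_prod, finrank_euclideanSpace_fin,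
      finrank_euclideanSpace_fin, Module.finrank_self]
  symm v w := by
    rw [inner_simonsOperator, real_inner_comm (simonsOperator p q w) v, inner_simonsOperator,
      real_inner_comm v.fst, real_inner_comm v.snd]
  sq v := by
    have h := sqrt_div_mul_sqrt_div hp hq
    refine (simonsEquiv p q).injective (Prod.ext ?_ ?_)
    · change Real.sqrt ((q : ℝ) / p) • Real.sqrt ((q : ℝ) / p) • v.fst =
        (Real.sqrt ((q : ℝ) / p) - Real.sqrt ((p : ℝ) / q)) • Real.sqrt ((q : ℝ) / p) • v.fst +
            v.fst
      have h' : Real.sqrt ((q : ℝ) / p) * Real.sqrt ((q : ℝ) / p) =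
          (Real.sqrt ((q : ℝ) / p) - Real.sqrt ((p : ℝ) / q)) * Real.sqrt ((q : ℝ) / p) + 1 := by
        linear_combination h
      rw [smul_smul, smul_smul, h', add_smul, one_smul]
    · change -(Real.sqrt ((p : ℝ) / q)) • -(Real.sqrt ((p : ℝ) / q)) • v.snd =
        (Real.sqrt ((q : ℝ) / p) - Real.sqrt ((p : ℝ) / q)) • -(Real.sqrt ((p : ℝ) / q)) • v.snd +
            v.snd
      have h' : -Real.sqrt ((p : ℝ) / q) * -Real.sqrt ((p : ℝ) / q) =
          (Real.sqrt ((q : ℝ) / p) - Real.sqrt ((p : ℝ) / q)) * -Real.sqrt ((p : ℝ) / q) + 1 := by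
        linear_combination h
      rw [smul_smul, smul_smul, h', add_smul, one_smul]
  trace := by
    have h := mul_sqrt_div hp hq
    simp only [Fintype.sum_sum_type, inner_simonsOperator]
    generalize Real.sqrt ((q : ℝ) / p) = α at h ⊢
    generalize Real.sqrt ((p : ℝ) / q) = β at h ⊢
    simp
    linear_combination h
  inner_eq_zero x := by
    have h := mul_sqrt_div hp hq
    rw [inner_simonsOperator, real_inner_self_eq_norm_sq, real_inner_self_eq_norm_sq,
      norm_sq_coneMap_simonsLink_fst, norm_sq_coneMap_simonsLink_snd]
    linear_combination (Real.exp x.2 ^ 2 / (p + q)) * h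

theorem isMinimalCone_simonsLink (hp : 1 ≤ p) (hq : 1 ≤ q) :
    IsMinimalCone (((𝓡 p).prod (𝓡 q)).prod 𝓘(ℝ, ℝ)) (coneMap (simonsLink p q)) := by
  refine (isSphericalImmersion_simonsLink hp hq).isMinimalCone
    (isQuadraticCone_simonsLink hp hq).isMinimal ?_
  rw [finrank_prodSpace, Module.finrank_prod, finrank_euclideanSpace_fin,
    finrank_euclideanSpace_fin]

theorem normSqA_simonsLink (hp : 1 ≤ p) (hq : 1 ≤ q) (x : (UnitSphere p × UnitSphere q) × ℝ) :
    normSqA (((𝓡 p).prod (𝓡 q)).prod 𝓘(ℝ, ℝ)) (coneMap (simonsLink p q)) x =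
      Real.exp (-2 * logNorm (coneMap (simonsLink p q)) x) * (p + q) := by
  rw [(isQuadraticCone_simonsLink hp hq).normSqA_eq, finrank_prodSpace,
    eq_inv_of_mul_eq_one_left ((isMinimalCone_simonsLink hp hq).exp_neg_two_mul_norm_sq x), inv_pow]
  push_cast
  ring

/-- Since `|A|² = (p + q) / |x|²`, stability is Hardy's inequality. -/
theorem isDeltaStable_simonsLink (hp : 1 ≤ p) (hq : 1 ≤ q) :
    IsDeltaStable (((𝓡 p).prod (𝓡 q)).prod 𝓘(ℝ, ℝ)) (coneMap (simonsLink p q))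
      (((p : ℝ) + q - 1) ^ 2 / (4 * (p + q))) := by
  intro φ hφ hs
  have hp0 : (0 : ℝ) < p := by exact_mod_cast hp
  have hM := isMinimalCone_simonsLink hp hq
  have h := hM.hardy hφ hs
  have h1 : (fun x => normSqA (((𝓡 p).prod (𝓡 q)).prod 𝓘(ℝ, ℝ)) (coneMap (simonsLink p q)) x *
      φ x ^ 2) = fun x => ((p : ℝ) + q) *
        (Real.exp (-2 * logNorm (coneMap (simonsLink p q)) x) * φ x ^ 2) := funext fun x => by
    rw [normSqA_simonsLink hp hq]
    ring
  have hs2 : HasCompactSupport fun x =>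
      Real.exp (-2 * logNorm (coneMap (simonsLink p q)) x) * φ x ^ 2 := by
    have : HasCompactSupport fun x => φ x ^ 2 := hs.comp_left (g := fun s => s ^ 2) (by simp)
    exact this.mul_left
  rw [h1, integral_const_mul _ hs2]
  refine le_trans (le_of_eq ?_) h
  rw [Module.finrank_prod, Module.finrank_prod, finrank_euclideanSpace_fin,
    finrank_euclideanSpace_fin, Module.finrank_self]
  push_cast
  have : (p : ℝ) + q ≠ 0 := by positivity
  field_simp
  ring

theorem not_isFlat_simonsLink (hp : 1 ≤ p) (hq : 1 ≤ q) :
    ¬ IsFlat (((𝓡 p).prod (𝓡 q)).prod 𝓘(ℝ, ℝ)) (coneMap (simonsLink p q)) := by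
  intro h
  have hp0 : (0 : ℝ) < p := by exact_mod_cast hp
  have hs : ∀ k : ℕ, Nonempty (UnitSphere k) := fun k =>
    ⟨⟨EuclideanSpace.single 0 1, by simp⟩⟩
  obtain ⟨a⟩ := hs p
  obtain ⟨b⟩ := hs q
  have h1 := normSqA_eq_zero_of_isFlat
    (isSphericalImmersion_simonsLink hp hq).isSmoothImmersion_coneMap h ((a, b), 0)
  rw [normSqA_simonsLink hp hq] at h1
  have : 0 < Real.exp (-2 * logNorm (coneMap (simonsLink p q)) ((a, b), 0)) * ((p : ℝ) + q) := by
    positivity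
  exact this.ne' h1

end SimonsConeGeometry

/-! ### Embeddedness of the Simons-type cones -/

section SimonsConeTopology

variable {p q : ℕ}

/-- The radial projection to the unit sphere. -/
def sphereProj {k : ℕ} (x : EuclideanSpace ℝ (Fin (k + 1))) (hx : x ≠ 0) : UnitSphere k :=
  ⟨‖x‖⁻¹ • x, by
    rw [mem_sphere_zero_iff_norm, norm_smul, norm_inv, norm_norm,
      inv_mul_cancel₀ (norm_ne_zero_iff.2 hx)]⟩

theorem sphereProj_smul {k : ℕ} {r : ℝ} (hr : 0 < r) (x : UnitSphere k)
    (hx : r • (x : EuclideanSpace ℝ (Fin (k + 1))) ≠ 0) :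
    sphereProj (r • (x : EuclideanSpace ℝ (Fin (k + 1)))) hx = x := by
  refine Subtype.ext ?_
  simp only [sphereProj, norm_smul, norm_eq_of_mem_sphere, mul_one, Real.norm_of_nonneg hr.le]
  exact inv_smul_smul₀ hr.ne' _

theorem coneMap_simonsLink_fst (z : (UnitSphere p × UnitSphere q) × ℝ) :
    (coneMap (simonsLink p q) z).fst = (Real.exp z.2 * Real.sqrt ((p : ℝ) / (p + q))) •
      (z.1.1 : EuclideanSpace ℝ (Fin (p + 1))) := by
  rw [coneMap, WithLp.smul_fst, simonsLink_fst, smul_smul]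

theorem coneMap_simonsLink_snd (z : (UnitSphere p × UnitSphere q) × ℝ) :
    (coneMap (simonsLink p q) z).snd = (Real.exp z.2 * Real.sqrt ((q : ℝ) / (p + q))) •
      (z.1.2 : EuclideanSpace ℝ (Fin (q + 1))) := by
  rw [coneMap, WithLp.smul_snd, simonsLink_snd, smul_smul]

/-- A Simons-type cone is embedded: a point of it is recovered from its two components by radial
projection, and from its norm. -/
theorem isEmbedding_coneMap_simonsLink (hp : 1 ≤ p) (hq : 1 ≤ q) :
    Topology.IsEmbedding (coneMap (simonsLink p q)) := by
  have hp0 : (0 : ℝ) < p := by exact_mod_cast hp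
  have hq0 : (0 : ℝ) < q := by exact_mod_cast hq
  have hξ := isSphericalImmersion_simonsLink hp hq
  have hpos1 : ∀ t : ℝ, 0 < Real.exp t * Real.sqrt ((p : ℝ) / (p + q)) := fun t => by positivity
  have hpos2 : ∀ t : ℝ, 0 < Real.exp t * Real.sqrt ((q : ℝ) / (p + q)) := fun t => by positivity
  have h1 : ∀ z, (coneMap (simonsLink p q) z).fst ≠ 0 := fun z => by
    rw [coneMap_simonsLink_fst]
    exact smul_ne_zero (hpos1 _).ne' (ne_zero_of_mem_unit_sphere z.1.1)
  have h2 : ∀ z, (coneMap (simonsLink p q) z).snd ≠ 0 := fun z => by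
    rw [coneMap_simonsLink_snd]
    exact smul_ne_zero (hpos2 _).ne' (ne_zero_of_mem_unit_sphere z.1.2)
  let f : (UnitSphere p × UnitSphere q) × ℝ → {w : ProdSpace p q // w.fst ≠ 0 ∧ w.snd ≠ 0} :=
    fun z => ⟨coneMap (simonsLink p q) z, h1 z, h2 z⟩
  let g : {w : ProdSpace p q // w.fst ≠ 0 ∧ w.snd ≠ 0} → (UnitSphere p × UnitSphere q) × ℝ :=
    fun w => ((sphereProj w.1.fst w.2.1, sphereProj w.1.snd w.2.2), Real.log ‖w.1‖)
  have hfc : Continuous f := hξ.contMDiff_coneMap.continuous.subtype_mk _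
  have hfst : Continuous fun w : {w : ProdSpace p q // w.fst ≠ 0 ∧ w.snd ≠ 0} => w.1.fst :=
    continuous_fst.comp ((simonsEquiv p q).continuous.comp continuous_subtype_val)
  have hsnd : Continuous fun w : {w : ProdSpace p q // w.fst ≠ 0 ∧ w.snd ≠ 0} => w.1.snd :=
    continuous_snd.comp ((simonsEquiv p q).continuous.comp continuous_subtype_val)
  have hgc : Continuous g := by
    refine (Continuous.prodMk (Continuous.subtype_mk ?_ _) (Continuous.subtype_mk ?_ _)).prodMk ?_
    · exact (hfst.norm.inv₀ fun w => norm_ne_zero_iff.2 w.2.1).smul hfst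
    · exact (hsnd.norm.inv₀ fun w => norm_ne_zero_iff.2 w.2.2).smul hsnd
    · refine continuous_subtype_val.norm.log fun w => norm_ne_zero_iff.2 fun h => w.2.1 ?_
      rw [h]
      rfl
  have hgf : Function.LeftInverse g f := fun z => by
    refine Prod.ext (Prod.ext ?_ ?_) (hξ.logNorm_coneMap z)
    · have := sphereProj_smul (hpos1 z.2) z.1.1
        (smul_ne_zero (hpos1 _).ne' (ne_zero_of_mem_unit_sphere z.1.1))
      simpa only [g, f, coneMap_simonsLink_fst] using this
    · have := sphereProj_smul (hpos2 z.2) z.1.2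
        (smul_ne_zero (hpos2 _).ne' (ne_zero_of_mem_unit_sphere z.1.2))
      simpa only [g, f, coneMap_simonsLink_snd] using this
  exact Topology.IsEmbedding.subtypeVal.comp (hgf.isEmbedding hgc hfc)

theorem range_coneMap_simonsLink (hp : 1 ≤ p) (hq : 1 ≤ q) :
    Set.range (coneMap (simonsLink p q)) = simonsCone p q \ {0} := by
  have hp0 : (0 : ℝ) < p := by exact_mod_cast hp
  have hq0 : (0 : ℝ) < q := by exact_mod_cast hq
  refine Set.Subset.antisymm ?_ fun w hw => ?_
  · rintro _ ⟨z, rfl⟩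
    refine ⟨?_, coneMap_simonsLink_ne_zero hp z⟩
    rw [simonsCone, Set.mem_ofPred_eq, norm_sq_coneMap_simonsLink_fst,
      norm_sq_coneMap_simonsLink_snd]
    ring
  · obtain ⟨hw1, hw0⟩ := hw
    rw [Set.mem_singleton_iff, ← norm_eq_zero] at hw0
    rw [simonsCone, Set.mem_ofPred_eq] at hw1
    have hn := WithLp.prod_norm_sq_eq_of_L2 w
    have hwpos : 0 < ‖w‖ := lt_of_le_of_ne (norm_nonneg _) (Ne.symm hw0)
    have h1 : ‖w.fst‖ = ‖w‖ * Real.sqrt ((p : ℝ) / (p + q)) := by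
      rw [← sq_eq_sq₀ (norm_nonneg _) (by positivity), mul_pow, Real.sq_sqrt (by positivity), hn]
      field_simp
      linarith
    have h2 : ‖w.snd‖ = ‖w‖ * Real.sqrt ((q : ℝ) / (p + q)) := by
      rw [← sq_eq_sq₀ (norm_nonneg _) (by positivity), mul_pow, Real.sq_sqrt (by positivity), hn]
      field_simp
      linarith
    have hf : w.fst ≠ 0 := norm_ne_zero_iff.1 (by rw [h1]; positivity)
    have hs : w.snd ≠ 0 := norm_ne_zero_iff.1 (by rw [h2]; positivity)
    refine ⟨((sphereProj w.fst hf, sphereProj w.snd hs), Real.log ‖w‖),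
      (simonsEquiv p q).injective (Prod.ext ?_ ?_)⟩
    · change (coneMap (simonsLink p q) _).fst = w.fst
      rw [coneMap_simonsLink_fst, Real.exp_log hwpos, ← h1]
      exact smul_inv_smul₀ (norm_ne_zero_iff.2 hf) _
    · change (coneMap (simonsLink p q) _).snd = w.snd
      rw [coneMap_simonsLink_snd, Real.exp_log hwpos, ← h2]
      exact smul_inv_smul₀ (norm_ne_zero_iff.2 hs) _

end SimonsConeTopology

end DeltaStable

end

theorem mainTheorem4 (n : ℕ) (hn : 2 ≤ n) :
    (∀ (δ : ℝ), ((n : ℝ) - 2) ^ 2 / (4 * ((n : ℝ) - 1)) < δ →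
      ∀ (V : Type*) [NormedAddCommGroup V] [InnerProductSpace ℝ V] [FiniteDimensional ℝ V],
        Module.finrank ℝ V = n + 1 →
      ∀ (E : Type*) [NormedAddCommGroup E] [NormedSpace ℝ E] [FiniteDimensional ℝ E],
        Module.finrank ℝ E + 1 = n →
      ∀ (H : Type*) [TopologicalSpace H] (I : ModelWithCorners ℝ E H) [I.Boundaryless]
        (S : Type*) [TopologicalSpace S] [ChartedSpace H S] [IsManifold I ∞ S]
        [CompactSpace S] [T2Space S] (ξ : S → V),
        DeltaStable.IsSphericalImmersion I ξ →
        DeltaStable.IsMinimal (I.prod 𝓘(ℝ, ℝ)) (DeltaStable.coneMap ξ) →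
        DeltaStable.IsDeltaStable (I.prod 𝓘(ℝ, ℝ)) (DeltaStable.coneMap ξ) δ →
        DeltaStable.IsFlat (I.prod 𝓘(ℝ, ℝ)) (DeltaStable.coneMap ξ)) ∧
    (∀ p q : ℕ, 1 ≤ p → 1 ≤ q → p + q + 1 = n →
      DeltaStable.IsSphericalImmersion ((𝓡 p).prod (𝓡 q)) (DeltaStable.simonsLink p q) ∧
      Topology.IsEmbedding (DeltaStable.coneMap (DeltaStable.simonsLink p q)) ∧
      Set.range (DeltaStable.coneMap (DeltaStable.simonsLink p q)) =
        DeltaStable.simonsCone p q \ {0} ∧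
      DeltaStable.IsMinimal (((𝓡 p).prod (𝓡 q)).prod 𝓘(ℝ, ℝ))
        (DeltaStable.coneMap (DeltaStable.simonsLink p q)) ∧
      DeltaStable.IsDeltaStable (((𝓡 p).prod (𝓡 q)).prod 𝓘(ℝ, ℝ))
        (DeltaStable.coneMap (DeltaStable.simonsLink p q))
        (((n : ℝ) - 2) ^ 2 / (4 * ((n : ℝ) - 1))) ∧
      ¬ DeltaStable.IsFlat (((𝓡 p).prod (𝓡 q)).prod 𝓘(ℝ, ℝ))
        (DeltaStable.coneMap (DeltaStable.simonsLink p q))) := by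
  have hn0 : (2 : ℝ) ≤ n := by exact_mod_cast hn
  refine ⟨?_, ?_⟩
  · intro δ hδ V _ _ _ hV E _ _ _ hE H _ I _ S _ _ _ _ _ ξ hξ hmin hst
    obtain ⟨m, rfl⟩ : ∃ m, n = m + 1 := ⟨n - 1, by omega⟩
    have hdimE : Module.finrank ℝ E = m := by omega
    have hM := hξ.isMinimalCone hmin (by omega)
    refine hM.isFlat_of_isDeltaStable (m := m) (by omega) (by omega) ?_ ?_ hst
    · rw [Module.finrank_prod, Module.finrank_self, hdimE]
    · convert hδ using 2 <;> push_cast <;> ring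
  · intro p q hp hq hpq
    refine ⟨DeltaStable.isSphericalImmersion_simonsLink hp hq,
      DeltaStable.isEmbedding_coneMap_simonsLink hp hq,
      DeltaStable.range_coneMap_simonsLink hp hq,
      (DeltaStable.isQuadraticCone_simonsLink hp hq).isMinimal, ?_,
      DeltaStable.not_isFlat_simonsLink hp hq⟩
    convert DeltaStable.isDeltaStable_simonsLink hp hq using 1
    rw [← hpq]
    push_cast
    ring
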